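/- **Setting.** Let $\Omega=(0,1)^2$, $1\le p,q\le 2$, $\nu_1,\nu_2\ge 0$, $f\in L_2(\Omega)$, and let $m\ge1$, $J\ge 1$ be integers. Let $B_m$ be the B-spline of order $m$ (the $m$-fold convolution of $\chi_{[0,1]}$ with itself), translated by $-\lfloor m/2\rfloor$, and $\phi=B_m\otimes B_m$. For $0\le l\le m$ let $q_l$ be the finitely supported sequence with $\sum_k q_l[k]z^k=\sigma_l\,2^{-m}\sqrt{\tbinom ml}\;z^{-\lfloor m/2\rfloor}(1-z)^l(1+z)^{m-l}$, where $\sigma_0=1$ and $\sigma_l=(-1)^{l+1}$ for $l\ge1$. For a band $b=(b_1,b_2)\in\{0,\dots,m\}^2$ put $\mathbf q^{(b)}=q_{b_1}\otimes q_{b_2}$, $\psi_b=4\sum_{\mathbf k\in\mathbb Z^2}\mathbf q^{(b)}[\mathbf k]\phi(2\cdot-\mathbf k)$ (tensor-product B-spline framelets), let $\varphi_b$ be the compactly supported function with $\partial^b\varphi_b=\psi_b$, and $c_b=\int\varphi_b$. For bands $a,b$ let $\varphi_{ab}$ be the compactly supported function with $(\partial^a\varphi_{ab})(z)=4c_b^{-1}\sum_{\mathbf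 r}\mathbf q^{(a)}[\mathbf r]\varphi_b(2z-\mathbf r/2)$, and $c_{ab}=\int\varphi_{ab}$. Choose bands $\beta_1,\dots,\beta_J\in\{0,\dots,m\}^2\setminus\{(0,0)\}$; put $D_j=\partial^{\beta_j}$, $s_j=|\beta_j|$, $s=\max_j s_j$, $\mathbf D'u=(D_ju)_{j}$, $\mathbf D''v=(D_iv_j)_{i,j}$. For $n\in\mathbb N$ put $\phi_{n,\mathbf k}=2^n\phi(2^n\cdot-\mathbf k)$, $\varphi_{b,n-1,\mathbf k}=2^{n-2}\varphi_b(2^{n-1}\cdot-\mathbf k/2)$, $\mathbf M_n=\{\mathbf k\in\mathbb Z^2:\operatorname{supp}\phi_{n,\mathbf k}\subset\overline\Omega\}$, and, for a fixed integer $C\ge2$, let $\mathbf K_n$ be the set of $\mathbf k\in\mathbf M_n$ with $\mathbf k+C\operatorname{supp}\mathbf q^{(b)}\subset\mathbf M_n$ for $b\in\{(0,0),\beta_1,\dots,\beta_J\}$. Define $$(\mathbf T_nu)[\mathbf k]=2^n\int_\Omega u\,\phi_{n,\mathbf k},\qquad (\mathbf S_nv)[j;\mathbf k]=2^n\int_\Omega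 v_j\,c_{\beta_j}^{-1}\varphi_{\beta_j,n-1,\mathbf k},$$ $$(\mathbf W_n'\mathbf u)[j;\mathbf k]=c_{\beta_j}^{-1}(-1)^{s_j}2^{(n-1)s_j}\sum_{\mathbf l}\mathbf q^{(\beta_j)}[\mathbf l-\mathbf k]\mathbf u[\mathbf l],\qquad (\mathbf W_n''\mathbf v)[i,j;\mathbf k]=c_{\beta_i\beta_j}^{-1}(-1)^{s_i}2^{(n-2)s_i}\sum_{\mathbf l}\mathbf q^{(\beta_i)}[\mathbf l-\mathbf k]\mathbf v[j;\mathbf l],$$ and $\|\mathbf a\|_{\ell_r(\mathbf K_n;\ell_2)}=\bigl(2^{-2n}\sum_{\mathbf k\in\mathbf K_n}(\sum_i|\mathbf a_i[\mathbf k]|^2)^{r/2}\bigr)^{1/r}$. Let $A:L_2(\Omega)\to L_2(\Omega)$ and $\mathbf A_n:\mathbb R^{\mathbf K_n}\to\mathbb R^{\mathbf K_n}$ be linear with $\lim_{n}\|\mathbf T_nAu-\mathbf A_n\mathbf T_nu\|_{\ell_2(\mathbf K_n)}=0$ for all $u\in L_2(\Omega)$. On $W_{2s}^p(\Omega)\times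 W_s^q(\Omega;\mathbb R^J)$ define $$E_n(u,v)=\nu_1\|\mathbf W_n'\mathbf T_nu-\mathbf S_nv\|^p_{\ell_p(\mathbf K_n;\ell_2)}+\nu_2\|\mathbf W_n''\mathbf S_nv\|^q_{\ell_q(\mathbf K_n;\ell_2)}+\tfrac12\|\mathbf A_n\mathbf T_nu-\mathbf T_nf\|^2_{\ell_2(\mathbf K_n)},$$ $$E(u,v)=\nu_1\|\mathbf D'u-v\|^p_{L_p(\Omega;\ell_2)}+\nu_2\|\mathbf D''v\|^q_{L_q(\Omega;\ell_2)}+\tfrac12\|Au-f\|^2_{L_2(\Omega)}.$$ For $\epsilon\ge0$, a point $x^\star$ is an $\epsilon$-optimal solution of a functional $F$ if $F(x^\star)\le\inf F+\epsilon$; a $0$-optimal solution is called a minimizer. **Corollary 3.2.** Let $\epsilon>0$ and, for every $n$, let $(u_n^\star,v_n^\star)\in W_{2s}^p(\Omega)\times W_s^q(\Omega;\mathbb R^J)$ be an $\epsilon$-optimal solution of $E_n$. Then every cluster point $(u^\star,v^\star)$ of the sequence $(u_n^\star,v_n^\star)_n$ in $W_{2s}^p(\Omega)\times W_s^q(\Omega;\mathbb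 R^J)$ is an $\epsilon$-optimal solution of $E$. In particular, if $(u_n^\star,v_n^\star)$ is a minimizer of $E_n$ for every $n$, then every cluster point of the sequence is a minimizer of $E$. -/

import Mathlib

open MeasureTheory Filter Topology
open scoped ENNReal NNReal ContDiff Polynomial

namespace WaveletFrame

noncomputable section

/-! ### The domain and Sobolev spaces -/

/-- The open unit square `Ω = (0,1)²`. -/
def Omega : Set (ℝ × ℝ) := Set.Ioo 0 1 ×ˢ Set.Ioo 0 1

/-- Lebesgue measure on `Ω`. -/
abbrev volOmega : Measure (ℝ × ℝ) := volume.restrict Omega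

/-- The partial derivative `∂^α = ∂₁^{α₁} ∂₂^{α₂}` of a function on the plane. -/
def partialDeriv (α : ℕ × ℕ) (η : ℝ × ℝ → ℝ) : ℝ × ℝ → ℝ :=
  (fun g x => fderiv ℝ g x (1, 0))^[α.1] ((fun g x => fderiv ℝ g x (0, 1))^[α.2] η)

/-- `g` is the weak derivative `∂^α u` on `Ω`. -/
def IsWeakDeriv (α : ℕ × ℕ) (u g : ℝ × ℝ → ℝ) : Prop :=
  ∀ η : ℝ × ℝ → ℝ, ContDiff ℝ ∞ η → HasCompactSupport η → tsupport η ⊆ Omega →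
    ∫ x in Omega, u x * partialDeriv α η x =
      (-1) ^ (α.1 + α.2) * ∫ x in Omega, g x * η x

/-- The multi-indices of order at most `k`. -/
def multiIndices (k : ℕ) : Finset (ℕ × ℕ) :=
  (Finset.range (k + 1) ×ˢ Finset.range (k + 1)).filter fun α => α.1 + α.2 ≤ k

theorem mem_multiIndices {k : ℕ} {α : ℕ × ℕ} : α ∈ multiIndices k ↔ α.1 + α.2 ≤ k := by
  simp only [multiIndices, Finset.mem_filter, Finset.mem_product, Finset.mem_range]
  omega

theorem contDiff_iterate_fderiv (v : ℝ × ℝ) (a : ℕ) {η : ℝ × ℝ → ℝ} (h : ContDiff ℝ ∞ η) :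
    ContDiff ℝ ∞ ((fun g x => fderiv ℝ g x v)^[a] η) := by
  induction a generalizing η with
  | zero => exact h
  | succ a ih =>
    rw [Function.iterate_succ_apply]
    exact ih ((h.fderiv_right (m := ∞) (by simp)).clm_apply contDiff_const)

theorem hasCompactSupport_iterate_fderiv (v : ℝ × ℝ) (a : ℕ) {η : ℝ × ℝ → ℝ}
    (h : HasCompactSupport η) : HasCompactSupport ((fun g x => fderiv ℝ g x v)^[a] η) := by
  induction a generalizing η with
  | zero => exact h
  | succ a ih =>
    rw [Function.iterate_succ_apply]
    exact ih (h.fderiv_apply (𝕜 := ℝ) v)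

theorem volOmega_lt_top : volume Omega < ⊤ := by
  rw [Omega, Measure.volume_eq_prod, Measure.prod_prod]
  simp

instance isFiniteMeasure_volOmega : IsFiniteMeasure volOmega :=
  ⟨by simpa using volOmega_lt_top⟩

theorem integrable_mul_of_test {p : ℝ≥0∞} (hp : 1 ≤ p) (u : Lp ℝ p volOmega) {η : ℝ × ℝ → ℝ}
    (h : Continuous η) (hc : HasCompactSupport η) :
    Integrable (fun x => u x * η x) volOmega := by
  obtain ⟨c, hcb⟩ := h.bounded_above_of_compact_support hc
  exact ((Lp.memLp u).integrable hp).mul_bdd (c := c) h.aestronglyMeasurable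
    (Eventually.of_forall hcb)

theorem integrable_mul_partialDeriv {p : ℝ≥0∞} (hp : 1 ≤ p) (u : Lp ℝ p volOmega) (α : ℕ × ℕ)
    {η : ℝ × ℝ → ℝ} (h : ContDiff ℝ ∞ η) (hc : HasCompactSupport η) :
    Integrable (fun x => u x * partialDeriv α η x) volOmega :=
  integrable_mul_of_test hp u
    (contDiff_iterate_fderiv _ _ (contDiff_iterate_fderiv _ _ h)).continuous
    (hasCompactSupport_iterate_fderiv _ _ (hasCompactSupport_iterate_fderiv _ _ hc))

/-- The Sobolev space `W_k^p(Ω)`. A function `u ∈ L_p(Ω)` whose weak derivatives `∂^α u` of order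
`|α| ≤ k` lie in `L_p(Ω)` is recorded together with these (unique) derivatives, as the family
`(∂^α u)_{|α| ≤ k}`; the norm inherited from the `ℓ_p`-product is the usual Sobolev norm
`(∑_{|α| ≤ k} ‖∂^α u‖_{L_p}^p)^{1/p}`. -/
def Sobolev (k : ℕ) (p : ℝ≥0∞) [hp : Fact (1 ≤ p)] :
    Submodule ℝ (PiLp p fun _ : multiIndices k => Lp ℝ p volOmega) where
  carrier := {U | ∀ α : multiIndices k,
    IsWeakDeriv α (U ⟨0, mem_multiIndices.2 (by simp)⟩) (U α)}
  zero_mem' := by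
    intro α η _ _ _
    have h0 : ((0 : Lp ℝ p volOmega) : ℝ × ℝ → ℝ) =ᵐ[volOmega] 0 := Lp.coeFn_zero _ _ _
    have key : ∀ θ : ℝ × ℝ → ℝ,
        ∫ x in Omega, (0 : Lp ℝ p volOmega) x * θ x = 0 := by
      intro θ
      rw [integral_congr_ae (g := fun _ => (0 : ℝ)), integral_zero]
      filter_upwards [h0] with x hx
      rw [hx, Pi.zero_apply, zero_mul]
    rw [PiLp.zero_apply, PiLp.zero_apply, key, key, mul_zero]
  add_mem' := by
    intro U V hU hV α η h1 h2 h3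
    have key : ∀ (a b : Lp ℝ p volOmega) (θ : ℝ × ℝ → ℝ),
        Integrable (fun x => a x * θ x) volOmega → Integrable (fun x => b x * θ x) volOmega →
        ∫ x in Omega, (a + b : Lp ℝ p volOmega) x * θ x =
          (∫ x in Omega, a x * θ x) + ∫ x in Omega, b x * θ x := by
      intro a b θ ha hb
      rw [← integral_add ha hb]
      refine integral_congr_ae ?_
      filter_upwards [Lp.coeFn_add a b] with x hx
      rw [hx, Pi.add_apply]
      ring
    simp only [PiLp.add_apply]
    rw [key _ _ _ (integrable_mul_partialDeriv hp.out _ _ h1 h2)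
      (integrable_mul_partialDeriv hp.out _ _ h1 h2),
      key _ _ _ (integrable_mul_of_test hp.out _ h1.continuous h2)
      (integrable_mul_of_test hp.out _ h1.continuous h2), hU α η h1 h2 h3, hV α η h1 h2 h3]
    ring
  smul_mem' := by
    intro c U hU α η h1 h2 h3
    have key : ∀ (a : Lp ℝ p volOmega) (θ : ℝ × ℝ → ℝ),
        ∫ x in Omega, (c • a : Lp ℝ p volOmega) x * θ x = c * ∫ x in Omega, a x * θ x := by
      intro a θ
      rw [← integral_const_mul]
      refine integral_congr_ae ?_
      filter_upwards [Lp.coeFn_smul c a] with x hx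
      rw [hx, Pi.smul_apply, smul_eq_mul]
      ring
    simp only [PiLp.smul_apply]
    rw [key, key, hU α η h1 h2 h3]
    ring

/-- The weak derivative `∂^α u` of `u ∈ W_k^p(Ω)`, `|α| ≤ k`, as a function. -/
def sobolevDeriv {k : ℕ} {p : ℝ≥0∞} [Fact (1 ≤ p)] (u : Sobolev k p) (α : ℕ × ℕ)
    (h : α.1 + α.2 ≤ k) : ℝ × ℝ → ℝ :=
  (u : PiLp p fun _ : multiIndices k => Lp ℝ p volOmega) ⟨α, mem_multiIndices.2 h⟩

/-- The function underlying `u ∈ W_k^p(Ω)`. -/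
def sobolevFun {k : ℕ} {p : ℝ≥0∞} [Fact (1 ≤ p)] (u : Sobolev k p) : ℝ × ℝ → ℝ :=
  sobolevDeriv u 0 (by simp)

/-! ### B-spline framelets -/

/-- The univariate cardinal B-spline of order `m ≥ 1`, supported on `[0, m]`. -/
def cardinalBSpline : ℕ → ℝ → ℝ
  | 0 => 0
  | 1 => Set.indicator (Set.Icc 0 1) 1
  | m + 2 => fun x => ∫ t in (x - 1)..x, cardinalBSpline (m + 1) t

/-- The refinable B-spline of order `m`: centred at `0` for even `m`, at `1/2` for odd `m`. -/
def bspline (m : ℕ) (x : ℝ) : ℝ := cardinalBSpline m (x + (m / 2 : ℕ))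

/-- The univariate B-spline tight frame masks `q_0, …, q_m` of order `m`: with `z = e^{-iξ}`,
the Fourier series of `q_l` is `± 2^{-m} √(m choose l) z^{-⌊m/2⌋} (1 - z)^l (1 + z)^{m-l}`.
The mask `q_0` is the refinement mask. -/
def mask (m l : ℕ) (k : ℤ) : ℝ :=
  if 0 ≤ k + (m / 2 : ℕ) then
    (if l = 0 then 1 else (-1) ^ (l + 1)) * √(m.choose l) / 2 ^ m *
      ((1 - Polynomial.X) ^ l * (1 + Polynomial.X) ^ (m - l) : ℝ[X]).coeff
        (k + (m / 2 : ℕ)).toNat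
  else 0

/-- The univariate framelet `ψ_l = 2 ∑_k q_l[k] φ(2 · - k)`; `ψ_0 = φ`. -/
def framelet (m l : ℕ) (x : ℝ) : ℝ := 2 * ∑' k : ℤ, mask m l k * bspline m (2 * x - k)

/-- The primitive `x ↦ ∫_{-∞}^x f`. -/
def primitive (f : ℝ → ℝ) (x : ℝ) : ℝ := ∫ t in Set.Iic x, f t

/-- The compactly supported function `φ_l` whose `l`-th derivative is the framelet `ψ_l`. -/
def varphi (m l : ℕ) : ℝ → ℝ := primitive^[l] (framelet m l)

/-- The compactly supported function whose `a`-th derivative is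
`z ↦ 2 ∑_r q_a[r] φ_b(2 z - r/2)`. -/
def varphiPair (m a b : ℕ) : ℝ → ℝ :=
  primitive^[a] fun z => 2 * ∑' r : ℤ, mask m a r * varphi m b (2 * z - r / 2)

/-- Tensor product of two univariate functions. -/
def tensor (f g : ℝ → ℝ) (x : ℝ × ℝ) : ℝ := f x.1 * g x.2

/-- The tensor-product mask `q^{(b)}` of the band `b`, `0 ≤ b₁, b₂ ≤ m`. -/
def mask₂ (m : ℕ) (b : ℕ × ℕ) (k : ℤ × ℤ) : ℝ := mask m b.1 k.1 * mask m b.2 k.2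

/-- The tensor-product refinable function `φ`. -/
def phi₂ (m : ℕ) : ℝ × ℝ → ℝ := tensor (bspline m) (bspline m)

/-- The compactly supported function `φ_b` with `∂^b φ_b = ψ_b`, where `ψ_b = ψ_{b₁} ⊗ ψ_{b₂}`. -/
def varphi₂ (m : ℕ) (b : ℕ × ℕ) : ℝ × ℝ → ℝ := tensor (varphi m b.1) (varphi m b.2)

/-- `c_b = ∫ φ_b`. -/
def cst (m : ℕ) (b : ℕ × ℕ) : ℝ := ∫ x, varphi₂ m b x

/-- The compactly supported function `φ_{ab}` with
`(∂^a φ_{ab})(z) = 4 c_b⁻¹ ∑_r q^{(a)}[r] φ_b(2 z - r/2)`, equivalently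
`∑_l q^{(a)}[l - k] c_b⁻¹ φ_{b,n-1,l} = 2^{-(n-2)|a|} ∂^a φ_{ab,n-2,k}` for
`φ_{ab,n-2,k} = 2^{n-4} φ_{ab}(2^{n-2} · - k/4)`. -/
def varphiPair₂ (m : ℕ) (a b : ℕ × ℕ) (x : ℝ × ℝ) : ℝ :=
  (cst m b)⁻¹ * tensor (varphiPair m a.1 b.1) (varphiPair m a.2 b.2) x

/-- `c_{ab} = ∫ φ_{ab}`. -/
def cstPair (m : ℕ) (a b : ℕ × ℕ) : ℝ := ∫ x, varphiPair₂ m a b x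

/-! ### Sampling and wavelet frame transforms

Arrays are written on all of `ℤ²`; the energies only read them at the indices in `K_n`, where
every sample that enters a convolution comes from a function supported in the closed square. -/

/-- `φ_{n,k} = 2^n φ(2^n · - k)`. -/
def phiScaled (m n : ℕ) (k : ℤ × ℤ) (x : ℝ × ℝ) : ℝ :=
  2 ^ n * phi₂ m (2 ^ n * x.1 - k.1, 2 ^ n * x.2 - k.2)

/-- `φ_{b,n-1,k} = 2^{n-2} φ_b(2^{n-1} · - k/2)`. -/
def varphiScaled (m : ℕ) (b : ℕ × ℕ) (n : ℕ) (k : ℤ × ℤ) (x : ℝ × ℝ) : ℝ :=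
  2 ^ ((n : ℤ) - 2) *
    varphi₂ m b (2 ^ ((n : ℤ) - 1) * x.1 - k.1 / 2, 2 ^ ((n : ℤ) - 1) * x.2 - k.2 / 2)

/-- `M_n`: the indices `k` with `supp φ_{n,k} ⊆ closure Ω`. -/
def indexM (m n : ℕ) : Set (ℤ × ℤ) := {k | tsupport (phiScaled m n k) ⊆ closure Omega}

/-- `K_n`: the `k ∈ M_n` with `k + C · supp q ⊆ M_n` for the masks `q` of the low-pass band and of
all the bands `β_j`. -/
def indexK (m : ℕ) {J : ℕ} (β : Fin J → ℕ × ℕ) (C n : ℕ) : Set (ℤ × ℤ) :=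
  {k | k ∈ indexM m n ∧ ∀ b : ℕ × ℕ, (b = 0 ∨ ∃ j, b = β j) →
    ∀ r : ℤ × ℤ, mask₂ m b r ≠ 0 → k + C • r ∈ indexM m n}

/-- The sampling operator `T_n`. -/
def sampleT (m n : ℕ) (g : ℝ × ℝ → ℝ) (k : ℤ × ℤ) : ℝ :=
  2 ^ n * ∫ x in Omega, g x * phiScaled m n k x

/-- The sampling operator `S_n`. -/
def sampleS (m : ℕ) {J : ℕ} (β : Fin J → ℕ × ℕ) (n : ℕ) (v : Fin J → ℝ × ℝ → ℝ) (j : Fin J)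
    (k : ℤ × ℤ) : ℝ :=
  2 ^ n * ∫ x in Omega, v j x * ((cst m (β j))⁻¹ * varphiScaled m (β j) n k x)

/-- The convolution `(q^{(b)}[-·] ⊛ a)[k] = ∑_l q^{(b)}[l - k] a[l]`. -/
def conv (m : ℕ) (b : ℕ × ℕ) (a : ℤ × ℤ → ℝ) (k : ℤ × ℤ) : ℝ :=
  ∑' l : ℤ × ℤ, mask₂ m b (l - k) * a l

/-- The order `|b|` of `∂^b`. -/
def order (b : ℕ × ℕ) : ℕ := b.1 + b.2

/-- The weighted transform `W'_n`, with weights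
`λ'_j = c_j⁻¹ (-1)^{s_j} 2^{(n-1) s_j}`. -/
def transform₁ (m : ℕ) {J : ℕ} (β : Fin J → ℕ × ℕ) (n : ℕ) (a : ℤ × ℤ → ℝ) (j : Fin J)
    (k : ℤ × ℤ) : ℝ :=
  (cst m (β j))⁻¹ * (-1) ^ order (β j) * (2 ^ ((n : ℤ) - 1)) ^ order (β j) * conv m (β j) a k

/-- The weighted transform `W''_n`, with weights
`λ''_{ij} = c_{ij}⁻¹ (-1)^{s_i} 2^{(n-2) s_i}`. -/
def transform₂ (m : ℕ) {J : ℕ} (β : Fin J → ℕ × ℕ) (n : ℕ) (a : Fin J → ℤ × ℤ → ℝ)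
    (ij : Fin J × Fin J) (k : ℤ × ℤ) : ℝ :=
  (cstPair m (β ij.1) (β ij.2))⁻¹ * (-1) ^ order (β ij.1) *
    (2 ^ ((n : ℤ) - 2)) ^ order (β ij.1) * conv m (β ij.1) (a ij.2) k

/-! ### The energies -/

/-- `‖a‖_{ℓ_r(K; ℓ_2)} = (2^{-2n} ∑_{k ∈ K} (∑_i |a_i[k]|²)^{r/2})^{1/r}`. -/
def discreteNorm {κ : Type} [Fintype κ] (n : ℕ) (K : Set (ℤ × ℤ)) (r : ℝ) (a : κ → K → ℝ) :
    ℝ≥0∞ :=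
  (((2 : ℝ≥0∞) ^ (2 * n))⁻¹ * ∑' k : K, ENNReal.ofReal ((∑ i, |a i k| ^ 2) ^ (r / 2))) ^ (1 / r)

/-- The `ℓ_2(K)`-norm of a scalar array. -/
def discreteNorm₂ (n : ℕ) (K : Set (ℤ × ℤ)) (a : K → ℝ) : ℝ≥0∞ :=
  discreteNorm n K 2 fun _ : Unit => a

/-- `‖g‖_{L_r(Ω; ℓ_2)} = (∫_Ω (∑_i |g_i|²)^{r/2})^{1/r}`. -/
def continuumNorm {κ : Type} [Fintype κ] (r : ℝ) (g : κ → ℝ × ℝ → ℝ) : ℝ≥0∞ :=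
  (∫⁻ x in Omega, ENNReal.ofReal ((∑ i, |g i x| ^ 2) ^ (r / 2))) ^ (1 / r)

/-- `s = |𝐃'| = max_j |D_j|` for `𝐃' = (∂^{β_1}, …, ∂^{β_J})`. -/
def maxOrder {J : ℕ} (β : Fin J → ℕ × ℕ) : ℕ := Finset.univ.sup fun j => order (β j)

theorem order_le_maxOrder {J : ℕ} (β : Fin J → ℕ × ℕ) (j : Fin J) :
    (β j).1 + (β j).2 ≤ maxOrder β :=
  Finset.le_sup (f := fun j => order (β j)) (Finset.mem_univ j)

/-- The space `W_{2s}^p(Ω) × W_s^q(Ω; ℝ^J)`, with its product topology. -/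
abbrev EnergySpace {J : ℕ} (β : Fin J → ℕ × ℕ) (p q : ℝ≥0∞) [Fact (1 ≤ p)] [Fact (1 ≤ q)] : Type :=
  Sobolev (2 * maxOrder β) p × (Fin J → Sobolev (maxOrder β) q)

/-- The restriction of `T_n g` to `K_n`. -/
def sampleTK (m : ℕ) {J : ℕ} (β : Fin J → ℕ × ℕ) (C n : ℕ) (g : ℝ × ℝ → ℝ)
    (k : indexK m β C n) : ℝ :=
  sampleT m n g k

/-- The functional `E_n` at resolution `n`. -/
def discreteEnergy (m : ℕ) {J : ℕ} (β : Fin J → ℕ × ℕ) (C : ℕ) (p q : ℝ≥0∞) [Fact (1 ≤ p)]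
    [Fact (1 ≤ q)] (ν₁ ν₂ : ℝ≥0) (f : Lp ℝ 2 volOmega) (n : ℕ)
    (An : (indexK m β C n → ℝ) →ₗ[ℝ] (indexK m β C n → ℝ)) (w : EnergySpace β p q) : ℝ≥0∞ :=
  ν₁ * discreteNorm n (indexK m β C n) p.toReal
      (fun j k => transform₁ m β n (sampleT m n (sobolevFun w.1)) j k -
        sampleS m β n (fun i => sobolevFun (w.2 i)) j k) ^ p.toReal
    + ν₂ * discreteNorm n (indexK m β C n) q.toReal
      (fun ij k => transform₂ m β n (sampleS m β n fun i => sobolevFun (w.2 i)) ij k) ^ q.toReal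
    + 2⁻¹ * discreteNorm₂ n (indexK m β C n)
      (An (sampleTK m β C n (sobolevFun w.1)) - sampleTK m β C n f) ^ 2

open Classical in
/-- `‖A u - f‖_{L_2(Ω)}`, and `+∞` for a function `u` outside `L_2(Ω)` (by Sobolev embedding the
functions in `W_{2s}^p(Ω)`, `s ≥ 1`, all belong to `L_2(Ω)`). -/
def fidelity (A : Lp ℝ 2 volOmega →ₗ[ℝ] Lp ℝ 2 volOmega) (f : Lp ℝ 2 volOmega)
    (u : ℝ × ℝ → ℝ) : ℝ≥0∞ :=
  if h : MemLp u 2 volOmega then ‖A (h.toLp u) - f‖ₑ else ⊤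

/-- The variational functional `E`. -/
def energy {J : ℕ} (β : Fin J → ℕ × ℕ) (p q : ℝ≥0∞) [Fact (1 ≤ p)] [Fact (1 ≤ q)]
    (ν₁ ν₂ : ℝ≥0) (A : Lp ℝ 2 volOmega →ₗ[ℝ] Lp ℝ 2 volOmega) (f : Lp ℝ 2 volOmega)
    (w : EnergySpace β p q) : ℝ≥0∞ :=
  ν₁ * continuumNorm p.toReal
      (fun j x => sobolevDeriv w.1 (β j) ((order_le_maxOrder β j).trans (by omega)) x -
        sobolevFun (w.2 j) x) ^ p.toReal
    + ν₂ * continuumNorm q.toReal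
      (fun (ij : Fin J × Fin J) x =>
        sobolevDeriv (w.2 ij.2) (β ij.1) (order_le_maxOrder β ij.1) x) ^ q.toReal
    + 2⁻¹ * fidelity A f (sobolevFun w.1) ^ 2

/-- `x` is an `ε`-optimal solution of `inf F`. -/
def IsEpsOptimal {X : Type} (F : X → ℝ≥0∞) (ε : ℝ≥0) (x : X) : Prop :=
  F x ≤ (⨅ y, F y) + ε

/-- A minimizer is a `0`-optimal solution. -/
def IsMinimizer {X : Type} (F : X → ℝ≥0∞) (x : X) : Prop := IsEpsOptimal F 0 x

end

end WaveletFrame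

open WaveletFrame

/-!
Integration by parts against splines turns `W'_n T_n u` on `K_n` into local averages of `D' u`
against a kernel of integral one, and `W''_n S_n v` into local averages of `D'' v`; the sampling
operators `T_n` and `S_n` themselves are local averages as well. Identifying arrays with step
functions, local averages at scale `2^{-n}` converge in `L_r` for `r < ∞` and are uniformly bounded
there. The fidelity term makes sense because `W_1^1(Ω)` embeds into `L_2(Ω)`, and consistency of
the `A_n` bounds `A_n T_n` uniformly by Banach-Steinhaus. Hence `E_n(w_n) → E(w)` whenever `w_n → w`
along a filter finer than `atTop`. A cluster point is a limit along an ultrafilter `U`, and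
`E_n(w_n) ≤ E_n(y) + ε` passes to the limit along `U` for every fixed competitor `y`.
-/

open Polynomial (aeval X)

namespace WaveletFrame

noncomputable section

/-! ### Shifts and window integrals -/

section Shift

/-- The unit shift `g ↦ g(· - 1)`; filters are polynomials in it. -/
def shift : Module.End ℝ (ℝ → ℝ) where
  toFun g x := g (x - 1)
  map_add' _ _ := rfl
  map_smul' _ _ := rfl

/-- The window integral `x ↦ ∫_{x-1}^x g`, the convolution of `g` with `χ_{[0,1]}`. -/
def winInt (g : ℝ → ℝ) (x : ℝ) : ℝ := ∫ t in (x - 1)..x, g t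

variable {g : ℝ → ℝ}

theorem shift_apply (g : ℝ → ℝ) (x : ℝ) : shift g x = g (x - 1) := rfl

theorem shift_pow_apply (i : ℕ) (g : ℝ → ℝ) (x : ℝ) : (shift ^ i) g x = g (x - i) := by
  induction i generalizing x with
  | zero => simp
  | succ i ih =>
    rw [pow_succ', Module.End.mul_apply, shift_apply, ih]
    push_cast
    congr 1
    ring

theorem aeval_shift_apply {P : ℝ[X]} {n : ℕ} (hP : P.natDegree ≤ n) (g : ℝ → ℝ) (x : ℝ) :
    aeval shift P g x = ∑ i ∈ Finset.range (n + 1), P.coeff i * g (x - i) := by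
  simp [Polynomial.aeval_eq_sum_range' (Nat.lt_succ_of_le hP), shift_pow_apply]

theorem integrable_aeval_shift (hg : Integrable g) (P : ℝ[X]) : Integrable (aeval shift P g) := by
  simp_rw [funext (aeval_shift_apply (le_refl P.natDegree) g)]
  exact integrable_finsetSum _ fun i _ => (hg.comp_sub_right _).const_mul _

theorem integral_aeval_shift (hg : Integrable g) (P : ℝ[X]) :
    ∫ x, aeval shift P g x = P.eval 1 * ∫ x, g x := by
  simp_rw [aeval_shift_apply (le_refl P.natDegree)]
  rw [integral_finsetSum _ fun i _ => (hg.comp_sub_right _).const_mul _]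
  simp_rw [integral_const_mul, integral_sub_right_eq_self g, ← Finset.sum_mul]
  rw [Polynomial.eval_eq_sum_range]
  simp only [one_pow, mul_one]

theorem primitive_eq_add_intervalIntegral (hg : Integrable g) (x : ℝ) :
    primitive g x = primitive g 0 + ∫ t in (0 : ℝ)..x, g t := by
  rw [primitive, primitive, add_comm, ← sub_eq_iff_eq_add,
    intervalIntegral.integral_Iic_sub_Iic hg.integrableOn hg.integrableOn]

theorem continuous_primitive (hg : Integrable g) : Continuous (primitive g) := by
  rw [funext (primitive_eq_add_intervalIntegral hg)]
  exact continuous_const.add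
    (intervalIntegral.continuous_primitive (fun _ _ => hg.intervalIntegrable) 0)

theorem winInt_eq_primitive_sub (hg : Integrable g) :
    winInt g = fun x => primitive g x - primitive g (x - 1) :=
  funext fun _ =>
    (intervalIntegral.integral_Iic_sub_Iic hg.integrableOn hg.integrableOn).symm

theorem continuous_winInt (hg : Integrable g) : Continuous (winInt g) := by
  have hcont := continuous_primitive hg
  rw [winInt_eq_primitive_sub hg]
  exact hcont.sub (hcont.comp (continuous_id.sub continuous_const))

theorem abs_winInt_le {M : ℝ} (hg : ∀ x, |g x| ≤ M) (x : ℝ) : |winInt g x| ≤ M := by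
  have h := intervalIntegral.norm_integral_le_of_norm_le_const (a := x - 1) (b := x)
    (f := g) fun t _ => hg t
  simpa [winInt] using h

theorem winInt_eq_convolution (g : ℝ → ℝ) :
    winInt g = convolution ((Set.Ico (0 : ℝ) 1).indicator 1) g (ContinuousLinearMap.mul ℝ ℝ) := by
  funext x
  have h : winInt g x = ∫ t in Set.Ico (0 : ℝ) 1, g (x - t) := by
    rw [integral_Ico_eq_integral_Ioc, ← intervalIntegral.integral_of_le zero_le_one,
      intervalIntegral.integral_comp_sub_left]
    simp [winInt]
  rw [h, convolution, ← integral_indicator measurableSet_Ico]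
  congr 1 with t
  by_cases ht : t ∈ Set.Ico (0 : ℝ) 1 <;> simp [ht]

theorem integrable_indicator_Ico : Integrable ((Set.Ico (0 : ℝ) 1).indicator (1 : ℝ → ℝ)) :=
  (integrable_indicator_iff measurableSet_Ico).2 (by simp [Pi.one_def])

theorem integrable_winInt (hg : Integrable g) : Integrable (winInt g) := by
  rw [winInt_eq_convolution]
  exact integrable_indicator_Ico.integrable_convolution _ hg

theorem integral_winInt (hg : Integrable g) : ∫ x, winInt g x = ∫ x, g x := by
  rw [winInt_eq_convolution, integral_convolution _ integrable_indicator_Ico hg,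
    integral_indicator measurableSet_Ico]
  simp

theorem integrable_winInt_iterate (hg : Integrable g) (l : ℕ) : Integrable (winInt^[l] g) := by
  induction l with
  | zero => exact hg
  | succ l ih =>
    rw [Function.iterate_succ_apply']
    exact integrable_winInt ih

theorem integral_winInt_iterate (hg : Integrable g) (l : ℕ) :
    ∫ x, (winInt^[l] g) x = ∫ x, g x := by
  induction l with
  | zero => rfl
  | succ l ih =>
    rw [Function.iterate_succ_apply', integral_winInt (integrable_winInt_iterate hg l), ih]

theorem winInt_aeval_shift (hg : ∀ a b, IntervalIntegrable g volume a b) (P : ℝ[X]) :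
    winInt (aeval shift P g) = aeval shift P (winInt g) := by
  funext x
  have hint : ∀ i : ℕ, IntervalIntegrable (fun t => P.coeff i * g (t - i)) volume (x - 1) x := by
    intro i
    have h := (hg (x - 1 - i) (x - i)).comp_sub_right i
    rw [sub_add_cancel, sub_add_cancel] at h
    exact h.const_mul _
  rw [winInt, aeval_shift_apply le_rfl]
  simp_rw [aeval_shift_apply (le_refl P.natDegree) g]
  rw [intervalIntegral.integral_finsetSum fun i _ => hint i]
  refine Finset.sum_congr rfl fun i _ => ?_
  rw [intervalIntegral.integral_const_mul, intervalIntegral.integral_comp_sub_right, winInt,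
    sub_right_comm]

theorem primitive_one_sub_shift (hg : Integrable g) :
    primitive (aeval shift (1 - X : ℝ[X]) g) = winInt g := by
  funext x
  have hshift : ∫ t in Set.Iic x, g (t - 1) = ∫ t in Set.Iic (x - 1), g t := by
    rw [← integral_indicator measurableSet_Iic, ← integral_indicator measurableSet_Iic,
      ← integral_sub_right_eq_self ((Set.Iic (x - 1)).indicator g) (1 : ℝ)]
    congr 1 with t
    simp only [Set.indicator, Set.mem_Iic, sub_le_sub_iff_right]
  have happly : aeval shift (1 - X : ℝ[X]) g = fun t => g t - g (t - 1) := by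
    funext t
    simp [shift_apply]
  rw [primitive, happly, winInt_eq_primitive_sub hg,
    integral_sub hg.integrableOn (hg.comp_sub_right 1).integrableOn, hshift]
  rfl

theorem primitive_comp_affine (g : ℝ → ℝ) (c : ℝ) {lam : ℝ} (hl : 0 < lam) (d : ℝ) :
    primitive (fun x => c * g (lam * x + d)) = fun x => c * lam⁻¹ * primitive g (lam * x + d) := by
  funext x
  have hscale := Measure.integral_comp_mul_left
    (fun y => (Set.Iic (lam * x + d)).indicator g (y + d)) lam
  rw [integral_add_right_eq_self (fun y => (Set.Iic (lam * x + d)).indicator g y) d,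
    abs_of_pos (inv_pos.2 hl), smul_eq_mul, integral_indicator measurableSet_Iic] at hscale
  rw [primitive, primitive, integral_const_mul, mul_assoc, ← hscale,
    ← integral_indicator measurableSet_Iic]
  congr 2 with t
  simp only [Set.indicator, Set.mem_Iic, add_le_add_iff_right, mul_le_mul_iff_right₀ hl]

theorem primitive_iterate_one_sub_shift_pow (hg : Integrable g) (l : ℕ) (c : ℝ) {lam : ℝ}
    (hl : 0 < lam) (d : ℝ) :
    primitive^[l] (fun x => c * aeval shift ((1 - X) ^ l : ℝ[X]) g (lam * x + d)) =
      fun x => c * lam⁻¹ ^ l * (winInt^[l] g) (lam * x + d) := by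
  induction l generalizing g c with
  | zero => simp
  | succ l ih =>
    rw [Function.iterate_succ_apply, primitive_comp_affine _ _ hl, pow_succ', map_mul,
      Module.End.mul_apply, primitive_one_sub_shift (integrable_aeval_shift hg _),
      winInt_aeval_shift (fun _ _ => hg.intervalIntegrable), ih (integrable_winInt hg),
      Function.iterate_succ_apply]
    funext x
    ring

end Shift

/-! ### Bounded, compactly supported kernels -/

/-- A bounded measurable function vanishing outside `[L, R]`: the regularity shared by B-splines
and everything that filters and window integrals make of them. -/
structure IsKernel (L R : ℝ) (g : ℝ → ℝ) : Prop where
  meas : Measurable g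
  bdd : ∃ M, ∀ x, |g x| ≤ M
  supp : ∀ x, x ∉ Set.Icc L R → g x = 0

namespace IsKernel

variable {L R : ℝ} {g : ℝ → ℝ}

theorem mono {L' R' : ℝ} (h : IsKernel L R g) (hL : L' ≤ L) (hR : R ≤ R') : IsKernel L' R' g :=
  ⟨h.meas, h.bdd, fun x hx => h.supp x fun hx' => hx ⟨hL.trans hx'.1, hx'.2.trans hR⟩⟩

theorem const_mul (h : IsKernel L R g) (c : ℝ) : IsKernel L R (fun x => c * g x) := by
  obtain ⟨M, hM⟩ := h.bdd
  refine ⟨h.meas.const_mul c, ⟨|c| * M, fun x => ?_⟩, fun x hx => by simp [h.supp x hx]⟩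
  rw [abs_mul]
  exact mul_le_mul_of_nonneg_left (hM x) (abs_nonneg c)

theorem sub {f : ℝ → ℝ} (hf : IsKernel L R f) (hg : IsKernel L R g) :
    IsKernel L R (fun x => f x - g x) := by
  obtain ⟨M, hM⟩ := hf.bdd
  obtain ⟨M', hM'⟩ := hg.bdd
  exact ⟨hf.meas.sub hg.meas, ⟨M + M', fun x => (abs_sub _ _).trans (add_le_add (hM x) (hM' x))⟩,
    fun x hx => by rw [hf.supp x hx, hg.supp x hx, sub_self]⟩

theorem translate (h : IsKernel L R g) (c : ℝ) :
    IsKernel (L - c) (R - c) (fun x => g (x + c)) := by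
  obtain ⟨M, hM⟩ := h.bdd
  refine ⟨h.meas.comp (measurable_id.add_const c), ⟨M, fun x => hM _⟩, fun x hx => h.supp _ ?_⟩
  contrapose! hx
  exact ⟨by linarith [hx.1], by linarith [hx.2]⟩

theorem aeval_shift (h : IsKernel L R g) {P : ℝ[X]} {n : ℕ} (hP : P.natDegree ≤ n) :
    IsKernel L (R + n) (aeval shift P g) := by
  obtain ⟨M, hM⟩ := h.bdd
  rw [funext (aeval_shift_apply hP g)]
  refine ⟨Finset.measurable_sum _ fun i _ => (h.meas.comp (measurable_sub_const _)).const_mul _,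
    ⟨∑ i ∈ Finset.range (n + 1), |P.coeff i| * M, fun x => ?_⟩,
    fun x hx => Finset.sum_eq_zero fun i hi => ?_⟩
  · refine (Finset.abs_sum_le_sum_abs _ _).trans (Finset.sum_le_sum fun i _ => ?_)
    rw [abs_mul]
    exact mul_le_mul_of_nonneg_left (hM _) (abs_nonneg _)
  · have hi' : (i : ℝ) ≤ n := by exact_mod_cast Finset.mem_range_succ_iff.1 hi
    rw [h.supp, mul_zero]
    contrapose! hx
    exact ⟨by linarith [hx.1, i.cast_nonneg (α := ℝ)], by linarith [hx.2]⟩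

theorem integrable (h : IsKernel L R g) : Integrable g := by
  obtain ⟨M, hM⟩ := h.bdd
  have hIcc : IntegrableOn g (Set.Icc L R) :=
    Measure.integrableOn_of_bounded (M := M) (by simp) h.meas.aestronglyMeasurable
      (Eventually.of_forall hM)
  exact (integrableOn_iff_integrable_of_support_subset
    fun x hx => not_not.1 fun hx' => hx (h.supp x hx')).1 hIcc

protected theorem winInt (h : IsKernel L R g) : IsKernel L (R + 1) (winInt g) := by
  obtain ⟨M, hM⟩ := h.bdd
  refine ⟨(continuous_winInt h.integrable).measurable, ⟨M, abs_winInt_le hM⟩, fun x hx => ?_⟩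
  rw [WaveletFrame.winInt, intervalIntegral.integral_of_le (by linarith)]
  refine setIntegral_eq_zero_of_forall_eq_zero fun t ht => h.supp t fun ht' => hx ?_
  exact ⟨by linarith [ht.2, ht'.1], by linarith [ht.1, ht'.2]⟩

theorem winInt_iterate (h : IsKernel L R g) (l : ℕ) : IsKernel L (R + l) (winInt^[l] g) := by
  induction l with
  | zero => simpa using h
  | succ l ih =>
    rw [Function.iterate_succ_apply', Nat.cast_succ, ← add_assoc]
    exact ih.winInt

end IsKernel

/-! ### B-splines and their masks -/

section BSpline

theorem cardinalBSpline_succ_succ (m : ℕ) :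
    cardinalBSpline (m + 2) = winInt (cardinalBSpline (m + 1)) := by
  funext x
  rw [cardinalBSpline, winInt]

theorem isKernel_cardinalBSpline (m : ℕ) : IsKernel 0 (m + 1 : ℕ) (cardinalBSpline (m + 1)) := by
  induction m with
  | zero =>
    refine ⟨measurable_one.indicator measurableSet_Icc, ⟨1, fun x => ?_⟩, fun x hx => ?_⟩
    · by_cases hx : x ∈ Set.Icc (0 : ℝ) 1 <;> simp [cardinalBSpline, hx]
    · rw [cardinalBSpline, Set.indicator_of_notMem (by simpa using hx)]
  | succ m ih =>
    rw [cardinalBSpline_succ_succ, Nat.cast_succ]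
    exact ih.winInt

theorem cardinalBSpline_nonneg (m : ℕ) (x : ℝ) : 0 ≤ cardinalBSpline (m + 1) x := by
  induction m generalizing x with
  | zero => exact Set.indicator_nonneg (fun _ _ => zero_le_one) _
  | succ m ih =>
    rw [cardinalBSpline_succ_succ, winInt]
    exact intervalIntegral.integral_nonneg (by linarith) fun t _ => ih t

theorem cardinalBSpline_pos (m : ℕ) {x : ℝ} (h0 : 0 < x) (h1 : x < (m + 1 : ℕ)) :
    0 < cardinalBSpline (m + 1) x := by
  induction m generalizing x with
  | zero =>
    have hx : x ∈ Set.Icc (0 : ℝ) 1 := ⟨h0.le, by simpa using h1.le⟩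
    rw [cardinalBSpline, Set.indicator_of_mem hx]
    exact one_pos
  | succ m ih =>
    have hint : ∀ a b, IntervalIntegrable (cardinalBSpline (m + 1)) volume a b := fun _ _ =>
      (isKernel_cardinalBSpline m).integrable.intervalIntegrable
    push_cast at h1 ih
    have hm : (0 : ℝ) < m + 1 := by positivity
    have hab : max (x - 1) 0 < min x (m + 1) :=
      max_lt (lt_min (by linarith) (by linarith)) (lt_min h0 hm)
    rw [cardinalBSpline_succ_succ, winInt]
    calc 0 < ∫ t in max (x - 1) 0..min x (m + 1), cardinalBSpline (m + 1) t :=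
          intervalIntegral.intervalIntegral_pos_of_pos_on (hint _ _)
            (fun t ht => ih ((le_max_right _ _).trans_lt ht.1) (ht.2.trans_le (min_le_right _ _)))
            hab
      _ ≤ ∫ t in (x - 1)..x, cardinalBSpline (m + 1) t :=
          intervalIntegral.integral_mono_interval (le_max_left _ _) hab.le (min_le_left _ _)
            (Eventually.of_forall (cardinalBSpline_nonneg m)) (hint _ _)

theorem integral_cardinalBSpline (m : ℕ) : ∫ x, cardinalBSpline (m + 1) x = 1 := by
  induction m with
  | zero =>
    simp only [cardinalBSpline]
    rw [integral_indicator measurableSet_Icc]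
    simp
  | succ m ih =>
    rw [cardinalBSpline_succ_succ, integral_winInt (isKernel_cardinalBSpline m).integrable, ih]

variable {m l : ℕ}

theorem isKernel_bspline (hm : 1 ≤ m) :
    IsKernel (-(m / 2 : ℕ)) (m - (m / 2 : ℕ)) (bspline m) := by
  obtain ⟨n, rfl⟩ := Nat.exists_eq_add_of_le' hm
  have h := (isKernel_cardinalBSpline n).translate ((n + 1) / 2 : ℕ)
  rwa [zero_sub] at h

theorem integral_bspline (hm : 1 ≤ m) : ∫ x, bspline m x = 1 := by
  obtain ⟨n, rfl⟩ := Nat.exists_eq_add_of_le' hm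
  simp only [bspline]
  rw [integral_add_right_eq_self (cardinalBSpline (n + 1)), integral_cardinalBSpline]

theorem bspline_pos {x : ℝ} (h0 : 0 < x + (m / 2 : ℕ)) (h1 : x + (m / 2 : ℕ) < m) :
    0 < bspline m x := by
  cases m with
  | zero =>
    simp only [Nat.zero_div, Nat.cast_zero] at h0 h1
    exact absurd h1 h0.not_gt
  | succ n => exact cardinalBSpline_pos n h0 h1

/-- The leading constant `± 2^{-m} √(m choose l)` of the mask `q_l`. -/
def maskConst (m l : ℕ) : ℝ := (if l = 0 then 1 else (-1) ^ (l + 1)) * √(m.choose l) / 2 ^ m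

theorem maskConst_ne_zero (hl : l ≤ m) : maskConst m l ≠ 0 := by
  have hsqrt : √(m.choose l : ℝ) ≠ 0 :=
    (Real.sqrt_pos.2 (by exact_mod_cast Nat.choose_pos hl)).ne'
  have hsign : (if l = 0 then (1 : ℝ) else (-1) ^ (l + 1)) ≠ 0 := by
    split_ifs
    exacts [one_ne_zero, pow_ne_zero _ (by norm_num)]
  exact div_ne_zero (mul_ne_zero hsign hsqrt) (by positivity)

theorem natDegree_one_add_X_pow_le (n : ℕ) : ((1 + X) ^ n : ℝ[X]).natDegree ≤ n :=
  (Polynomial.natDegree_pow_le_of_le n (by compute_degree : (1 + X : ℝ[X]).natDegree ≤ 1)).trans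
    (mul_one n).le

theorem natDegree_maskPoly_le (hl : l ≤ m) :
    ((1 - X) ^ l * (1 + X) ^ (m - l) : ℝ[X]).natDegree ≤ m := by
  have hsub : (1 - X : ℝ[X]).natDegree ≤ 1 := by compute_degree
  have h₁ := Polynomial.natDegree_pow_le_of_le l hsub
  have h₂ := natDegree_one_add_X_pow_le (m - l)
  exact Polynomial.natDegree_mul_le.trans (by omega)

/-- The interval of integers containing the supports of the masks of order `m`. -/
def maskRange (m : ℕ) : Finset ℤ := Finset.Icc (-((m / 2 : ℕ) : ℤ)) (m - (m / 2 : ℕ))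

theorem mask_eq_zero (hl : l ≤ m) {r : ℤ} (hr : r ∉ maskRange m) : mask m l r = 0 := by
  simp only [maskRange, Finset.mem_Icc, not_and_or, not_le] at hr
  refine ite_eq_right_iff.2 fun h => ?_
  rw [Polynomial.coeff_eq_zero_of_natDegree_lt, mul_zero]
  exact (natDegree_maskPoly_le hl).trans_lt (by omega)

theorem mask_zero_left_ne_zero (m : ℕ) : mask m 0 (-((m / 2 : ℕ) : ℤ)) ≠ 0 := by
  simp [mask, Polynomial.coeff_zero_eq_eval_zero]

theorem mask_zero_right_ne_zero (m : ℕ) : mask m 0 (m - ((m / 2 : ℕ) : ℤ)) ≠ 0 := by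
  simp [mask, Polynomial.coeff_one_add_X_pow]

theorem tsum_mask (hl : l ≤ m) (a : ℤ → ℝ) :
    ∑' r : ℤ, mask m l r * a r = ∑ r ∈ maskRange m, mask m l r * a r :=
  tsum_eq_sum fun r hr => by rw [mask_eq_zero hl hr, zero_mul]

/-- The filter `g ↦ ∑_r q_l[r] g(· - r)`. -/
def maskOp (m l : ℕ) (g : ℝ → ℝ) (z : ℝ) : ℝ := ∑ r ∈ maskRange m, mask m l r * g (z - r)

/-- The operator taking `g` to the compactly supported function whose `l`-th derivative is
`∑_r q_l[r] g(· - r)`: each factor `1 - z` of the symbol of `q_l`, a backward difference, is the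
derivative of a window integral. -/
def liftOp (m l : ℕ) (g : ℝ → ℝ) (z : ℝ) : ℝ :=
  maskConst m l * (winInt^[l] (aeval shift ((1 + X) ^ (m - l) : ℝ[X]) g)) (z + (m / 2 : ℕ))

theorem maskOp_eq_aeval_shift (hl : l ≤ m) (g : ℝ → ℝ) (z : ℝ) :
    maskOp m l g z =
      maskConst m l *
        aeval shift ((1 - X) ^ l * (1 + X) ^ (m - l) : ℝ[X]) g (z + (m / 2 : ℕ)) := by
  rw [aeval_shift_apply (natDegree_maskPoly_le hl), Finset.mul_sum, maskOp]
  refine (Finset.sum_nbij' (fun i : ℕ => (i : ℤ) - (m / 2 : ℕ))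
    (fun r => (r + (m / 2 : ℕ)).toNat) ?_ ?_ ?_ ?_ ?_).symm
  · intro i hi
    simp only [maskRange, Finset.mem_Icc, Finset.mem_range] at hi ⊢
    omega
  · intro r hr
    simp only [maskRange, Finset.mem_Icc, Finset.mem_range] at hr ⊢
    omega
  · intro i _
    simp
  · intro r hr
    simp only [maskRange, Finset.mem_Icc] at hr
    omega
  · intro i _
    rw [mask, sub_add_cancel, if_pos (Int.natCast_nonneg i), Int.toNat_natCast, maskConst,
      mul_assoc]
    rw [Int.cast_sub, Int.cast_natCast, Int.cast_natCast, sub_sub_eq_add_sub]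

theorem IsKernel.liftOp {L R : ℝ} {g : ℝ → ℝ} (h : IsKernel L R g) (hl : l ≤ m) :
    IsKernel (L - (m / 2 : ℕ)) (R + (m - (m / 2 : ℕ))) (liftOp m l g) := by
  have hker := (((h.aeval_shift (natDegree_one_add_X_pow_le (m - l))).winInt_iterate l).translate
    (m / 2 : ℕ)).const_mul (maskConst m l)
  refine hker.mono le_rfl ?_
  rw [Nat.cast_sub hl]
  linarith

theorem integral_liftOp_ne_zero {g : ℝ → ℝ} (hg : Integrable g) (hl : l ≤ m)
    (hg0 : ∫ x, g x ≠ 0) : ∫ x, liftOp m l g x ≠ 0 := by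
  have hint := integrable_aeval_shift hg ((1 + X) ^ (m - l))
  simp only [liftOp]
  rw [integral_const_mul, integral_add_right_eq_self, integral_winInt_iterate hint,
    integral_aeval_shift hg]
  refine mul_ne_zero (maskConst_ne_zero hl) (mul_ne_zero ?_ hg0)
  norm_num

theorem primitive_iterate_maskOp {g : ℝ → ℝ} (hg : Integrable g) (hl : l ≤ m) (c : ℝ) {lam : ℝ}
    (hlam : 0 < lam) :
    primitive^[l] (fun x => c * maskOp m l g (lam * x)) =
      fun x => c * lam⁻¹ ^ l * liftOp m l g (lam * x) := by
  have h := primitive_iterate_one_sub_shift_pow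
    (integrable_aeval_shift hg ((1 + X) ^ (m - l))) l (c * maskConst m l) hlam (m / 2 : ℕ)
  simp_rw [maskOp_eq_aeval_shift hl, map_mul, Module.End.mul_apply, ← mul_assoc]
  rw [h]
  funext x
  rw [liftOp]
  ring

end BSpline

/-! ### The functions `φ_b`, `φ_{ab}` and their integrals -/

section Framelet

variable {m : ℕ}

theorem varphi_eq {l : ℕ} (hm : 1 ≤ m) (hl : l ≤ m) (x : ℝ) :
    varphi m l x = 2 * 2⁻¹ ^ l * liftOp m l (bspline m) (2 * x) := by
  have hframelet : framelet m l = fun x => 2 * maskOp m l (bspline m) (2 * x) := by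
    funext x
    rw [framelet, tsum_mask hl fun r => bspline m (2 * x - r), maskOp]
  rw [varphi, hframelet, primitive_iterate_maskOp (isKernel_bspline hm).integrable hl 2 two_pos]

theorem varphiPair_eq {a b : ℕ} (hm : 1 ≤ m) (ha : a ≤ m) (hb : b ≤ m) (x : ℝ) :
    varphiPair m a b x =
      2 * (2 * 2⁻¹ ^ b) * 4⁻¹ ^ a * liftOp m a (liftOp m b (bspline m)) (4 * x) := by
  have hfilter : (fun z => 2 * ∑' r : ℤ, mask m a r * varphi m b (2 * z - r / 2)) =
      fun z => 2 * (2 * 2⁻¹ ^ b) * maskOp m a (liftOp m b (bspline m)) (4 * z) := by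
    funext z
    rw [tsum_mask ha fun r => varphi m b (2 * z - r / 2), maskOp, mul_assoc 2]
    congr 1
    rw [Finset.mul_sum]
    refine Finset.sum_congr rfl fun r _ => ?_
    rw [varphi_eq hm hb, show 2 * (2 * z - (r : ℝ) / 2) = 4 * z - r by ring]
    ring
  rw [varphiPair, hfilter,
    primitive_iterate_maskOp ((isKernel_bspline hm).liftOp hb).integrable ha _ four_pos]

theorem integral_varphi {l : ℕ} (hm : 1 ≤ m) (hl : l ≤ m) :
    ∫ x, varphi m l x = 2⁻¹ ^ l * ∫ x, liftOp m l (bspline m) x := by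
  simp_rw [varphi_eq hm hl]
  rw [integral_const_mul, Measure.integral_comp_mul_left (liftOp m l (bspline m)) 2,
    abs_of_pos (by norm_num), smul_eq_mul]
  ring

theorem integral_varphiPair {a b : ℕ} (hm : 1 ≤ m) (ha : a ≤ m) (hb : b ≤ m) :
    ∫ x, varphiPair m a b x =
      2⁻¹ ^ b * 4⁻¹ ^ a * ∫ x, liftOp m a (liftOp m b (bspline m)) x := by
  simp_rw [varphiPair_eq hm ha hb]
  rw [integral_const_mul, Measure.integral_comp_mul_left (liftOp m a (liftOp m b (bspline m))) 4,
    abs_of_pos (by norm_num), smul_eq_mul]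
  ring

theorem integral_tensor (f g : ℝ → ℝ) :
    ∫ x, tensor f g x = (∫ x, f x) * ∫ x, g x :=
  integral_prod_mul f g

theorem cst_eq (hm : 1 ≤ m) {b : ℕ × ℕ} (hb : b.1 ≤ m ∧ b.2 ≤ m) :
    cst m b = 2⁻¹ ^ order b *
      ((∫ x, liftOp m b.1 (bspline m) x) * ∫ x, liftOp m b.2 (bspline m) x) := by
  simp only [cst, varphi₂]
  rw [integral_tensor, integral_varphi hm hb.1, integral_varphi hm hb.2, order, pow_add]
  ring

theorem cstPair_eq (hm : 1 ≤ m) {a b : ℕ × ℕ} (ha : a.1 ≤ m ∧ a.2 ≤ m)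
    (hb : b.1 ≤ m ∧ b.2 ≤ m) :
    cstPair m a b = 4⁻¹ ^ order a *
      (((∫ x, liftOp m b.1 (bspline m) x) * ∫ x, liftOp m b.2 (bspline m) x)⁻¹ *
        ((∫ x, liftOp m a.1 (liftOp m b.1 (bspline m)) x) *
          ∫ x, liftOp m a.2 (liftOp m b.2 (bspline m)) x)) := by
  simp only [cstPair, varphiPair₂]
  rw [integral_const_mul, integral_tensor, integral_varphiPair hm ha.1 hb.1,
    integral_varphiPair hm ha.2 hb.2, cst_eq hm hb, order, order, mul_inv, pow_add, pow_add]
  field_simp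

end Framelet

/-! ### Smooth approximation of kernels -/

/-- Uniformly bounded almost everywhere convergence. -/
structure BddTendsto (g : ℕ → ℝ → ℝ) (G : ℝ → ℝ) : Prop where
  bdd : ∃ M, ∀ i x, |g i x| ≤ M
  tendsto : ∀ᵐ x, Tendsto (fun i => g i x) atTop (𝓝 (G x))

namespace BddTendsto

variable {g g' : ℕ → ℝ → ℝ} {G G' : ℝ → ℝ}

theorem mul (h : BddTendsto g G) (h' : BddTendsto g' G') :
    BddTendsto (fun i x => g i x * g' i x) (fun x => G x * G' x) := by
  obtain ⟨M, hM⟩ := h.bdd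
  obtain ⟨M', hM'⟩ := h'.bdd
  refine ⟨⟨M * M', fun i x => ?_⟩, ?_⟩
  · rw [abs_mul]
    exact mul_le_mul (hM i x) (hM' i x) (abs_nonneg _) ((abs_nonneg _).trans (hM i x))
  · filter_upwards [h.tendsto, h'.tendsto] with x hx hx' using hx.mul hx'

theorem const_mul (h : BddTendsto g G) (c : ℝ) :
    BddTendsto (fun i x => c * g i x) (fun x => c * G x) :=
  mul (g := fun _ _ => c) ⟨⟨|c|, fun _ _ => le_rfl⟩, ae_of_all _ fun _ => tendsto_const_nhds⟩ h

theorem comp_affine (h : BddTendsto g G) {a : ℝ} (ha : a ≠ 0) (b : ℝ) :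
    BddTendsto (fun i x => g i (a * x + b)) (fun x => G (a * x + b)) := by
  obtain ⟨M, hM⟩ := h.bdd
  refine ⟨⟨M, fun i x => hM i _⟩, ?_⟩
  have hmul : Measure.QuasiMeasurePreserving (fun x : ℝ => a * x) volume volume := by
    refine ⟨measurable_const_mul a, ?_⟩
    rw [Real.map_volume_mul_left ha]
    exact Measure.smul_absolutelyContinuous
  have hadd : Measure.QuasiMeasurePreserving (fun x : ℝ => x + b) volume volume :=
    (measurePreserving_add_right volume b).quasiMeasurePreserving
  exact (hadd.comp hmul).ae h.tendsto

theorem aeval_shift (h : BddTendsto g G) (P : ℝ[X]) :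
    BddTendsto (fun i => aeval shift P (g i)) (aeval shift P G) := by
  obtain ⟨M, hM⟩ := h.bdd
  have hshift : ∀ᵐ x : ℝ, ∀ j : ℕ, Tendsto (fun i => g i (x - j)) atTop (𝓝 (G (x - j))) :=
    ae_all_iff.2 fun j => by
      simpa only [one_mul, sub_eq_add_neg] using (h.comp_affine one_ne_zero (-j : ℝ)).tendsto
  simp_rw [fun i => funext (aeval_shift_apply (le_refl P.natDegree) (g i))]
  rw [funext (aeval_shift_apply (le_refl P.natDegree) G)]
  refine ⟨⟨∑ j ∈ Finset.range (P.natDegree + 1), |P.coeff j| * M, fun i x => ?_⟩, ?_⟩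
  · refine (Finset.abs_sum_le_sum_abs _ _).trans (Finset.sum_le_sum fun j _ => ?_)
    rw [abs_mul]
    exact mul_le_mul_of_nonneg_left (hM i _) (abs_nonneg _)
  · filter_upwards [hshift] with x hx
    exact tendsto_finsetSum _ fun j _ => (hx j).const_mul _

theorem winInt (h : BddTendsto g G) (hm : ∀ i, Measurable (g i)) :
    BddTendsto (fun i => winInt (g i)) (winInt G) := by
  obtain ⟨M, hM⟩ := h.bdd
  refine ⟨⟨M, fun i x => abs_winInt_le (hM i) x⟩, Eventually.of_forall fun x => ?_⟩
  refine intervalIntegral.tendsto_integral_filter_of_dominated_convergence (fun _ => M)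
    (Eventually.of_forall fun i => (hm i).aestronglyMeasurable)
    (Eventually.of_forall fun i => Eventually.of_forall fun t _ => hM i t) (by simp) ?_
  filter_upwards [h.tendsto] with t ht _ using ht

theorem winInt_iterate (h : BddTendsto g G) (hg : ∀ i, Integrable (g i))
    (hm : ∀ i, Measurable (g i)) (l : ℕ) :
    BddTendsto (fun i => WaveletFrame.winInt^[l] (g i)) (WaveletFrame.winInt^[l] G) := by
  induction l generalizing g G with
  | zero => exact h
  | succ _ ih =>
    exact ih (h.winInt hm) (fun i => integrable_winInt (hg i)) fun i =>
      (continuous_winInt (hg i)).measurable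

theorem tendsto_setIntegral (h : BddTendsto g G) (hm : ∀ i, Measurable (g i)) {s : Set ℝ}
    (hs : volume s ≠ ⊤) :
    Tendsto (fun i => ∫ t in s, g i t) atTop (𝓝 (∫ t in s, G t)) := by
  obtain ⟨M, hM⟩ := h.bdd
  exact tendsto_integral_of_dominated_convergence (fun _ => M)
    (fun i => (hm i).aestronglyMeasurable) (integrableOn_const hs)
    (fun i => Eventually.of_forall (hM i)) (ae_restrict_of_ae h.tendsto)

end BddTendsto

theorem exists_contDiff_bddTendsto {G : ℝ → ℝ} (hG : LocallyIntegrable G) {M : ℝ}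
    (hM : ∀ x, |G x| ≤ M) : ∃ g : ℕ → ℝ → ℝ, (∀ i, ContDiff ℝ ∞ (g i)) ∧ BddTendsto g G := by
  let θ : ℕ → ContDiffBump (0 : ℝ) := fun i =>
    { rIn := 1 / (i + 1)
      rOut := 2 * (1 / (i + 1))
      rIn_pos := by positivity
      rIn_lt_rOut := by linarith [show 0 < (1 : ℝ) / (i + 1) by positivity] }
  refine ⟨fun i => convolution ((θ i).normed volume) G (ContinuousLinearMap.lsmul ℝ ℝ) volume,
    fun i => (θ i).hasCompactSupport_normed.contDiff_convolution_left _ (θ i).contDiff_normed hG,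
    ⟨M, fun i x => ?_⟩, ?_⟩
  · have hbound : ‖∫ t, (θ i).normed volume t • G (x - t)‖ ≤ ∫ t, (θ i).normed volume t * M := by
      refine norm_integral_le_of_norm_le ((θ i).integrable_normed.mul_const M)
        (Eventually.of_forall fun t => ?_)
      rw [norm_smul, Real.norm_of_nonneg ((θ i).nonneg_normed t)]
      exact mul_le_mul_of_nonneg_left (hM _) ((θ i).nonneg_normed t)
    rwa [integral_mul_const, (θ i).integral_normed, one_mul] at hbound
  · refine ContDiffBump.ae_convolution_tendsto_right_of_locallyIntegrable (K := 2) ?_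
      (Eventually.of_forall fun i => le_rfl) hG
    simpa [θ] using tendsto_one_div_add_atTop_nhds_zero_nat (𝕜 := ℝ).const_mul 2

/-- A smooth cutoff, equal to `1` on `[L + 2 / (i + 1), R - 2 / (i + 1)]` and to `0` outside
`[L + 1 / (i + 1), R - 1 / (i + 1)]`. -/
def cutoff (L R : ℝ) (i : ℕ) (x : ℝ) : ℝ :=
  Real.smoothTransition ((i + 1) * (x - L) - 1) * Real.smoothTransition ((i + 1) * (R - x) - 1)

section Cutoff

variable {L R : ℝ}

theorem contDiff_cutoff (i : ℕ) : ContDiff ℝ ∞ (cutoff L R i) := by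
  unfold cutoff
  fun_prop

theorem abs_cutoff_le_one (i : ℕ) (x : ℝ) : |cutoff L R i x| ≤ 1 := by
  have h₁ := Real.smoothTransition.nonneg ((i + 1) * (x - L) - 1)
  have h₂ := Real.smoothTransition.nonneg ((i + 1) * (R - x) - 1)
  rw [cutoff, abs_of_nonneg (mul_nonneg h₁ h₂)]
  exact mul_le_one₀ (Real.smoothTransition.le_one _) h₂ (Real.smoothTransition.le_one _)

theorem cutoff_eq_zero {i : ℕ} {x : ℝ}
    (hx : x ∉ Set.Icc (L + 1 / (i + 1 : ℝ)) (R - 1 / (i + 1 : ℝ))) : cutoff L R i x = 0 := by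
  have hi : (0 : ℝ) < i + 1 := by positivity
  rw [Set.mem_Icc, not_and_or, not_le, not_le] at hx
  rcases hx with hx | hx
  · rw [cutoff, Real.smoothTransition.zero_of_nonpos, zero_mul]
    have := mul_lt_mul_of_pos_left (sub_lt_iff_lt_add'.2 hx) hi
    rw [mul_one_div_cancel hi.ne'] at this
    linarith
  · rw [cutoff, mul_comm, Real.smoothTransition.zero_of_nonpos, zero_mul]
    have := mul_lt_mul_of_pos_left (sub_lt_comm.1 hx) hi
    rw [mul_one_div_cancel hi.ne'] at this
    linarith

theorem eventually_cutoff_eq_one {x : ℝ} (hx : x ∈ Set.Ioo L R) :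
    ∀ᶠ i in atTop, cutoff L R i x = 1 := by
  have hlarge : ∀ {y : ℝ}, 0 < y → ∀ᶠ i : ℕ in atTop, 1 ≤ ((i : ℝ) + 1) * y - 1 := fun hy =>
    (tendsto_atTop_add_const_right _ (-1) ((tendsto_atTop_add_const_right _ 1
      tendsto_natCast_atTop_atTop).atTop_mul_const hy)).eventually_ge_atTop 1
  filter_upwards [hlarge (sub_pos.2 hx.1), hlarge (sub_pos.2 hx.2)] with i h₁ h₂
  rw [cutoff, Real.smoothTransition.one_of_one_le h₁, Real.smoothTransition.one_of_one_le h₂,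
    one_mul]

end Cutoff

namespace IsKernel

variable {L R : ℝ} {g G : ℝ → ℝ}

theorem exists_contDiff_approx (h : IsKernel L R G) :
    ∃ g : ℕ → ℝ → ℝ, (∀ i, ContDiff ℝ ∞ (g i)) ∧
      (∀ i, ∃ δ > 0, IsKernel (L + δ) (R - δ) (g i)) ∧ BddTendsto g G := by
  obtain ⟨M, hM⟩ := h.bdd
  obtain ⟨g, hsmooth, hlim⟩ := exists_contDiff_bddTendsto h.integrable.locallyIntegrable hM
  have hcut : BddTendsto (cutoff L R) ((Set.Icc L R).indicator 1) := by
    refine ⟨⟨1, abs_cutoff_le_one⟩, ?_⟩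
    filter_upwards [Measure.ae_ne volume L, Measure.ae_ne volume R] with x hxL hxR
    by_cases hx : x ∈ Set.Icc L R
    · rw [Set.indicator_of_mem hx, Pi.one_apply]
      exact tendsto_nhds_of_eventually_eq
        (eventually_cutoff_eq_one ⟨hx.1.lt_of_ne' hxL, hx.2.lt_of_ne hxR⟩)
    · rw [Set.indicator_of_notMem hx]
      refine tendsto_const_nhds.congr fun i => (cutoff_eq_zero fun hx' => hx ?_).symm
      have hi : (0 : ℝ) < 1 / (i + 1) := by positivity
      exact ⟨by linarith [hx'.1], by linarith [hx'.2]⟩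
  have hG : (fun x => (Set.Icc L R).indicator 1 x * G x) = G := by
    funext x
    by_cases hx : x ∈ Set.Icc L R
    · rw [Set.indicator_of_mem hx, Pi.one_apply, one_mul]
    · rw [h.supp x hx, mul_zero]
  have hprod := hcut.mul hlim
  rw [hG] at hprod
  have hprodSmooth i : ContDiff ℝ ∞ fun x => cutoff L R i x * g i x :=
    (contDiff_cutoff i).mul (hsmooth i)
  refine ⟨_, hprodSmooth, fun i => ⟨1 / (i + 1), by positivity,
    (hprodSmooth i).continuous.measurable, ?_, fun x hx => ?_⟩, hprod⟩
  · obtain ⟨K, hK⟩ := hprod.bdd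
    exact ⟨K, hK i⟩
  · rw [cutoff_eq_zero hx, zero_mul]

theorem tsupport_comp_affine_subset (h : IsKernel L R g) (c : ℝ) {N : ℝ} (hN : 0 < N) (d : ℝ) :
    tsupport (fun x => c * g (N * x + d)) ⊆ Set.Icc ((L - d) / N) ((R - d) / N) := by
  refine closure_minimal (fun x hx => ?_) isClosed_Icc
  have hmem : N * x + d ∈ Set.Icc L R :=
    by_contra fun hx' => hx (by simp only [h.supp _ hx', mul_zero])
  rw [Set.mem_Icc, div_le_iff₀ hN, le_div_iff₀ hN]
  exact ⟨by linarith [hmem.1], by linarith [hmem.2]⟩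

end IsKernel

/-! ### Derivatives of primitives and window integrals -/

section Deriv

variable {g : ℝ → ℝ}

theorem hasDerivAt_primitive (hg : Integrable g) (hcont : Continuous g) (x : ℝ) :
    HasDerivAt (primitive g) (g x) x := by
  rw [funext (primitive_eq_add_intervalIntegral hg)]
  exact (intervalIntegral.integral_hasDerivAt_right hg.intervalIntegrable
    hcont.stronglyMeasurable.stronglyMeasurableAtFilter hcont.continuousAt).const_add _

theorem deriv_primitive (hg : Integrable g) (hcont : Continuous g) : deriv (primitive g) = g :=
  funext fun x => (hasDerivAt_primitive hg hcont x).deriv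

theorem contDiff_primitive (hg : Integrable g) (hsm : ContDiff ℝ ∞ g) :
    ContDiff ℝ ∞ (primitive g) :=
  contDiff_infty_iff_deriv.2
    ⟨fun x => (hasDerivAt_primitive hg hsm.continuous x).differentiableAt,
      (deriv_primitive hg hsm.continuous).symm ▸ hsm⟩

theorem contDiff_winInt (hg : Integrable g) (hsm : ContDiff ℝ ∞ g) : ContDiff ℝ ∞ (winInt g) := by
  have hprim := contDiff_primitive hg hsm
  rw [winInt_eq_primitive_sub hg]
  exact hprim.sub (hprim.comp (contDiff_id.sub contDiff_const))

theorem deriv_winInt (hg : Integrable g) (hcont : Continuous g) :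
    deriv (winInt g) = aeval shift (1 - X : ℝ[X]) g := by
  have hprim := hasDerivAt_primitive hg hcont
  funext x
  rw [winInt_eq_primitive_sub hg, ((hprim x).fun_sub ((hprim (x - 1)).comp_sub_const x 1)).deriv]
  simp [shift_apply]

theorem contDiff_aeval_shift (hsm : ContDiff ℝ ∞ g) (P : ℝ[X]) :
    ContDiff ℝ ∞ (aeval shift P g) := by
  rw [funext (aeval_shift_apply (le_refl P.natDegree) g)]
  exact ContDiff.sum fun i _ => contDiff_const.mul (hsm.comp (contDiff_id.sub contDiff_const))

theorem contDiff_winInt_iterate (hg : Integrable g) (hsm : ContDiff ℝ ∞ g) (l : ℕ) :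
    ContDiff ℝ ∞ (winInt^[l] g) := by
  induction l generalizing g with
  | zero => exact hsm
  | succ _ ih => exact ih (integrable_winInt hg) (contDiff_winInt hg hsm)

theorem deriv_iterate_winInt_iterate (hg : Integrable g) (hsm : ContDiff ℝ ∞ g) (l : ℕ) :
    deriv^[l] (winInt^[l] g) = aeval shift ((1 - X) ^ l : ℝ[X]) g := by
  induction l generalizing g with
  | zero => simp
  | succ l ih =>
    rw [Function.iterate_succ_apply', Function.iterate_succ_apply,
      ih (integrable_winInt hg) (contDiff_winInt hg hsm),
      ← winInt_aeval_shift (fun _ _ => hg.intervalIntegrable),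
      deriv_winInt (integrable_aeval_shift hg _) (contDiff_aeval_shift hsm _).continuous,
      pow_succ', map_mul, Module.End.mul_apply]

theorem deriv_iterate_comp_affine (hsm : ContDiff ℝ ∞ g) (l : ℕ) (c a b : ℝ) :
    deriv^[l] (fun x => c * g (a * x + b)) = fun x => c * a ^ l * (deriv^[l] g) (a * x + b) := by
  induction l with
  | zero => simp
  | succ l ih =>
    rw [Function.iterate_succ_apply', ih, Function.iterate_succ_apply']
    funext x
    have haff : HasDerivAt (fun x : ℝ => a * x + b) a x := by
      simpa using ((hasDerivAt_id x).const_mul a).add_const b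
    have hg : HasDerivAt (deriv^[l] g) (deriv (deriv^[l] g) (a * x + b)) (a * x + b) :=
      ((hsm.iterate_deriv l).differentiable (by simp) _).hasDerivAt
    refine ((hg.comp x haff).const_mul (c * a ^ l)).deriv.trans ?_
    ring

end Deriv

/-! ### Integration by parts against non-smooth tensor products -/

/-- `F` and its `a`-th derivative `f` are limits of smooth functions compactly supported in
`(0,1)` and of their `a`-th derivatives, so that `F` may serve as a test function. -/
def TestApprox (a : ℕ) (F f : ℝ → ℝ) : Prop :=
  ∃ η : ℕ → ℝ → ℝ, (∀ i, ContDiff ℝ ∞ (η i)) ∧ (∀ i, tsupport (η i) ⊆ Set.Ioo 0 1) ∧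
    BddTendsto η F ∧ BddTendsto (fun i => deriv^[a] (η i)) f

theorem IsKernel.testApprox_winInt_iterate {L R : ℝ} {G : ℝ → ℝ} (h : IsKernel L R G) (a : ℕ)
    (c : ℝ) {N d : ℝ} (hN : 0 < N) (hL : 0 ≤ L - d) (hR : R + a - d ≤ N) :
    TestApprox a (fun x => c * (WaveletFrame.winInt^[a] G) (N * x + d))
      (fun x => c * N ^ a * aeval shift ((1 - X) ^ a : ℝ[X]) G (N * x + d)) := by
  obtain ⟨g, hsm, hker, hlim⟩ := h.exists_contDiff_approx
  have hint i : Integrable (g i) := (hker i).elim fun _ hi => hi.2.integrable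
  have hsm' i := contDiff_winInt_iterate (hint i) (hsm i) a
  refine ⟨fun i x => c * (WaveletFrame.winInt^[a] (g i)) (N * x + d), fun i => ?_, fun i => ?_,
    ((hlim.winInt_iterate hint (fun i => (hsm i).continuous.measurable) a).comp_affine hN.ne'
      d).const_mul c, ?_⟩
  · exact contDiff_const.mul
      ((hsm' i).comp ((contDiff_const.mul contDiff_id).add contDiff_const))
  · obtain ⟨δ, hδ, hgi⟩ := hker i
    refine ((hgi.winInt_iterate a).tsupport_comp_affine_subset c hN d).trans
      (Set.Icc_subset_Ioo ?_ ?_)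
    · exact div_pos (by linarith) hN
    · exact (div_lt_one hN).2 (by linarith)
  · simp_rw [deriv_iterate_comp_affine (hsm' _), deriv_iterate_winInt_iterate (hint _) (hsm _)]
    exact ((hlim.aeval_shift _).comp_affine hN.ne' d).const_mul (c * N ^ a)

theorem IsKernel.testApprox_zero {f : ℝ → ℝ} (h : IsKernel 0 1 f) : TestApprox 0 f f := by
  simpa using h.testApprox_winInt_iterate 0 1 (d := 0) one_pos

section Primitive

variable {L R : ℝ} {G : ℝ → ℝ}

theorem BddTendsto.sub_tendsto_mul {g : ℕ → ℝ → ℝ} (hlim : BddTendsto g G) {c : ℕ → ℝ}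
    (hc : Tendsto c atTop (𝓝 0)) {θ : ℝ → ℝ} (hθ : IsKernel L R θ) :
    BddTendsto (fun i x => g i x - c i * θ x) G := by
  obtain ⟨M, hM⟩ := hlim.bdd
  obtain ⟨M', hM'⟩ := hθ.bdd
  obtain ⟨K, hK⟩ := hc.abs.bddAbove_range
  refine ⟨⟨M + K * M', fun i x => ?_⟩, ?_⟩
  · refine (abs_sub _ _).trans (add_le_add (hM i x) ?_)
    rw [abs_mul]
    have hci : |c i| ≤ K := hK ⟨i, rfl⟩
    exact mul_le_mul hci (hM' x) (abs_nonneg _) ((abs_nonneg _).trans hci)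
  · filter_upwards [hlim.tendsto] with x hx
    simpa using hx.sub (hc.mul_const (θ x))

theorem IsKernel.primitive_eq_setIntegral (h : IsKernel L R G) (x : ℝ) :
    primitive G x = ∫ t in Set.Iic x ∩ Set.Icc L R, G t :=
  setIntegral_eq_of_subset_of_forall_sdiff_eq_zero measurableSet_Iic Set.inter_subset_left
    fun t ht => h.supp t fun ht' => ht.2 ⟨ht.1, ht'⟩

theorem IsKernel.abs_primitive_le (h : IsKernel L R G) {M : ℝ} (hM : ∀ x, |G x| ≤ M) (x : ℝ) :
    |primitive G x| ≤ M * volume.real (Set.Icc L R) := by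
  have hM0 : 0 ≤ M := (abs_nonneg _).trans (hM 0)
  rw [h.primitive_eq_setIntegral]
  refine (norm_setIntegral_le_of_norm_le_const (f := G) ?_ fun t _ => hM t).trans ?_
  · exact (measure_mono Set.inter_subset_right).trans_lt measure_Icc_lt_top
  · exact mul_le_mul_of_nonneg_left
      (measureReal_mono Set.inter_subset_right measure_Icc_lt_top.ne) hM0

theorem IsKernel.primitive (h : IsKernel L R G) (h0 : ∫ x, G x = 0) :
    IsKernel L R (primitive G) := by
  obtain ⟨M, hM⟩ := h.bdd
  refine ⟨(continuous_primitive h.integrable).measurable, ⟨_, h.abs_primitive_le hM⟩,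
    fun x hx => ?_⟩
  rcases lt_or_ge x L with hxL | hxL
  · exact setIntegral_eq_zero_of_forall_eq_zero fun t ht =>
      h.supp t fun ht' => (ht'.1.trans ht).not_gt hxL
  · rw [WaveletFrame.primitive, setIntegral_eq_integral_of_forall_compl_eq_zero, h0]
    exact fun t ht => h.supp t fun ht' => hx ⟨hxL, (not_le.1 ht).le.trans ht'.2⟩

theorem BddTendsto.primitive {g : ℕ → ℝ → ℝ} (hlim : BddTendsto g G)
    (hg : ∀ i, IsKernel L R (g i)) (hG : IsKernel L R G) :
    BddTendsto (fun i => primitive (g i)) (primitive G) := by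
  obtain ⟨M, hM⟩ := hlim.bdd
  refine ⟨⟨_, fun i => (hg i).abs_primitive_le (hM i)⟩, ae_of_all _ fun x => ?_⟩
  simp_rw [fun i => (hg i).primitive_eq_setIntegral, hG.primitive_eq_setIntegral]
  exact hlim.tendsto_setIntegral (fun i => (hg i).meas)
    ((measure_mono Set.inter_subset_right).trans_lt measure_Icc_lt_top).ne

theorem exists_contDiff_isKernel_integral_eq_one :
    ∃ θ : ℝ → ℝ, ContDiff ℝ ∞ θ ∧ IsKernel (1 / 4) (3 / 4) θ ∧ ∫ x, θ x = 1 := by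
  let θ : ContDiffBump (1 / 2 : ℝ) := ⟨1 / 8, 1 / 4, by norm_num, by norm_num⟩
  have hsm : ContDiff ℝ ∞ (θ.normed volume) := θ.contDiff_normed
  refine ⟨θ.normed volume, hsm, ⟨hsm.continuous.measurable,
    hsm.continuous.bounded_above_of_compact_support θ.hasCompactSupport_normed,
    fun x hx => Function.notMem_support.1 fun hx' => hx ?_⟩, θ.integral_normed⟩
  rw [θ.support_normed_eq, Real.ball_eq_Ioo] at hx'
  exact ⟨by linarith [hx'.1], by linarith [hx'.2]⟩

theorem IsKernel.exists_contDiff_approx_of_integral_eq_zero (h : IsKernel 0 1 G)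
    (h0 : ∫ x, G x = 0) :
    ∃ g : ℕ → ℝ → ℝ, (∀ i, ContDiff ℝ ∞ (g i)) ∧ (∀ i, ∫ x, g i x = 0) ∧
      (∀ i, ∃ δ > 0, IsKernel (0 + δ) (1 - δ) (g i)) ∧ BddTendsto g G := by
  obtain ⟨g, hsm, hker, hlim⟩ := h.exists_contDiff_approx
  obtain ⟨θ, hθsm, hθ, hθ1⟩ := exists_contDiff_isKernel_integral_eq_one
  have hker' i : IsKernel 0 1 (g i) := (hker i).elim fun δ hδ =>
    hδ.2.mono (by linarith [hδ.1]) (by linarith [hδ.1])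
  have hmean : Tendsto (fun i => ∫ x, g i x) atTop (𝓝 0) := by
    have hset {f : ℝ → ℝ} (hf : IsKernel 0 1 f) : ∫ x, f x = ∫ x in Set.Icc 0 1, f x :=
      (setIntegral_eq_integral_of_forall_compl_eq_zero hf.supp).symm
    rw [← h0, hset h]
    simp_rw [fun i => hset (hker' i)]
    exact hlim.tendsto_setIntegral (fun i => (hker' i).meas) measure_Icc_lt_top.ne
  refine ⟨fun i x => g i x - (∫ t, g i t) * θ x, fun i => (hsm i).sub (contDiff_const.mul hθsm),
    fun i => ?_, fun i => ?_, hlim.sub_tendsto_mul hmean hθ⟩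
  · rw [integral_sub (hker' i).integrable (hθ.integrable.const_mul _), integral_const_mul, hθ1,
      mul_one, sub_self]
  · obtain ⟨δ, hδ, hgi⟩ := hker i
    have hleft := min_le_left δ (1 / 4)
    have hright := min_le_right δ (1 / 4)
    exact ⟨min δ (1 / 4), lt_min hδ (by norm_num),
      (hgi.mono (by linarith) (by linarith)).sub
        ((hθ.mono (by linarith) (by linarith)).const_mul _)⟩

theorem IsKernel.testApprox_primitive (h : IsKernel 0 1 G) (h0 : ∫ x, G x = 0) :
    TestApprox 1 (WaveletFrame.primitive G) G := by
  obtain ⟨g, hsm, hmean, hker, hlim⟩ := h.exists_contDiff_approx_of_integral_eq_zero h0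
  have hker' i : IsKernel 0 1 (g i) := (hker i).elim fun δ hδ =>
    hδ.2.mono (by linarith [hδ.1]) (by linarith [hδ.1])
  refine ⟨fun i => WaveletFrame.primitive (g i),
    fun i => contDiff_primitive (hker' i).integrable (hsm i), fun i => ?_,
    hlim.primitive hker' h, ?_⟩
  · obtain ⟨δ, hδ, hgi⟩ := hker i
    have hsub := (hgi.primitive (hmean i)).tsupport_comp_affine_subset 1 one_pos 0
    simp only [one_mul, add_zero, sub_zero, div_one, zero_add] at hsub
    exact hsub.trans (Set.Icc_subset_Ioo hδ (by linarith))
  · simpa only [Function.iterate_one,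
      fun i => deriv_primitive (hker' i).integrable (hsm i).continuous] using hlim

end Primitive

section Tensor

variable {f g : ℝ → ℝ}

theorem contDiff_tensor (hf : ContDiff ℝ ∞ f) (hg : ContDiff ℝ ∞ g) : ContDiff ℝ ∞ (tensor f g) :=
  (hf.comp contDiff_fst).mul (hg.comp contDiff_snd)

theorem fderiv_tensor_apply (hf : ContDiff ℝ ∞ f) (hg : ContDiff ℝ ∞ g) (x v : ℝ × ℝ) :
    fderiv ℝ (tensor f g) x v =
      v.1 * tensor (deriv f) g x + v.2 * tensor f (deriv g) x := by
  have hf' : HasDerivAt f (deriv f x.1) x.1 := (hf.differentiable (by simp) _).hasDerivAt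
  have hg' : HasDerivAt g (deriv g x.2) x.2 := (hg.differentiable (by simp) _).hasDerivAt
  have htensor : HasFDerivAt (tensor f g)
      (f x.1 • deriv g x.2 • ContinuousLinearMap.snd ℝ ℝ ℝ +
        g x.2 • deriv f x.1 • ContinuousLinearMap.fst ℝ ℝ ℝ) x :=
    (hf'.comp_hasFDerivAt x hasFDerivAt_fst).mul (hg'.comp_hasFDerivAt x hasFDerivAt_snd)
  rw [htensor.fderiv]
  simp only [add_apply, smul_apply, ContinuousLinearMap.coe_snd', ContinuousLinearMap.coe_fst',
    smul_eq_mul, tensor]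
  ring

theorem partialDeriv_tensor (hf : ContDiff ℝ ∞ f) (hg : ContDiff ℝ ∞ g) (α : ℕ × ℕ) :
    partialDeriv α (tensor f g) = tensor (deriv^[α.1] f) (deriv^[α.2] g) := by
  have hsnd a : (fun (h : ℝ × ℝ → ℝ) x => fderiv ℝ h x (0, 1))^[a] (tensor f g) =
      tensor f (deriv^[a] g) := by
    induction a with
    | zero => rfl
    | succ a ih =>
      rw [Function.iterate_succ_apply', Function.iterate_succ_apply', ih]
      funext x
      simp [fderiv_tensor_apply hf (hg.iterate_deriv a)]
  have hfst a : (fun (h : ℝ × ℝ → ℝ) x => fderiv ℝ h x (1, 0))^[a] (tensor f (deriv^[α.2] g)) =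
      tensor (deriv^[a] f) (deriv^[α.2] g) := by
    induction a with
    | zero => rfl
    | succ a ih =>
      rw [Function.iterate_succ_apply', Function.iterate_succ_apply', ih]
      funext x
      simp [fderiv_tensor_apply (hf.iterate_deriv a) (hg.iterate_deriv α.2)]
  rw [partialDeriv, hsnd, hfst]

theorem tsupport_tensor_subset (f g : ℝ → ℝ) : tsupport (tensor f g) ⊆ tsupport f ×ˢ tsupport g :=
  closure_minimal (fun _ hx => ⟨subset_tsupport f (left_ne_zero_of_mul hx),
    subset_tsupport g (right_ne_zero_of_mul hx)⟩)
    ((isClosed_tsupport f).prod (isClosed_tsupport g))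

theorem hasCompactSupport_of_tsupport_subset_Omega {η : ℝ × ℝ → ℝ} (h : tsupport η ⊆ Omega) :
    HasCompactSupport η :=
  (isCompact_Icc.prod isCompact_Icc).of_isClosed_subset (isClosed_tsupport η)
    (h.trans (Set.prod_mono Set.Ioo_subset_Icc_self Set.Ioo_subset_Icc_self))

theorem tendsto_integral_mul_tensor {u : ℝ × ℝ → ℝ} (hu : Integrable u volOmega)
    {η θ : ℕ → ℝ → ℝ} {F G : ℝ → ℝ} (hη : BddTendsto η F) (hθ : BddTendsto θ G)
    (hηm : ∀ i, Measurable (η i)) (hθm : ∀ i, Measurable (θ i)) :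
    Tendsto (fun i => ∫ x in Omega, u x * tensor (η i) (θ i) x) atTop
      (𝓝 (∫ x in Omega, u x * tensor F G x)) := by
  obtain ⟨M, hM⟩ := hη.bdd
  obtain ⟨M', hM'⟩ := hθ.bdd
  refine tendsto_integral_of_dominated_convergence (fun x => ‖u x‖ * (M * M')) (fun i => ?_)
    (hu.norm.mul_const _) (fun i => ae_of_all _ fun x => ?_) ?_
  · exact hu.1.mul
      (((hηm i).comp measurable_fst).mul ((hθm i).comp measurable_snd)).aestronglyMeasurable
  · rw [norm_mul, tensor, norm_mul]
    exact mul_le_mul_of_nonneg_left (mul_le_mul (hM i _) (hM' i _) (norm_nonneg _)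
      ((abs_nonneg _).trans (hM i 0))) (norm_nonneg _)
  · filter_upwards [ae_restrict_of_ae (Measure.quasiMeasurePreserving_fst.ae hη.tendsto),
      ae_restrict_of_ae (Measure.quasiMeasurePreserving_snd.ae hθ.tendsto)] with x hx₁ hx₂
    exact (hx₁.mul hx₂).const_mul _

theorem IsWeakDeriv.integral_tensor {α : ℕ × ℕ} {u u' : ℝ × ℝ → ℝ} (h : IsWeakDeriv α u u')
    (hu : Integrable u volOmega) (hu' : Integrable u' volOmega) {F₁ f₁ F₂ f₂ : ℝ → ℝ}
    (h₁ : TestApprox α.1 F₁ f₁) (h₂ : TestApprox α.2 F₂ f₂) :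
    ∫ x in Omega, u x * tensor f₁ f₂ x =
      (-1) ^ order α * ∫ x in Omega, u' x * tensor F₁ F₂ x := by
  obtain ⟨η, hη, hηsupp, hηlim, hηderiv⟩ := h₁
  obtain ⟨θ, hθ, hθsupp, hθlim, hθderiv⟩ := h₂
  have hsmooth i : ∫ x in Omega, u x * tensor (deriv^[α.1] (η i)) (deriv^[α.2] (θ i)) x =
      (-1) ^ order α * ∫ x in Omega, u' x * tensor (η i) (θ i) x := by
    have hsub : tsupport (tensor (η i) (θ i)) ⊆ Omega :=
      (tsupport_tensor_subset _ _).trans (Set.prod_mono (hηsupp i) (hθsupp i))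
    rw [← partialDeriv_tensor (hη i) (hθ i)]
    exact h _ (contDiff_tensor (hη i) (hθ i)) (hasCompactSupport_of_tsupport_subset_Omega hsub) hsub
  have hlim := tendsto_integral_mul_tensor hu hηderiv hθderiv
    (fun i => ((hη i).iterate_deriv _).continuous.measurable)
    (fun i => ((hθ i).iterate_deriv _).continuous.measurable)
  simp_rw [hsmooth] at hlim
  exact tendsto_nhds_unique hlim
    ((tendsto_integral_mul_tensor hu' hηlim hθlim (fun i => (hη i).continuous.measurable)
      fun i => (hθ i).continuous.measurable).const_mul _)

end Tensor

/-! ### Local averages on dyadic grids -/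

/-- The index of the dyadic cell of side `2^{-n}` containing `x`. -/
def cell (n : ℕ) (x : ℝ × ℝ) : ℤ × ℤ := (⌊2 ^ n * x.1⌋, ⌊2 ^ n * x.2⌋)

/-- The kernel `4^n κ(2^n · - k)`. -/
def scaled (κ : ℝ × ℝ → ℝ) (n : ℕ) (k : ℤ × ℤ) (y : ℝ × ℝ) : ℝ :=
  2 ^ n * 2 ^ n * κ (2 ^ n * y.1 - k.1, 2 ^ n * y.2 - k.2)

/-- The local average of `g` over `Ω` with respect to `4^n κ(2^n · - k)`. -/
def avg (κ : ℝ × ℝ → ℝ) (n : ℕ) (g : ℝ × ℝ → ℝ) (k : ℤ × ℤ) : ℝ :=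
  ∫ y in Omega, g y * scaled κ n k y

/-- The piecewise constant function with the values `a` on the cells indexed by `K`. -/
def stepFun (n : ℕ) (K : Set (ℤ × ℤ)) (a : ℤ × ℤ → ℝ) : ℝ × ℝ → ℝ :=
  (cell n ⁻¹' K).indicator fun x => a (cell n x)

/-- Averaging kernels: bounded by `M`, supported in `[-R, R]²`, of integral one. -/
structure IsAvgKernel (κ : ℝ × ℝ → ℝ) (M R : ℝ) : Prop where
  meas : Measurable κ
  bdd : ∀ z, |κ z| ≤ M
  supp : ∀ z, κ z ≠ 0 → |z.1| ≤ R ∧ |z.2| ≤ R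
  integral_eq : ∫ z, κ z = 1

/-- A bound on `L_r(Ω)`, uniform in `n` and `r`, for averaging against an averaging kernel with
parameters `M` and `R`. -/
def avgBound (M R : ℝ) : ℝ≥0∞ := ENNReal.ofReal (4 * (R + 1) ^ 2 * M)

theorem avgBound_ne_top (M R : ℝ) : avgBound M R ≠ ⊤ := ENNReal.ofReal_ne_top

theorem isOpen_Omega : IsOpen Omega := isOpen_Ioo.prod isOpen_Ioo

theorem measurableSet_Omega : MeasurableSet Omega := isOpen_Omega.measurableSet

theorem measurable_cell (n : ℕ) : Measurable (cell n) :=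
  (Int.measurable_floor.comp (measurable_fst.const_mul _)).prodMk
    (Int.measurable_floor.comp (measurable_snd.const_mul _))

section StepFun

variable (n : ℕ) (K : Set (ℤ × ℤ)) (a b : ℤ × ℤ → ℝ)

theorem measurable_stepFun : Measurable (stepFun n K a) :=
  ((measurable_of_countable a).comp (measurable_cell n)).indicator
    (measurable_cell n K.to_countable.measurableSet)

theorem norm_stepFun_le (x : ℝ × ℝ) : ‖stepFun n K a x‖ ≤ ‖a (cell n x)‖ :=
  norm_indicator_le_norm_self _ _

theorem stepFun_sub : stepFun n K (a - b) = stepFun n K a - stepFun n K b := by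
  rw [stepFun, stepFun, stepFun, ← Set.indicator_sub']
  rfl

end StepFun

section ClosedBall

variable {ρ : ℝ}

theorem volume_closedBall_prod (x : ℝ × ℝ) (hρ : 0 ≤ ρ) :
    volume (Metric.closedBall x ρ) = ENNReal.ofReal (4 * ρ ^ 2) := by
  rw [← closedBall_prod_same, Measure.volume_eq_prod, Measure.prod_prod, Real.volume_closedBall,
    Real.volume_closedBall, ← ENNReal.ofReal_mul (by positivity)]
  ring_nf

theorem lintegral_lintegral_closedBall (μ : Measure (ℝ × ℝ)) [SFinite μ] {f : ℝ × ℝ → ℝ≥0∞}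
    (hf : AEMeasurable f μ) (hρ : 0 ≤ ρ) :
    ∫⁻ x, ∫⁻ y in Metric.closedBall x ρ, f y ∂μ = ENNReal.ofReal (4 * ρ ^ 2) * ∫⁻ y, f y ∂μ := by
  have hset : MeasurableSet {z : (ℝ × ℝ) × (ℝ × ℝ) | dist z.2 z.1 ≤ ρ} :=
    (isClosed_le (continuous_snd.dist continuous_fst) continuous_const).measurableSet
  calc ∫⁻ x, ∫⁻ y in Metric.closedBall x ρ, f y ∂μ
      = ∫⁻ x, ∫⁻ y, {z : (ℝ × ℝ) × (ℝ × ℝ) | dist z.2 z.1 ≤ ρ}.indicator (fun z => f z.2) (x, y)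
          ∂μ := lintegral_congr fun x => (lintegral_indicator measurableSet_closedBall _).symm
    _ = ∫⁻ y, (∫⁻ x, (Metric.closedBall y ρ).indicator (fun _ => f y) x) ∂μ := by
      rw [lintegral_lintegral_swap (f := fun x y => {z : (ℝ × ℝ) × (ℝ × ℝ) | dist z.2 z.1 ≤ ρ}
        |>.indicator (fun z => f z.2) (x, y)) (hf.comp_snd.indicator hset)]
      refine lintegral_congr fun y => lintegral_congr fun x => ?_
      simp only [Set.indicator, Set.mem_ofPred_eq, Metric.mem_closedBall, dist_comm y x]
    _ = ENNReal.ofReal (4 * ρ ^ 2) * ∫⁻ y, f y ∂μ := by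
      rw [← lintegral_const_mul' _ _ ENNReal.ofReal_ne_top]
      refine lintegral_congr fun y => ?_
      rw [lintegral_indicator measurableSet_closedBall, setLIntegral_const,
        volume_closedBall_prod _ hρ, mul_comm]

theorem rpow_lintegral_enorm_le {α : Type*} [MeasurableSpace α] {μ : Measure α} {g : α → ℝ}
    (hg : AEStronglyMeasurable g μ) {r : ℝ} (hr : 1 ≤ r) :
    (∫⁻ y, ‖g y‖ₑ ∂μ) ^ r ≤ μ Set.univ ^ (r - 1) * ∫⁻ y, ‖g y‖ₑ ^ r ∂μ := by
  have hr0 : 0 < r := by linarith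
  have hHolder := eLpNorm_le_eLpNorm_mul_rpow_measure_univ (p := 1) (q := ENNReal.ofReal r)
    (by simpa using hr) hg
  rw [eLpNorm_one_eq_lintegral_enorm, eLpNorm_eq_lintegral_rpow_enorm_toReal (by simpa using hr0)
    ENNReal.ofReal_ne_top, ENNReal.toReal_ofReal hr0.le, ENNReal.toReal_one] at hHolder
  have hpow := ENNReal.rpow_le_rpow hHolder hr0.le
  rwa [ENNReal.mul_rpow_of_nonneg _ _ hr0.le, ← ENNReal.rpow_mul, one_div_mul_cancel hr0.ne',
    ENNReal.rpow_one, ← ENNReal.rpow_mul, mul_comm,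
    show (1 / 1 - 1 / r) * r = r - 1 by field_simp] at hpow

theorem lintegral_rpow_closedBall_le {μ : Measure (ℝ × ℝ)} [SFinite μ] (hμ : μ ≤ volume)
    {g : ℝ × ℝ → ℝ} (hg : AEStronglyMeasurable g μ) (hρ : 0 < ρ) {r : ℝ} (hr : 1 ≤ r) :
    ∫⁻ x, (∫⁻ y in Metric.closedBall x ρ, ‖g y‖ₑ ∂μ) ^ r ≤
      ENNReal.ofReal (4 * ρ ^ 2) ^ r * ∫⁻ y, ‖g y‖ₑ ^ r ∂μ := by
  set V := ENNReal.ofReal (4 * ρ ^ 2) with hV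
  have hV0 : V ≠ 0 := by rw [hV]; positivity
  have hVt : V ≠ ⊤ := ENNReal.ofReal_ne_top
  have hball x : (∫⁻ y in Metric.closedBall x ρ, ‖g y‖ₑ ∂μ) ^ r ≤
      V ^ (r - 1) * ∫⁻ y in Metric.closedBall x ρ, ‖g y‖ₑ ^ r ∂μ := by
    refine (rpow_lintegral_enorm_le hg.restrict hr).trans ?_
    rw [Measure.restrict_apply_univ]
    gcongr
    exact (hμ _).trans (volume_closedBall_prod x hρ.le).le
  calc ∫⁻ x, (∫⁻ y in Metric.closedBall x ρ, ‖g y‖ₑ ∂μ) ^ r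
      ≤ ∫⁻ x, V ^ (r - 1) * ∫⁻ y in Metric.closedBall x ρ, ‖g y‖ₑ ^ r ∂μ := lintegral_mono hball
    _ = V ^ (r - 1) * (V * ∫⁻ y, ‖g y‖ₑ ^ r ∂μ) := by
      rw [lintegral_const_mul' _ _ (ENNReal.rpow_ne_top_of_nonneg (by linarith) hVt),
        lintegral_lintegral_closedBall μ (hg.enorm.pow_const r) hρ.le]
    _ = V ^ r * ∫⁻ y, ‖g y‖ₑ ^ r ∂μ := by
      rw [← mul_assoc]
      nth_rw 2 [← ENNReal.rpow_one V]
      rw [← ENNReal.rpow_add _ _ hV0 hVt, sub_add_cancel]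

end ClosedBall

theorem eventually_closedBall_div_two_pow_subset (ρ : ℝ) {x : ℝ × ℝ} {s : Set (ℝ × ℝ)}
    (hs : s ∈ 𝓝 x) :
    ∀ᶠ n : ℕ in atTop, Metric.closedBall x (ρ / 2 ^ n) ⊆ s := by
  have hlim : Tendsto (fun n : ℕ => ρ / 2 ^ n) atTop (𝓝 0) :=
    tendsto_const_nhds.div_atTop (tendsto_pow_atTop_atTop_of_one_lt one_lt_two)
  exact hlim.eventually (eventually_closedBall_subset hs)

theorem integral_scaled (κ : ℝ × ℝ → ℝ) (n : ℕ) (k : ℤ × ℤ) :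
    ∫ y, scaled κ n k y = ∫ z, κ z := by
  let shifted : ℝ × ℝ → ℝ := fun z => κ (z - ((k.1 : ℝ), (k.2 : ℝ)))
  calc ∫ y, scaled κ n k y = 2 ^ n * 2 ^ n * ∫ y : ℝ × ℝ, shifted ((2 ^ n : ℝ) • y) :=
        integral_const_mul _ _
    _ = ∫ z, shifted z := by
      rw [Measure.integral_comp_smul, Module.finrank_prod, Module.finrank_self,
        abs_of_nonneg (by positivity), smul_eq_mul]
      field_simp
    _ = ∫ z, κ z := integral_sub_right_eq_self κ _

namespace IsAvgKernel

variable {κ : ℝ × ℝ → ℝ} {M R : ℝ}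

theorem nonneg_bound (h : IsAvgKernel κ M R) : 0 ≤ M := (abs_nonneg _).trans (h.bdd 0)

theorem nonneg_radius (h : IsAvgKernel κ M R) : 0 ≤ R := by
  by_contra hR
  have hκ : κ = 0 := funext fun z => by_contra fun hz => hR ((abs_nonneg _).trans (h.supp z hz).1)
  simpa [hκ] using h.integral_eq

theorem measurable_scaled (h : IsAvgKernel κ M R) (n : ℕ) (k : ℤ × ℤ) :
    Measurable (scaled κ n k) :=
  (h.meas.comp (((measurable_fst.const_mul _).sub_const _).prodMk
    ((measurable_snd.const_mul _).sub_const _))).const_mul _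

theorem abs_scaled_le (h : IsAvgKernel κ M R) (n : ℕ) (k : ℤ × ℤ) (y : ℝ × ℝ) :
    |scaled κ n k y| ≤ 2 ^ n * 2 ^ n * M := by
  rw [scaled, abs_mul, abs_of_nonneg (by positivity : (0 : ℝ) ≤ 2 ^ n * 2 ^ n)]
  exact mul_le_mul_of_nonneg_left (h.bdd _) (by positivity)

theorem mem_closedBall_of_scaled_ne_zero (h : IsAvgKernel κ M R) {n : ℕ} {x y : ℝ × ℝ}
    (hy : scaled κ n (cell n x) y ≠ 0) : y ∈ Metric.closedBall x ((R + 1) / 2 ^ n) := by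
  have hn : (0 : ℝ) < 2 ^ n := by positivity
  have hcoord {a b : ℝ} (hab : |2 ^ n * b - (⌊2 ^ n * a⌋ : ℝ)| ≤ R) :
      |b - a| ≤ (R + 1) / 2 ^ n := by
    rw [abs_le] at hab
    rw [le_div_iff₀ hn, ← abs_of_pos hn, ← abs_mul, abs_le]
    constructor <;>
      linarith [hab.1, hab.2, Int.floor_le (2 ^ n * a), Int.lt_floor_add_one (2 ^ n * a)]
  obtain ⟨h₁, h₂⟩ := h.supp _ (right_ne_zero_of_mul hy)
  rw [Metric.mem_closedBall, Prod.dist_eq, Real.dist_eq, Real.dist_eq]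
  exact max_le (hcoord h₁) (hcoord h₂)

theorem integrable_mul_scaled (h : IsAvgKernel κ M R) (n : ℕ) (k : ℤ × ℤ) {g : ℝ × ℝ → ℝ}
    (hg : Integrable g volOmega) : Integrable (fun y => g y * scaled κ n k y) volOmega :=
  hg.mul_bdd (h.measurable_scaled n k).aestronglyMeasurable (ae_of_all _ (h.abs_scaled_le n k))

theorem avg_sub (h : IsAvgKernel κ M R) (n : ℕ) {f g : ℝ × ℝ → ℝ} (hf : Integrable f volOmega)
    (hg : Integrable g volOmega) : avg κ n (f - g) = avg κ n f - avg κ n g := by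
  funext k
  simp only [Pi.sub_apply, avg, sub_mul]
  exact integral_sub (h.integrable_mul_scaled n k hf) (h.integrable_mul_scaled n k hg)

theorem enorm_avg_le (h : IsAvgKernel κ M R) (n : ℕ) (g : ℝ × ℝ → ℝ) (x : ℝ × ℝ) :
    ‖avg κ n g (cell n x)‖ₑ ≤ ENNReal.ofReal (2 ^ n * 2 ^ n * M) *
      ∫⁻ y in Metric.closedBall x ((R + 1) / 2 ^ n), ‖g y‖ₑ ∂volOmega := by
  refine (enorm_integral_le_lintegral_enorm _).trans ?_
  rw [← lintegral_const_mul' _ _ ENNReal.ofReal_ne_top,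
    ← lintegral_indicator measurableSet_closedBall]
  refine lintegral_mono fun y => ?_
  by_cases hy : scaled κ n (cell n x) y = 0
  · simp only [hy, mul_zero, enorm_zero, zero_le]
  · rw [Set.indicator_of_mem (h.mem_closedBall_of_scaled_ne_zero hy), enorm_mul, mul_comm,
      Real.enorm_eq_ofReal_abs (scaled _ _ _ _)]
    gcongr
    exact h.abs_scaled_le n _ y

theorem ofReal_mul_volume_closedBall (h : IsAvgKernel κ M R) (n : ℕ) :
    ENNReal.ofReal (2 ^ n * 2 ^ n * M) * ENNReal.ofReal (4 * ((R + 1) / 2 ^ n) ^ 2) =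
      avgBound M R := by
  have hM := h.nonneg_bound
  rw [← ENNReal.ofReal_mul (by positivity), avgBound]
  congr 1
  field_simp

theorem enorm_avg_le_of_forall_enorm_le (h : IsAvgKernel κ M R) {n : ℕ} {g : ℝ × ℝ → ℝ}
    {x : ℝ × ℝ} {δ : ℝ≥0∞} (hg : ∀ y ∈ Metric.closedBall x ((R + 1) / 2 ^ n), ‖g y‖ₑ ≤ δ) :
    ‖avg κ n g (cell n x)‖ₑ ≤ avgBound M R * δ := by
  have hR := h.nonneg_radius
  calc ‖avg κ n g (cell n x)‖ₑ
      ≤ ENNReal.ofReal (2 ^ n * 2 ^ n * M) *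
          ∫⁻ y in Metric.closedBall x ((R + 1) / 2 ^ n), ‖g y‖ₑ ∂volOmega := h.enorm_avg_le n g x
    _ ≤ ENNReal.ofReal (2 ^ n * 2 ^ n * M) *
          (δ * ENNReal.ofReal (4 * ((R + 1) / 2 ^ n) ^ 2)) := by
      gcongr
      refine (setLIntegral_mono measurable_const hg).trans ?_
      rw [setLIntegral_const, ← volume_closedBall_prod x (by positivity)]
      gcongr
      exact Measure.restrict_le_self
    _ = avgBound M R * δ := by
      rw [← h.ofReal_mul_volume_closedBall n]
      ring

theorem eLpNorm_stepFun_avg_le (h : IsAvgKernel κ M R) (n : ℕ) (K : Set (ℤ × ℤ)) {g : ℝ × ℝ → ℝ}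
    (hg : AEStronglyMeasurable g volOmega) {r : ℝ≥0∞} (hr : 1 ≤ r) (hr' : r ≠ ⊤) :
    eLpNorm (stepFun n K (avg κ n g)) r volOmega ≤ avgBound M R * eLpNorm g r volOmega := by
  have hrn : r ≠ 0 := (zero_lt_one.trans_le hr).ne'
  have hr1 : 1 ≤ r.toReal := by
    rw [← ENNReal.toReal_one]
    exact ENNReal.toReal_mono hr' hr
  have hr0 : 0 < r.toReal := zero_lt_one.trans_le hr1
  have hρ : 0 < (R + 1) / 2 ^ n := by have := h.nonneg_radius; positivity
  have hpow : ∫⁻ x, ‖avg κ n g (cell n x)‖ₑ ^ r.toReal ∂volOmega ≤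
      avgBound M R ^ r.toReal * ∫⁻ y, ‖g y‖ₑ ^ r.toReal ∂volOmega := by
    calc ∫⁻ x, ‖avg κ n g (cell n x)‖ₑ ^ r.toReal ∂volOmega
        ≤ ∫⁻ x, ‖avg κ n g (cell n x)‖ₑ ^ r.toReal :=
          lintegral_mono' Measure.restrict_le_self le_rfl
      _ ≤ ∫⁻ x, ENNReal.ofReal (2 ^ n * 2 ^ n * M) ^ r.toReal *
          (∫⁻ y in Metric.closedBall x ((R + 1) / 2 ^ n), ‖g y‖ₑ ∂volOmega) ^ r.toReal := by
        refine lintegral_mono fun x => ?_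
        rw [← ENNReal.mul_rpow_of_nonneg _ _ hr0.le]
        exact ENNReal.rpow_le_rpow (h.enorm_avg_le n g x) hr0.le
      _ ≤ ENNReal.ofReal (2 ^ n * 2 ^ n * M) ^ r.toReal *
          (ENNReal.ofReal (4 * ((R + 1) / 2 ^ n) ^ 2) ^ r.toReal *
            ∫⁻ y, ‖g y‖ₑ ^ r.toReal ∂volOmega) := by
        rw [lintegral_const_mul' _ _ (ENNReal.rpow_ne_top_of_nonneg hr0.le ENNReal.ofReal_ne_top)]
        gcongr
        exact lintegral_rpow_closedBall_le Measure.restrict_le_self hg hρ hr1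
      _ = avgBound M R ^ r.toReal * ∫⁻ y, ‖g y‖ₑ ^ r.toReal ∂volOmega := by
        rw [← mul_assoc, ← ENNReal.mul_rpow_of_nonneg _ _ hr0.le, h.ofReal_mul_volume_closedBall]
  refine (eLpNorm_mono (norm_stepFun_le n K _)).trans ?_
  rw [eLpNorm_eq_lintegral_rpow_enorm_toReal hrn hr',
    eLpNorm_eq_lintegral_rpow_enorm_toReal hrn hr']
  refine (ENNReal.rpow_le_rpow hpow (by positivity)).trans_eq ?_
  rw [ENNReal.mul_rpow_of_nonneg _ _ (by positivity), ← ENNReal.rpow_mul,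
    mul_one_div_cancel hr0.ne', ENNReal.rpow_one]

theorem eventually_avg_const (h : IsAvgKernel κ M R) (c : ℝ) {x : ℝ × ℝ} (hx : x ∈ Omega) :
    ∀ᶠ n in atTop, avg κ n (fun _ => c) (cell n x) = c := by
  filter_upwards [eventually_closedBall_div_two_pow_subset (R + 1) (isOpen_Omega.mem_nhds hx)]
    with n hn
  have hsupp y (hy : y ∉ Omega) : scaled κ n (cell n x) y = 0 :=
    by_contra fun hne => hy (hn (h.mem_closedBall_of_scaled_ne_zero hne))
  rw [avg, integral_const_mul, setIntegral_eq_integral_of_forall_compl_eq_zero hsupp,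
    integral_scaled, h.integral_eq, mul_one]

theorem tendsto_avg (h : IsAvgKernel κ M R) {g : ℝ × ℝ → ℝ} (hg : Continuous g)
    (hint : Integrable g volOmega) {x : ℝ × ℝ} (hx : x ∈ Omega) :
    Tendsto (fun n => avg κ n g (cell n x)) atTop (𝓝 (g x)) := by
  rw [tendsto_iff_edist_tendsto_0, ENNReal.tendsto_nhds_zero]
  intro ε hε
  have hδ : 0 < ε / avgBound M R := ENNReal.div_pos hε.ne' (avgBound_ne_top M R)
  have hnear : {y | ‖g y - g x‖ₑ ≤ ε / avgBound M R} ∈ 𝓝 x := by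
    have hlim : Tendsto (fun y => ‖g y - g x‖ₑ) (𝓝 x) (𝓝 0) := by
      simpa using (hg.sub (continuous_const (y := g x))).enorm.tendsto x
    exact ENNReal.tendsto_nhds_zero.1 hlim _ hδ
  filter_upwards [h.eventually_avg_const (g x) hx,
    eventually_closedBall_div_two_pow_subset (R + 1) hnear] with n hconst hball
  have hsub : avg κ n g (cell n x) - g x = avg κ n (g - fun _ => g x) (cell n x) := by
    rw [h.avg_sub n hint (integrable_const _), Pi.sub_apply, hconst]
  rw [edist_eq_enorm_sub, hsub]
  exact (h.enorm_avg_le_of_forall_enorm_le hball).trans ENNReal.mul_div_le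

end IsAvgKernel

theorem tendsto_eLpNorm_zero_of_bdd {α : Type*} [MeasurableSpace α] {μ : Measure α}
    [IsFiniteMeasure μ] {F : ℕ → α → ℝ} (hF : ∀ n, AEStronglyMeasurable (F n) μ) {B : ℝ≥0∞}
    (hBt : B ≠ ⊤) (hB : ∀ n x, ‖F n x‖ₑ ≤ B)
    (hlim : ∀ᵐ x ∂μ, Tendsto (fun n => F n x) atTop (𝓝 0)) {r : ℝ≥0∞} (hr : r ≠ 0)
    (hr' : r ≠ ⊤) : Tendsto (fun n => eLpNorm (F n) r μ) atTop (𝓝 0) := by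
  have hr0 : 0 < r.toReal := ENNReal.toReal_pos hr hr'
  have hpow : Tendsto (fun n => ∫⁻ x, ‖F n x‖ₑ ^ r.toReal ∂μ) atTop (𝓝 (∫⁻ _, 0 ∂μ)) := by
    refine tendsto_lintegral_of_dominated_convergence' (fun _ => B ^ r.toReal)
      (fun n => (hF n).enorm.pow_const _)
      (fun n => ae_of_all _ fun x => ENNReal.rpow_le_rpow (hB n x) hr0.le) ?_ ?_
    · rw [lintegral_const]
      exact ENNReal.mul_ne_top (ENNReal.rpow_ne_top_of_nonneg hr0.le hBt) (measure_ne_top _ _)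
    · filter_upwards [hlim] with x hx
      simpa [hr0] using hx.enorm.ennrpow_const r.toReal
  simp_rw [eLpNorm_eq_lintegral_rpow_enorm_toReal hr hr']
  simpa [hr0] using hpow.ennrpow_const (1 / r.toReal)

namespace IsAvgKernel

variable {κ : ℝ × ℝ → ℝ} {M R : ℝ} {K : ℕ → Set (ℤ × ℤ)} {r : ℝ≥0∞}

theorem tendsto_eLpNorm_stepFun_avg_sub_of_continuous (h : IsAvgKernel κ M R)
    (hK : ∀ x ∈ Omega, ∀ᶠ n in atTop, cell n x ∈ K n) {g : ℝ × ℝ → ℝ}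
    (hg : Continuous g) (hc : HasCompactSupport g) (hr : r ≠ 0) (hr' : r ≠ ⊤) :
    Tendsto (fun n => eLpNorm (stepFun n (K n) (avg κ n g) - g) r volOmega) atTop (𝓝 0) := by
  obtain ⟨H, hH⟩ := hg.bounded_above_of_compact_support hc
  have hH' x : ‖g x‖ₑ ≤ ENNReal.ofReal H := by
    rw [← ofReal_norm]
    exact ENNReal.ofReal_le_ofReal (hH x)
  refine tendsto_eLpNorm_zero_of_bdd
    (B := avgBound M R * ENNReal.ofReal H + ENNReal.ofReal H)
    (fun n => (measurable_stepFun _ _ _).aestronglyMeasurable.sub hg.aestronglyMeasurable)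
    (by finiteness [avgBound_ne_top M R]) (fun n x => ?_) ?_ hr hr'
  · exact (enorm_sub_le ..).trans (add_le_add ((enorm_indicator_le_enorm_self _ _).trans
      (h.enorm_avg_le_of_forall_enorm_le fun y _ => hH' y)) (hH' x))
  · refine (ae_restrict_iff' measurableSet_Omega).2 (ae_of_all _ fun x hx => ?_)
    have havg := (h.tendsto_avg hg (hg.integrable_of_hasCompactSupport hc).restrict hx).sub_const
      (g x)
    rw [sub_self] at havg
    refine havg.congr' ?_
    filter_upwards [hK x hx] with n hn
    rw [Pi.sub_apply, stepFun, Set.indicator_of_mem (Set.mem_preimage.2 hn)]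

theorem eLpNorm_stepFun_avg_sub_le (h : IsAvgKernel κ M R) (n : ℕ) (K : Set (ℤ × ℤ)) (hr : 1 ≤ r)
    (hr' : r ≠ ⊤) {f g G : ℝ × ℝ → ℝ} (hf : MemLp f r volOmega) (hg : MemLp g r volOmega)
    (hG : MemLp G r volOmega) :
    eLpNorm (stepFun n K (avg κ n g) - G) r volOmega ≤ avgBound M R * eLpNorm (g - f) r volOmega +
      eLpNorm (stepFun n K (avg κ n f) - f) r volOmega + eLpNorm (f - G) r volOmega := by
  have hstep a : AEStronglyMeasurable (stepFun n K a) volOmega :=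
    (measurable_stepFun _ _ _).aestronglyMeasurable
  have hsplit : stepFun n K (avg κ n g) - G =
      stepFun n K (avg κ n (g - f)) + (stepFun n K (avg κ n f) - f) + (f - G) := by
    rw [h.avg_sub n (hg.integrable hr) (hf.integrable hr), stepFun_sub]
    abel
  rw [hsplit]
  refine (eLpNorm_add_le ((hstep _).add ((hstep _).sub hf.1)) (hf.1.sub hG.1) hr).trans ?_
  gcongr
  refine (eLpNorm_add_le (hstep _) ((hstep _).sub hf.1) hr).trans ?_
  gcongr
  exact h.eLpNorm_stepFun_avg_le n _ (hg.1.sub hf.1) hr hr'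

theorem tendsto_eLpNorm_stepFun_avg_sub (h : IsAvgKernel κ M R)
    (hK : ∀ x ∈ Omega, ∀ᶠ n in atTop, cell n x ∈ K n) {g : ℝ × ℝ → ℝ}
    (hg : MemLp g r volOmega) (hr : 1 ≤ r) (hr' : r ≠ ⊤) :
    Tendsto (fun n => eLpNorm (stepFun n (K n) (avg κ n g) - g) r volOmega) atTop (𝓝 0) := by
  rw [ENNReal.tendsto_nhds_zero]
  intro ε hε
  have hct : avgBound M R + 1 ≠ ⊤ := by finiteness [avgBound_ne_top M R]
  have hε2 : 0 < ε / 2 := ENNReal.half_pos hε.ne'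
  obtain ⟨f, hfc, hfg, hf, hfm⟩ :=
    hg.exists_hasCompactSupport_eLpNorm_sub_le hr' (ENNReal.div_pos hε2.ne' hct).ne'
  have hlim := h.tendsto_eLpNorm_stepFun_avg_sub_of_continuous hK hf hfc
    (zero_lt_one.trans_le hr).ne' hr'
  filter_upwards [ENNReal.tendsto_nhds_zero.1 hlim _ hε2] with n hn
  calc eLpNorm (stepFun n (K n) (avg κ n g) - g) r volOmega
      ≤ avgBound M R * eLpNorm (g - f) r volOmega +
          eLpNorm (stepFun n (K n) (avg κ n f) - f) r volOmega + eLpNorm (f - g) r volOmega :=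
        h.eLpNorm_stepFun_avg_sub_le n _ hr hr' hfm hg hg
    _ ≤ avgBound M R * eLpNorm (g - f) r volOmega + ε / 2 + eLpNorm (g - f) r volOmega := by
      rw [eLpNorm_sub_comm f g]
      gcongr
    _ = (avgBound M R + 1) * eLpNorm (g - f) r volOmega + ε / 2 := by ring
    _ ≤ (avgBound M R + 1) * (ε / 2 / (avgBound M R + 1)) + ε / 2 := by gcongr
    _ ≤ ε / 2 + ε / 2 := by gcongr; exact ENNReal.mul_div_le
    _ = ε := ENNReal.add_halves ε

theorem tendsto_eLpNorm_stepFun_avg (h : IsAvgKernel κ M R)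
    (hK : ∀ x ∈ Omega, ∀ᶠ n in atTop, cell n x ∈ K n) (hr : 1 ≤ r) (hr' : r ≠ ⊤) {l : Filter ℕ}
    (hl : l ≤ atTop) {g : ℕ → ℝ × ℝ → ℝ} {G : ℝ × ℝ → ℝ} (hg : ∀ n, MemLp (g n) r volOmega)
    (hG : MemLp G r volOmega) (hlim : Tendsto (fun n => eLpNorm (g n - G) r volOmega) l (𝓝 0)) :
    Tendsto (fun n => eLpNorm (stepFun n (K n) (avg κ n (g n)) - G) r volOmega) l (𝓝 0) := by
  have hbound := (ENNReal.Tendsto.const_mul (a := avgBound M R) hlim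
    (Or.inr (avgBound_ne_top M R))).add
      ((h.tendsto_eLpNorm_stepFun_avg_sub hK hG hr hr').mono_left hl)
  rw [mul_zero, add_zero] at hbound
  refine tendsto_of_tendsto_of_tendsto_of_le_of_le tendsto_const_nhds hbound (fun _ => zero_le)
    fun n => ?_
  simpa using h.eLpNorm_stepFun_avg_sub_le n (K n) hr hr' hG (hg n) hG

end IsAvgKernel

/-! ### Discrete norms as norms of step functions -/

/-- The dyadic interval `[k 2^{-n}, (k + 1) 2^{-n})`. -/
def dyadicInterval (n : ℕ) (k : ℤ) : Set ℝ := {t | ⌊2 ^ n * t⌋ = k}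

/-- The indices of the dyadic cells contained in `[0,1)²`. -/
def boxIndex (n : ℕ) : Set (ℤ × ℤ) := Set.Ico 0 (2 ^ n) ×ˢ Set.Ico 0 (2 ^ n)

section Dyadic

variable (n : ℕ)

theorem dyadicInterval_eq_Ico (k : ℤ) :
    dyadicInterval n k = Set.Ico ((k : ℝ) / 2 ^ n) ((k + 1) / 2 ^ n) := by
  have hn : (0 : ℝ) < 2 ^ n := by positivity
  ext t
  rw [dyadicInterval, Set.mem_ofPred_eq, Int.floor_eq_iff, Set.mem_Ico, div_le_iff₀ hn,
    lt_div_iff₀ hn, mul_comm]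

theorem measurableSet_dyadicInterval (k : ℤ) : MeasurableSet (dyadicInterval n k) := by
  rw [dyadicInterval_eq_Ico]
  exact measurableSet_Ico

theorem volume_dyadicInterval (k : ℤ) : volume (dyadicInterval n k) = (2 ^ n)⁻¹ := by
  have hn : (0 : ℝ) < 2 ^ n := by positivity
  rw [dyadicInterval_eq_Ico, Real.volume_Ico, ← sub_div, add_sub_cancel_left, one_div,
    ENNReal.ofReal_inv_of_pos hn, ENNReal.ofReal_pow zero_le_two, ENNReal.ofReal_ofNat]

theorem volume_cell_preimage (k : ℤ × ℤ) : volume (cell n ⁻¹' {k}) = (2 ^ (2 * n))⁻¹ := by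
  have hprod : cell n ⁻¹' {k} = dyadicInterval n k.1 ×ˢ dyadicInterval n k.2 := by
    ext x
    exact Prod.ext_iff
  rw [hprod, Measure.volume_eq_prod, Measure.prod_prod, volume_dyadicInterval,
    volume_dyadicInterval, two_mul, pow_add, ENNReal.mul_inv (by simp) (by simp)]

theorem lintegral_comp_cell (F : ℤ × ℤ → ℝ≥0∞) :
    ∫⁻ x, F (cell n x) = (2 ^ (2 * n))⁻¹ * ∑' k, F k := by
  rw [← lintegral_map (measurable_of_countable F) (measurable_cell n), lintegral_countable',
    ← ENNReal.tsum_mul_left]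
  refine tsum_congr fun k => ?_
  rw [Measure.map_apply (measurable_cell n) (measurableSet_singleton k), volume_cell_preimage,
    mul_comm]

theorem finite_boxIndex : (boxIndex n).Finite := (Set.finite_Ico _ _).prod (Set.finite_Ico _ _)

variable {n}

theorem cell_mem_boxIndex {x : ℝ × ℝ} :
    cell n x ∈ boxIndex n ↔ x ∈ Set.Ico (0 : ℝ) 1 ×ˢ Set.Ico (0 : ℝ) 1 := by
  have hn : (0 : ℝ) < 2 ^ n := by positivity
  have hfloor (a : ℝ) : ⌊2 ^ n * a⌋ ∈ Set.Ico (0 : ℤ) (2 ^ n) ↔ a ∈ Set.Ico (0 : ℝ) 1 := by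
    rw [Set.mem_Ico, Int.floor_nonneg, Int.floor_lt, Set.mem_Ico, Int.cast_pow, Int.cast_ofNat,
      mul_nonneg_iff_of_pos_left hn, mul_lt_iff_lt_one_right hn]
  exact and_congr (hfloor x.1) (hfloor x.2)

theorem volOmega_eq : volOmega = volume.restrict (Set.Ico (0 : ℝ) 1 ×ˢ Set.Ico (0 : ℝ) 1) := by
  refine Measure.restrict_congr_set ?_
  rw [Omega, Measure.volume_eq_prod]
  exact Measure.set_prod_ae_eq Ioo_ae_eq_Ico Ioo_ae_eq_Ico

theorem setLIntegral_comp_cell {K : Set (ℤ × ℤ)} (hK : K ⊆ boxIndex n) (F : ℤ × ℤ → ℝ≥0∞) :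
    ∫⁻ x, K.indicator F (cell n x) ∂volOmega = (2 ^ (2 * n))⁻¹ * ∑' k : K, F k := by
  rw [tsum_subtype K F, ← lintegral_comp_cell, volOmega_eq, setLIntegral_eq_of_support_subset]
  exact fun x hx => cell_mem_boxIndex.1 (hK (Set.mem_of_indicator_ne_zero hx))

end Dyadic

section VectorNorm

variable {ι : Type} [Fintype ι] {r : ℝ≥0∞}

theorem enorm_toLp_rpow (y : ι → ℝ) {s : ℝ} (hs : 0 ≤ s) :
    ‖WithLp.toLp 2 y‖ₑ ^ s = ENNReal.ofReal ((∑ i, |y i| ^ 2) ^ (s / 2)) := by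
  rw [← ofReal_norm, EuclideanSpace.norm_eq, Real.sqrt_eq_rpow,
    ENNReal.ofReal_rpow_of_nonneg (by positivity) hs, ← Real.rpow_mul (by positivity),
    one_div_mul_eq_div]
  rfl

theorem discreteNorm_eq_eLpNorm {n : ℕ} {K : Set (ℤ × ℤ)} (hK : K ⊆ boxIndex n) (hr : r ≠ 0)
    (hr' : r ≠ ⊤) (a : ι → ℤ × ℤ → ℝ) :
    discreteNorm n K r.toReal (fun i k => a i k) =
      eLpNorm (fun x => WithLp.toLp 2 fun i => stepFun n K (a i) x) r volOmega := by
  have hr0 : 0 < r.toReal := ENNReal.toReal_pos hr hr'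
  have hstep x : ‖WithLp.toLp 2 fun i => stepFun n K (a i) x‖ₑ ^ r.toReal =
      K.indicator (fun k => ENNReal.ofReal ((∑ i, |a i k| ^ 2) ^ (r.toReal / 2))) (cell n x) := by
    rw [enorm_toLp_rpow _ hr0.le]
    by_cases hx : cell n x ∈ K <;> simp [stepFun, hx, hr0.ne']
  rw [eLpNorm_eq_lintegral_rpow_enorm_toReal hr hr', discreteNorm]
  simp_rw [hstep]
  rw [setLIntegral_comp_cell hK]

theorem continuumNorm_eq_eLpNorm (hr : r ≠ 0) (hr' : r ≠ ⊤) (g : ι → ℝ × ℝ → ℝ) :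
    continuumNorm r.toReal g = eLpNorm (fun x => WithLp.toLp 2 fun i => g i x) r volOmega := by
  rw [eLpNorm_eq_lintegral_rpow_enorm_toReal hr hr', continuumNorm]
  simp_rw [enorm_toLp_rpow _ ENNReal.toReal_nonneg]

section MeasureSpace

variable {α : Type*} [MeasurableSpace α] {μ : Measure α}

theorem aestronglyMeasurable_toLp {ι : Type*} [Countable ι] {g : ι → α → ℝ}
    (hg : ∀ i, AEStronglyMeasurable (g i) μ) :
    AEStronglyMeasurable (fun x => WithLp.toLp 2 fun i => g i x) μ :=
  (PiLp.continuous_toLp 2 _).comp_aestronglyMeasurable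
    (aemeasurable_pi_lambda _ fun i => (hg i).aemeasurable).aestronglyMeasurable

theorem eLpNorm_toLp_le (hr : 1 ≤ r) {g : ι → α → ℝ} (hg : ∀ i, AEStronglyMeasurable (g i) μ) :
    eLpNorm (fun x => WithLp.toLp 2 fun i => g i x) r μ ≤ ∑ i, eLpNorm (g i) r μ := by
  have hpoint x : ‖WithLp.toLp 2 fun i => g i x‖ ≤ ‖(∑ i, fun x => ‖g i x‖) x‖ := by
    rw [EuclideanSpace.norm_eq, Finset.sum_apply,
      Real.norm_of_nonneg (Finset.sum_nonneg fun i _ => norm_nonneg _)]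
    exact Real.sqrt_le_iff.2 ⟨Finset.sum_nonneg fun i _ => norm_nonneg _,
      Finset.sum_sq_le_sq_sum_of_nonneg fun i _ => norm_nonneg _⟩
  calc eLpNorm (fun x => WithLp.toLp 2 fun i => g i x) r μ
      ≤ eLpNorm (∑ i, fun x => ‖g i x‖) r μ := eLpNorm_mono hpoint
    _ ≤ ∑ i, eLpNorm (fun x => ‖g i x‖) r μ := eLpNorm_sum_le (fun i _ => (hg i).norm) hr
    _ = ∑ i, eLpNorm (g i) r μ := Finset.sum_congr rfl fun i _ => eLpNorm_norm (g i)

theorem tendsto_eLpNorm_of_tendsto_eLpNorm_sub {β E : Type*} [NormedAddCommGroup E] (hr : 1 ≤ r)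
    {l : Filter β} {F : β → α → E} {G : α → E} (hF : ∀ n, AEStronglyMeasurable (F n) μ)
    (hG : MemLp G r μ) (h : Tendsto (fun n => eLpNorm (F n - G) r μ) l (𝓝 0)) :
    Tendsto (fun n => eLpNorm (F n) r μ) l (𝓝 (eLpNorm G r μ)) := by
  have hconst := tendsto_const_nhds (x := eLpNorm G r μ) (f := l)
  have hlower := ENNReal.Tendsto.sub hconst h (Or.inl hG.2.ne)
  have hupper := hconst.add h
  rw [tsub_zero] at hlower
  rw [add_zero] at hupper
  refine tendsto_of_tendsto_of_tendsto_of_le_of_le hlower hupper (fun n => ?_) fun n => ?_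
  · rw [tsub_le_iff_right]
    simpa using eLpNorm_sub_le (hF n) ((hF n).sub hG.1) hr
  · simpa using eLpNorm_add_le hG.1 ((hF n).sub hG.1) hr

end MeasureSpace

theorem tendsto_discreteNorm {K : ℕ → Set (ℤ × ℤ)} (hK : ∀ n, K n ⊆ boxIndex n) (hr : 1 ≤ r)
    (hr' : r ≠ ⊤) {l : Filter ℕ} {a : ℕ → ι → ℤ × ℤ → ℝ} {g : ι → ℝ × ℝ → ℝ}
    (hg : ∀ i, MemLp (g i) r volOmega)
    (h : ∀ i, Tendsto (fun n => eLpNorm (stepFun n (K n) (a n i) - g i) r volOmega) l (𝓝 0)) :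
    Tendsto (fun n => discreteNorm n (K n) r.toReal fun i k => a n i k) l
      (𝓝 (continuumNorm r.toReal g)) := by
  have hr0 : r ≠ 0 := (zero_lt_one.trans_le hr).ne'
  have hstep n i : AEStronglyMeasurable (stepFun n (K n) (a n i)) volOmega :=
    (measurable_stepFun _ _ _).aestronglyMeasurable
  have hsum := tendsto_finsetSum Finset.univ fun i _ => h i
  rw [Finset.sum_const_zero] at hsum
  simp_rw [discreteNorm_eq_eLpNorm (hK _) hr0 hr', continuumNorm_eq_eLpNorm hr0 hr']
  refine tendsto_eLpNorm_of_tendsto_eLpNorm_sub hr (fun n => aestronglyMeasurable_toLp (hstep n))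
    ⟨aestronglyMeasurable_toLp fun i => (hg i).1, ?_⟩ ?_
  · exact (eLpNorm_toLp_le hr fun i => (hg i).1).trans_lt
      (ENNReal.sum_lt_top.2 fun i _ => (hg i).2)
  · exact tendsto_of_tendsto_of_tendsto_of_le_of_le tendsto_const_nhds hsum (fun _ => zero_le)
      fun n => eLpNorm_toLp_le hr fun i => (hstep n i).sub (hg i).1

end VectorNorm

/-! ### The embedding of `W_1^1(Ω)` into `L_2(Ω)` -/

/-- The normalized indicator function of a dyadic interval. -/
def cellBump (n : ℕ) (k : ℤ) : ℝ → ℝ := (dyadicInterval n k).indicator fun _ => 2 ^ n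

section CellBump

variable (n : ℕ) (k : ℤ)

theorem cellBump_nonneg (t : ℝ) : 0 ≤ cellBump n k t :=
  Set.indicator_nonneg (fun _ _ => by positivity) t

theorem abs_cellBump_le (t : ℝ) : |cellBump n k t| ≤ 2 ^ n := by
  rw [abs_of_nonneg (cellBump_nonneg n k t)]
  exact Set.indicator_le_self' (fun _ _ => by positivity) t

theorem abs_cellBump_zero_le (t : ℝ) : |cellBump 0 0 t| ≤ 1 := by
  simpa using abs_cellBump_le 0 0 t

theorem lintegral_ofReal_cellBump_floor (s : ℝ) :
    ∫⁻ t : ℝ, ENNReal.ofReal (cellBump n ⌊2 ^ n * t⌋ s) = 1 := by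
  have hswap (t : ℝ) : ENNReal.ofReal (cellBump n ⌊2 ^ n * t⌋ s) =
      (dyadicInterval n ⌊2 ^ n * s⌋).indicator (fun _ => 2 ^ n) t := by
    by_cases h : ⌊2 ^ n * s⌋ = ⌊2 ^ n * t⌋
    · rw [cellBump, Set.indicator_of_mem (show s ∈ dyadicInterval n ⌊2 ^ n * t⌋ from h),
        Set.indicator_of_mem (show t ∈ dyadicInterval n ⌊2 ^ n * s⌋ from h.symm),
        ENNReal.ofReal_pow zero_le_two, ENNReal.ofReal_ofNat]
    · rw [cellBump, Set.indicator_of_notMem (show s ∉ dyadicInterval n ⌊2 ^ n * t⌋ from h),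
        Set.indicator_of_notMem (show t ∉ dyadicInterval n ⌊2 ^ n * s⌋ from Ne.symm h),
        ENNReal.ofReal_zero]
  simp_rw [hswap]
  rw [lintegral_indicator_const (measurableSet_dyadicInterval _ _), volume_dyadicInterval,
    ENNReal.mul_inv_cancel (by simp) (by simp)]

theorem integral_cellBump : ∫ t, cellBump n k t = 1 := by
  rw [cellBump, integral_indicator_const _ (measurableSet_dyadicInterval _ _), measureReal_def,
    volume_dyadicInterval]
  simp

variable {n k}

theorem isKernel_cellBump (hk : k ∈ Set.Ico 0 (2 ^ n)) : IsKernel 0 1 (cellBump n k) := by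
  have hn : (0 : ℝ) < 2 ^ n := by positivity
  have hk₀ : (0 : ℝ) ≤ k := by exact_mod_cast hk.1
  have hk₁ : (k : ℝ) + 1 ≤ 2 ^ n := by exact_mod_cast hk.2
  refine ⟨measurable_const.indicator (measurableSet_dyadicInterval _ _),
    ⟨2 ^ n, abs_cellBump_le n k⟩, fun t ht => Set.indicator_of_notMem (fun hmem => ht ?_) _⟩
  rw [dyadicInterval_eq_Ico] at hmem
  exact ⟨(by positivity : 0 ≤ (k : ℝ) / 2 ^ n).trans hmem.1,
    hmem.2.le.trans ((div_le_one hn).2 hk₁)⟩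

theorem isKernel_cellBump_zero : IsKernel 0 1 (cellBump 0 0) := isKernel_cellBump (by simp)

theorem scaled_tensor_cellBump (k : ℤ × ℤ) :
    scaled (tensor (cellBump 0 0) (cellBump 0 0)) n k =
      tensor (cellBump n k.1) (cellBump n k.2) := by
  have hscale (k : ℤ) (t : ℝ) : cellBump n k t = 2 ^ n * cellBump 0 0 (2 ^ n * t - k) := by
    simp [cellBump, dyadicInterval, Set.indicator_apply, Int.floor_eq_iff, sub_lt_iff_lt_add']
  funext y
  simp only [scaled, tensor, hscale k.1, hscale k.2]
  ring

theorem isAvgKernel_cellBump : IsAvgKernel (tensor (cellBump 0 0) (cellBump 0 0)) 1 1 := by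
  have hK := isKernel_cellBump_zero
  have hsupp t (ht : cellBump 0 0 t ≠ 0) : |t| ≤ 1 := by
    have hmem : t ∈ Set.Icc (0 : ℝ) 1 := by_contra fun h => ht (hK.supp t h)
    rw [abs_of_nonneg hmem.1]
    exact hmem.2
  refine ⟨(hK.meas.comp measurable_fst).mul (hK.meas.comp measurable_snd), fun z => ?_,
    fun z hz => ⟨hsupp _ (left_ne_zero_of_mul hz), hsupp _ (right_ne_zero_of_mul hz)⟩, ?_⟩
  · rw [tensor, abs_mul]
    exact mul_le_one₀ (abs_cellBump_zero_le _) (abs_nonneg _) (abs_cellBump_zero_le _)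
  · rw [integral_tensor, integral_cellBump, one_mul]

end CellBump

theorem abs_primitive_sub_le_one {f g : ℝ → ℝ} (hf : Integrable f) (hg : Integrable g)
    (hf0 : 0 ≤ f) (hg0 : 0 ≤ g) (hf1 : ∫ t, f t = 1) (hg1 : ∫ t, g t = 1) (t : ℝ) :
    |primitive (fun s => f s - g s) t| ≤ 1 := by
  have hmem {h : ℝ → ℝ} (hh : Integrable h) (h0 : 0 ≤ h) (h1 : ∫ t, h t = 1) :
      ∫ s in Set.Iic t, h s ∈ Set.Icc (0 : ℝ) 1 :=
    ⟨integral_nonneg h0, h1 ▸ setIntegral_le_integral hh (ae_of_all _ h0)⟩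
  rw [primitive, integral_sub hf.integrableOn hg.integrableOn, ← Real.dist_eq]
  simpa using Real.dist_le_of_mem_Icc (hmem hf hf0 hf1) (hmem hg hg0 hg1)

theorem IsKernel.integrable_mul_tensor {L R L' R' : ℝ} {f g : ℝ → ℝ} (hf : IsKernel L R f)
    (hg : IsKernel L' R' g) {u : ℝ × ℝ → ℝ} (hu : Integrable u volOmega) :
    Integrable (fun y => u y * tensor f g y) volOmega := by
  obtain ⟨M, hM⟩ := hf.bdd
  obtain ⟨M', hM'⟩ := hg.bdd
  refine hu.mul_bdd (c := M * M')
    ((hf.meas.comp measurable_fst).mul (hg.meas.comp measurable_snd)).aestronglyMeasurable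
    (ae_of_all _ fun y => ?_)
  rw [tensor, norm_mul]
  exact mul_le_mul (hM _) (hM' _) (norm_nonneg _) ((abs_nonneg _).trans (hM 0))

theorem enorm_integral_sub_integral_le {α : Type*} [MeasurableSpace α] {μ : Measure α}
    {u g P Q s : α → ℝ} (hu : AEStronglyMeasurable u μ) (hs : Measurable s)
    (hP : ∀ y, |P y| ≤ s y) (hQ : ∀ y, |Q y| ≤ s y) :
    ‖(∫ y, u y * P y ∂μ) - ∫ y, g y * Q y ∂μ‖ₑ ≤
      ∫⁻ y, (‖u y‖ₑ + ‖g y‖ₑ) * ENNReal.ofReal (s y) ∂μ := by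
  have hle {w T : α → ℝ} (hT : ∀ y, |T y| ≤ s y) :
      ‖∫ y, w y * T y ∂μ‖ₑ ≤ ∫⁻ y, ‖w y‖ₑ * ENNReal.ofReal (s y) ∂μ := by
    refine (enorm_integral_le_lintegral_enorm _).trans (lintegral_mono fun y => ?_)
    rw [enorm_mul, Real.enorm_eq_ofReal_abs (T y)]
    gcongr
    exact hT y
  simp_rw [add_mul]
  rw [lintegral_add_left' (f := fun y => ‖u y‖ₑ * ENNReal.ofReal (s y))
    (hu.enorm.mul hs.ennreal_ofReal.aemeasurable)]
  exact enorm_sub_le.trans (add_le_add (hle hP) (hle hQ))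

/-- The mass `∫_Ω Φ` along the strip of points whose coordinate `π` lies in the dyadic interval
of index `k`, relative to the width of the strip. -/
def stripMass (Φ : ℝ × ℝ → ℝ≥0∞) (π : ℝ × ℝ → ℝ) (n : ℕ) (k : ℤ) : ℝ≥0∞ :=
  ∫⁻ y in Omega, Φ y * ENNReal.ofReal (cellBump n k (π y))

section Embedding

variable {u g : ℝ × ℝ → ℝ} {n : ℕ} {k : ℤ × ℤ}

theorem testApprox_primitive_cellBump {k : ℤ} (hk : k ∈ Set.Ico 0 (2 ^ n)) :
    TestApprox 1 (primitive fun t => cellBump n k t - cellBump 0 0 t)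
      fun t => cellBump n k t - cellBump 0 0 t := by
  refine ((isKernel_cellBump hk).sub isKernel_cellBump_zero).testApprox_primitive ?_
  rw [integral_sub (isKernel_cellBump hk).integrable isKernel_cellBump_zero.integrable,
    integral_cellBump, integral_cellBump, sub_self]

theorem abs_primitive_cellBump_le {k : ℤ} (hk : k ∈ Set.Ico 0 (2 ^ n)) (t : ℝ) :
    |primitive (fun s => cellBump n k s - cellBump 0 0 s) t| ≤ 1 :=
  abs_primitive_sub_le_one (isKernel_cellBump hk).integrable isKernel_cellBump_zero.integrable
    (cellBump_nonneg n k) (cellBump_nonneg 0 0) (integral_cellBump n k) (integral_cellBump 0 0) t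

-- Replacing the bump in one direction by the indicator of the whole interval costs a primitive
-- of size at most one, whatever the width of the bump.
theorem IsWeakDeriv.enorm_avg_le_snd (h : IsWeakDeriv (1, 0) u g) (hu : Integrable u volOmega)
    (hg : Integrable g volOmega) (hk : k ∈ boxIndex n) :
    ‖avg (tensor (cellBump 0 0) (cellBump 0 0)) n u k‖ₑ ≤
      stripMass (fun y => ‖u y‖ₑ + ‖g y‖ₑ) Prod.snd n k.2 := by
  have hbump := isKernel_cellBump hk.2
  have hparts := h.integral_tensor hu hg (testApprox_primitive_cellBump hk.1) hbump.testApprox_zero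
  have hsplit : ∫ y in Omega, u y * tensor (cellBump n k.1) (cellBump n k.2) y =
      (∫ y in Omega, u y * tensor (cellBump 0 0) (cellBump n k.2) y) +
        ∫ y in Omega, u y * tensor (fun t => cellBump n k.1 t - cellBump 0 0 t)
          (cellBump n k.2) y := by
    rw [← integral_add (isKernel_cellBump_zero.integrable_mul_tensor hbump hu)
      (((isKernel_cellBump hk.1).sub isKernel_cellBump_zero).integrable_mul_tensor hbump hu)]
    refine integral_congr_ae (ae_of_all _ fun y => ?_)
    simp only [tensor]
    ring
  have hle {f : ℝ → ℝ} (hf : ∀ t, |f t| ≤ 1) (y : ℝ × ℝ) :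
      |tensor f (cellBump n k.2) y| ≤ cellBump n k.2 y.2 := by
    rw [tensor, abs_mul, abs_of_nonneg (cellBump_nonneg _ _ _)]
    exact mul_le_of_le_one_left (cellBump_nonneg _ _ _) (hf _)
  rw [avg, scaled_tensor_cellBump, hsplit, hparts, show order (1, 0) = 1 from rfl, pow_one,
    neg_one_mul, ← sub_eq_add_neg]
  exact enorm_integral_sub_integral_le hu.1 (hbump.meas.comp measurable_snd)
    (hle abs_cellBump_zero_le) (hle (abs_primitive_cellBump_le hk.1))

theorem IsWeakDeriv.enorm_avg_le_fst (h : IsWeakDeriv (0, 1) u g) (hu : Integrable u volOmega)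
    (hg : Integrable g volOmega) (hk : k ∈ boxIndex n) :
    ‖avg (tensor (cellBump 0 0) (cellBump 0 0)) n u k‖ₑ ≤
      stripMass (fun y => ‖u y‖ₑ + ‖g y‖ₑ) Prod.fst n k.1 := by
  have hbump := isKernel_cellBump hk.1
  have hparts := h.integral_tensor hu hg hbump.testApprox_zero (testApprox_primitive_cellBump hk.2)
  have hsplit : ∫ y in Omega, u y * tensor (cellBump n k.1) (cellBump n k.2) y =
      (∫ y in Omega, u y * tensor (cellBump n k.1) (cellBump 0 0) y) +
        ∫ y in Omega, u y * tensor (cellBump n k.1)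
          (fun t => cellBump n k.2 t - cellBump 0 0 t) y := by
    rw [← integral_add (hbump.integrable_mul_tensor isKernel_cellBump_zero hu)
      (hbump.integrable_mul_tensor ((isKernel_cellBump hk.2).sub isKernel_cellBump_zero) hu)]
    refine integral_congr_ae (ae_of_all _ fun y => ?_)
    simp only [tensor]
    ring
  have hle {f : ℝ → ℝ} (hf : ∀ t, |f t| ≤ 1) (y : ℝ × ℝ) :
      |tensor (cellBump n k.1) f y| ≤ cellBump n k.1 y.1 := by
    rw [tensor, abs_mul, abs_of_nonneg (cellBump_nonneg _ _ _)]
    exact mul_le_of_le_one_right (cellBump_nonneg _ _ _) (hf _)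
  rw [avg, scaled_tensor_cellBump, hsplit, hparts, show order (0, 1) = 1 from rfl, pow_one,
    neg_one_mul, ← sub_eq_add_neg]
  exact enorm_integral_sub_integral_le hu.1 (hbump.meas.comp measurable_fst)
    (hle abs_cellBump_zero_le) (hle (abs_primitive_cellBump_le hk.2))

theorem lintegral_stripMass {Φ : ℝ × ℝ → ℝ≥0∞} (hΦ : AEMeasurable Φ volOmega)
    {π : ℝ × ℝ → ℝ} (hπ : Measurable π) (n : ℕ) :
    ∫⁻ t : ℝ, stripMass Φ π n ⌊2 ^ n * t⌋ = ∫⁻ y in Omega, Φ y := by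
  have hfloor : Measurable fun t : ℝ => ⌊2 ^ n * t⌋ :=
    Int.measurable_floor.comp (measurable_id.const_mul _)
  have hbump : Measurable fun z : ℝ × ℝ × ℝ =>
      ENNReal.ofReal (cellBump n ⌊2 ^ n * z.1⌋ (π z.2)) := by
    have hset : MeasurableSet {z : ℝ × ℝ × ℝ | ⌊2 ^ n * π z.2⌋ = ⌊2 ^ n * z.1⌋} :=
      measurableSet_eq_fun (hfloor.comp (hπ.comp measurable_snd)) (hfloor.comp measurable_fst)
    exact (measurable_const.indicator hset).ennreal_ofReal
  simp only [stripMass]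
  rw [lintegral_lintegral_swap (hΦ.comp_snd.mul hbump.aemeasurable)]
  refine lintegral_congr fun y => ?_
  have hbumpy : Measurable fun t : ℝ => ENNReal.ofReal (cellBump n ⌊2 ^ n * t⌋ (π y)) :=
    hbump.comp measurable_prodMk_right
  rw [lintegral_const_mul _ hbumpy, lintegral_ofReal_cellBump_floor, mul_one]

/-- The Sobolev norm of `W_1^1(Ω)`, for given first order derivatives. -/
def sobolevNormOne (u g₁ g₂ : ℝ × ℝ → ℝ) : ℝ≥0∞ :=
  eLpNorm u 1 volOmega + eLpNorm g₁ 1 volOmega + eLpNorm g₂ 1 volOmega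

-- The Gagliardo-Nirenberg argument: one factor depends on `x.1` only, the other one on `x.2` only,
-- so the integral of their product factorizes.
theorem enorm_stepFun_avg_sq_le {g₁ g₂ : ℝ × ℝ → ℝ} (hu : Integrable u volOmega)
    (hg₁ : Integrable g₁ volOmega) (hg₂ : Integrable g₂ volOmega) (h₁ : IsWeakDeriv (1, 0) u g₁)
    (h₂ : IsWeakDeriv (0, 1) u g₂) (n : ℕ) (x : ℝ × ℝ) :
    ‖stepFun n (boxIndex n) (avg (tensor (cellBump 0 0) (cellBump 0 0)) n u) x‖ₑ ^ 2 ≤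
      stripMass (fun y => ‖u y‖ₑ + ‖g₁ y‖ₑ + ‖g₂ y‖ₑ) Prod.fst n ⌊2 ^ n * x.1⌋ *
        stripMass (fun y => ‖u y‖ₑ + ‖g₁ y‖ₑ + ‖g₂ y‖ₑ) Prod.snd n ⌊2 ^ n * x.2⌋ := by
  by_cases hx : cell n x ∈ boxIndex n
  · rw [stepFun, Set.indicator_of_mem (Set.mem_preimage.2 hx), sq]
    gcongr
    · refine (h₂.enorm_avg_le_fst hu hg₂ hx).trans (lintegral_mono fun y => ?_)
      exact mul_le_mul' (add_le_add le_self_add le_rfl) le_rfl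
    · refine (h₁.enorm_avg_le_snd hu hg₁ hx).trans (lintegral_mono fun y => ?_)
      exact mul_le_mul' le_self_add le_rfl
  · simp [stepFun, hx]

theorem eLpNorm_two_stepFun_avg_le {g₁ g₂ : ℝ × ℝ → ℝ} (hu : Integrable u volOmega)
    (hg₁ : Integrable g₁ volOmega) (hg₂ : Integrable g₂ volOmega) (h₁ : IsWeakDeriv (1, 0) u g₁)
    (h₂ : IsWeakDeriv (0, 1) u g₂) (n : ℕ) :
    eLpNorm (stepFun n (boxIndex n) (avg (tensor (cellBump 0 0) (cellBump 0 0)) n u)) 2 volOmega ≤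
      sobolevNormOne u g₁ g₂ := by
  set F := stepFun n (boxIndex n) (avg (tensor (cellBump 0 0) (cellBump 0 0)) n u)
  set Φ : ℝ × ℝ → ℝ≥0∞ := fun y => ‖u y‖ₑ + ‖g₁ y‖ₑ + ‖g₂ y‖ₑ
  have hΦ : AEMeasurable Φ volOmega := (hu.1.enorm.add hg₁.1.enorm).add hg₂.1.enorm
  have hΦint : ∫⁻ y in Omega, Φ y = sobolevNormOne u g₁ g₂ := by
    rw [lintegral_add_right' _ hg₂.1.enorm, lintegral_add_right' _ hg₁.1.enorm]
    simp only [sobolevNormOne, eLpNorm_one_eq_lintegral_enorm]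
  have hmeas π : Measurable fun t : ℝ => stripMass Φ π n ⌊2 ^ n * t⌋ :=
    (measurable_of_countable (stripMass Φ π n)).comp
      (Int.measurable_floor.comp (measurable_id.const_mul _))
  have hsq : ∫⁻ x, ‖F x‖ₑ ^ 2 ∂volOmega ≤ sobolevNormOne u g₁ g₂ ^ 2 := by
    calc ∫⁻ x, ‖F x‖ₑ ^ 2 ∂volOmega
        ≤ ∫⁻ x : ℝ × ℝ, stripMass Φ Prod.fst n ⌊2 ^ n * x.1⌋ *
            stripMass Φ Prod.snd n ⌊2 ^ n * x.2⌋ :=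
        lintegral_mono' Measure.restrict_le_self (enorm_stepFun_avg_sq_le hu hg₁ hg₂ h₁ h₂ n)
      _ = (∫⁻ t : ℝ, stripMass Φ Prod.fst n ⌊2 ^ n * t⌋) *
            ∫⁻ t : ℝ, stripMass Φ Prod.snd n ⌊2 ^ n * t⌋ :=
        lintegral_prod_mul (hmeas _).aemeasurable (hmeas _).aemeasurable
      _ = sobolevNormOne u g₁ g₂ ^ 2 := by
        rw [lintegral_stripMass hΦ measurable_fst, lintegral_stripMass hΦ measurable_snd, hΦint, sq]
  rw [eLpNorm_eq_lintegral_rpow_enorm_toReal two_ne_zero ENNReal.ofNat_ne_top]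
  simp only [ENNReal.toReal_ofNat, ENNReal.rpow_ofNat]
  rw [one_div, ENNReal.rpow_inv_le_iff two_pos, ENNReal.rpow_ofNat]
  exact hsq

theorem eLpNorm_two_le_sobolevNormOne {g₁ g₂ : ℝ × ℝ → ℝ} (hu : Integrable u volOmega)
    (hg₁ : Integrable g₁ volOmega) (hg₂ : Integrable g₂ volOmega) (h₁ : IsWeakDeriv (1, 0) u g₁)
    (h₂ : IsWeakDeriv (0, 1) u g₂) : eLpNorm u 2 volOmega ≤ sobolevNormOne u g₁ g₂ := by
  have hcell x (hx : x ∈ Omega) : ∀ᶠ n in atTop, cell n x ∈ boxIndex n :=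
    Eventually.of_forall fun _ =>
      cell_mem_boxIndex.2 ⟨Set.Ioo_subset_Ico_self hx.1, Set.Ioo_subset_Ico_self hx.2⟩
  have hlim := isAvgKernel_cellBump.tendsto_eLpNorm_stepFun_avg_sub hcell
    (memLp_one_iff_integrable.2 hu) le_rfl ENNReal.one_ne_top
  have hmeas n : AEStronglyMeasurable
      (stepFun n (boxIndex n) (avg (tensor (cellBump 0 0) (cellBump 0 0)) n u)) volOmega :=
    (measurable_stepFun _ _ _).aestronglyMeasurable
  obtain ⟨ns, -, hns⟩ :=
    (tendstoInMeasure_of_tendsto_eLpNorm one_ne_zero hmeas hu.1 hlim).exists_seq_tendsto_ae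
  exact Lp.eLpNorm_le_of_ae_tendsto (Eventually.of_forall fun i =>
    eLpNorm_two_stepFun_avg_le hu hg₁ hg₂ h₁ h₂ (ns i)) (fun i => hmeas (ns i)) hns

end Embedding

/-! ### The index sets -/

/-- The integers `a` for which `a + c [-⌊m/2⌋, m - ⌊m/2⌋] ⊆ [0, 2^n]`, where
`[-⌊m/2⌋, m - ⌊m/2⌋]` is the support of the B-spline of order `m`. -/
def splineRange (m c n : ℕ) : Set ℤ :=
  {a | (c * (m / 2 : ℕ) : ℝ) ≤ a ∧ (a + c * (m - (m / 2 : ℕ)) : ℝ) ≤ 2 ^ n}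

section Index

variable {m n c : ℕ}

theorem cast_half_le (m : ℕ) : ((m / 2 : ℕ) : ℝ) ≤ m := mod_cast Nat.div_le_self m 2

theorem splineRange_anti {c' : ℕ} (h : c ≤ c') : splineRange m c' n ⊆ splineRange m c n := by
  intro a ⟨ha, ha'⟩
  have hm := sub_nonneg.2 (cast_half_le m)
  exact ⟨le_trans (by gcongr) ha, le_trans (by gcongr) ha'⟩

theorem mem_Icc_of_mem_splineRange {a : ℤ} (ha : a ∈ splineRange m c n) {t : ℝ}
    (ht : 2 ^ n * t - a ∈ Set.Icc (-(c * (m / 2 : ℕ)) : ℝ) (c * (m - (m / 2 : ℕ)))) :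
    t ∈ Set.Icc (0 : ℝ) 1 := by
  have hn : (0 : ℝ) < 2 ^ n := by positivity
  constructor
  · exact nonneg_of_mul_nonneg_right (by linarith [ht.1, ha.1]) hn
  · exact le_of_mul_le_mul_left (by linarith [ht.2, ha.2]) hn

theorem mem_splineRange_one (hm : 1 ≤ m) {a : ℤ}
    (h : ∀ s : ℝ, 0 < s → s < m → (s - (m / 2 : ℕ) + a) / 2 ^ n ∈ Set.Icc (0 : ℝ) 1) :
    a ∈ splineRange m 1 n := by
  have hn : (0 : ℝ) < 2 ^ n := by positivity
  have hm' : (1 : ℝ) ≤ m := by exact_mod_cast hm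
  have hlow := (le_div_iff₀ hn).1 (h (1 / 2) (by norm_num) (by linarith)).1
  have hhigh := (div_le_one hn).1 (h (m - 1 / 2) (by linarith) (by linarith)).2
  simp only [splineRange, Set.mem_ofPred_eq, Nat.cast_one, one_mul]
  generalize m / 2 = d at *
  constructor
  · have hlt : (d : ℤ) < a + 1 := by
      rify
      linarith
    exact_mod_cast Int.lt_add_one_iff.1 hlt
  · have hlt : a + (m - d) < (2 : ℤ) ^ n + 1 := by
      rify
      linarith
    exact_mod_cast Int.lt_add_one_iff.1 hlt

theorem closure_Omega : closure Omega = Set.Icc (0 : ℝ) 1 ×ˢ Set.Icc (0 : ℝ) 1 := by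
  rw [Omega, closure_prod_eq, closure_Ioo zero_ne_one]

theorem indexM_eq (hm : 1 ≤ m) : indexM m n = splineRange m 1 n ×ˢ splineRange m 1 n := by
  ext k
  have hn : (0 : ℝ) < 2 ^ n := by positivity
  constructor
  · intro hk
    have hmem (s : ℝ) (h0 : 0 < s) (h1 : s < m) :
        ((s - (m / 2 : ℕ) + k.1) / 2 ^ n, (s - (m / 2 : ℕ) + k.2) / 2 ^ n) ∈ closure Omega := by
      have hpos : 0 < bspline m (s - (m / 2 : ℕ)) := bspline_pos (by simpa) (by simpa)
      refine hk (subset_tsupport _ ?_)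
      simp only [Function.mem_support, phiScaled, phi₂, tensor, mul_div_cancel₀ _ hn.ne',
        add_sub_cancel_right]
      positivity
    rw [closure_Omega] at hmem
    exact ⟨mem_splineRange_one hm fun s h0 h1 => (hmem s h0 h1).1,
      mem_splineRange_one hm fun s h0 h1 => (hmem s h0 h1).2⟩
  · intro hk
    have hIcc {a : ℤ} (ha : a ∈ splineRange m 1 n) {t : ℝ} (ht : bspline m (2 ^ n * t - a) ≠ 0) :
        t ∈ Set.Icc (0 : ℝ) 1 := by
      refine mem_Icc_of_mem_splineRange ha (by_contra fun h => ht ?_)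
      exact (isKernel_bspline hm).supp _ (by simpa using h)
    refine closure_minimal (fun x hx => ?_) isClosed_closure
    have hx' := right_ne_zero_of_mul hx
    rw [closure_Omega]
    exact ⟨hIcc hk.1 (left_ne_zero_of_mul hx'), hIcc hk.2 (right_ne_zero_of_mul hx')⟩

theorem add_nsmul_mem_splineRange {a r : ℤ} (ha : a ∈ splineRange m (c + 1) n)
    (hr : r ∈ maskRange m) : a + c • r ∈ splineRange m 1 n := by
  obtain ⟨hl, hu⟩ := Finset.mem_Icc.1 hr
  have hl' : -((m / 2 : ℕ) : ℝ) ≤ r := by exact_mod_cast Int.cast_le (R := ℝ).2 hl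
  have hu' : (r : ℝ) ≤ m - (m / 2 : ℕ) := by exact_mod_cast Int.cast_le (R := ℝ).2 hu
  have hcl := mul_le_mul_of_nonneg_left hl' (Nat.cast_nonneg c)
  have hcu := mul_le_mul_of_nonneg_left hu' (Nat.cast_nonneg c)
  simp only [splineRange, Set.mem_ofPred_eq, nsmul_eq_mul] at ha ⊢
  generalize m / 2 = d at *
  push_cast at ha ⊢
  constructor <;> linarith [ha.1, ha.2]

theorem mem_splineRange_succ {a : ℤ}
    (hl : a + c • (-((m / 2 : ℕ) : ℤ)) ∈ splineRange m 1 n)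
    (hr : a + c • ((m : ℤ) - (m / 2 : ℕ)) ∈ splineRange m 1 n) : a ∈ splineRange m (c + 1) n := by
  have hl' := hl.1
  have hr' := hr.2
  simp only [splineRange, Set.mem_ofPred_eq, nsmul_eq_mul] at hl' hr' ⊢
  generalize m / 2 = d at *
  push_cast at hl' hr' ⊢
  constructor <;> linarith

theorem indexK_eq {J : ℕ} (hm : 1 ≤ m) {β : Fin J → ℕ × ℕ} (hβ : ∀ j, (β j).1 ≤ m ∧ (β j).2 ≤ m)
    (C : ℕ) : indexK m β C n = splineRange m (C + 1) n ×ˢ splineRange m (C + 1) n := by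
  ext k
  simp only [indexK, indexM_eq hm, Set.mem_ofPred_eq]
  constructor
  · rintro ⟨-, h⟩
    have hl := h 0 (Or.inl rfl) (-((m / 2 : ℕ) : ℤ), -((m / 2 : ℕ) : ℤ))
      (mul_ne_zero (mask_zero_left_ne_zero m) (mask_zero_left_ne_zero m))
    have hr := h 0 (Or.inl rfl) (m - ((m / 2 : ℕ) : ℤ), m - ((m / 2 : ℕ) : ℤ))
      (mul_ne_zero (mask_zero_right_ne_zero m) (mask_zero_right_ne_zero m))
    exact ⟨mem_splineRange_succ hl.1 hr.1, mem_splineRange_succ hl.2 hr.2⟩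
  · rintro ⟨h₁, h₂⟩
    have hanti := splineRange_anti (m := m) (n := n) (Nat.le_add_left 1 C)
    refine ⟨⟨hanti h₁, hanti h₂⟩, fun b hb r hr => ?_⟩
    have hbm : b.1 ≤ m ∧ b.2 ≤ m := by
      rcases hb with rfl | ⟨j, rfl⟩
      exacts [⟨zero_le, zero_le⟩, hβ j]
    have hrange {l : ℕ} (hl : l ≤ m) {i : ℤ} (hi : mask m l i ≠ 0) : i ∈ maskRange m :=
      by_contra fun h => hi (mask_eq_zero hl h)
    exact ⟨add_nsmul_mem_splineRange h₁ (hrange hbm.1 (left_ne_zero_of_mul hr)),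
      add_nsmul_mem_splineRange h₂ (hrange hbm.2 (right_ne_zero_of_mul hr))⟩

theorem splineRange_prod_subset_boxIndex (hm : 1 ≤ m) (hc : c ≠ 0) :
    splineRange m c n ×ˢ splineRange m c n ⊆ boxIndex n := by
  have hsubset : splineRange m c n ⊆ Set.Ico 0 (2 ^ n) := by
    rintro a ha
    obtain ⟨ha₀, ha₁⟩ := splineRange_anti (Nat.one_le_iff_ne_zero.2 hc) ha
    have hlt : ((m / 2 : ℕ) : ℝ) < m := by exact_mod_cast Nat.div_lt_self hm one_lt_two
    rw [Nat.cast_one, one_mul] at ha₀ ha₁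
    have h₀ : (0 : ℝ) ≤ a := (Nat.cast_nonneg _).trans ha₀
    have h₁ : (a : ℝ) < 2 ^ n := by linarith
    exact ⟨by exact_mod_cast h₀, by exact_mod_cast h₁⟩
  exact Set.prod_mono hsubset hsubset

theorem eventually_floor_mem_splineRange (m c : ℕ) {t : ℝ} (ht : t ∈ Set.Ioo (0 : ℝ) 1) :
    ∀ᶠ n : ℕ in atTop, ⌊2 ^ n * t⌋ ∈ splineRange m c n := by
  have hpow : Tendsto (fun n : ℕ => (2 : ℝ) ^ n) atTop atTop :=
    tendsto_pow_atTop_atTop_of_one_lt one_lt_two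
  filter_upwards [(hpow.atTop_mul_const ht.1).eventually_ge_atTop (c * (m / 2 : ℕ) + 1 : ℝ),
    (hpow.atTop_mul_const (sub_pos.2 ht.2)).eventually_ge_atTop (c * (m - (m / 2 : ℕ)) : ℝ)]
    with n h₀ h₁
  rw [mul_one_sub] at h₁
  have hlower := Int.lt_floor_add_one (2 ^ n * t : ℝ)
  have hupper := Int.floor_le (2 ^ n * t : ℝ)
  exact ⟨by linarith, by linarith⟩

theorem eventually_cell_mem_splineRange (m c : ℕ) {x : ℝ × ℝ} (hx : x ∈ Omega) :
    ∀ᶠ n in atTop, cell n x ∈ splineRange m c n ×ˢ splineRange m c n :=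
  (eventually_floor_mem_splineRange m c hx.1).and (eventually_floor_mem_splineRange m c hx.2)

end Index

/-! ### Sampling operators as local averages -/

/-- Univariate kernels supported in `c [-⌊m/2⌋, m - ⌊m/2⌋]` and of nonzero integral: the B-spline of
order `m` is one with `c = 1`, and each application of `liftOp` increases `c` by one. -/
structure IsSplineKernel (m c : ℕ) (f : ℝ → ℝ) : Prop extends
    IsKernel (-(c * (m / 2 : ℕ))) (c * (m - (m / 2 : ℕ))) f where
  integral_ne_zero : ∫ t, f t ≠ 0

theorem isSplineKernel_bspline {m : ℕ} (hm : 1 ≤ m) : IsSplineKernel m 1 (bspline m) where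
  toIsKernel := by simpa using isKernel_bspline hm
  integral_ne_zero := by simp [integral_bspline hm]

theorem IsSplineKernel.liftOp {m c l : ℕ} {f : ℝ → ℝ} (h : IsSplineKernel m c f) (hl : l ≤ m) :
    IsSplineKernel m (c + 1) (liftOp m l f) where
  toIsKernel := (h.toIsKernel.liftOp hl).mono (by push_cast; linarith) (by push_cast; linarith)
  integral_ne_zero := integral_liftOp_ne_zero h.integrable hl h.integral_ne_zero

/-- The tensor product of `f` and `g`, normalised to have integral one. -/
def normTensor (f g : ℝ → ℝ) (z : ℝ × ℝ) : ℝ := ((∫ t, f t) * ∫ t, g t)⁻¹ * tensor f g z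

/-- The rescaled function `z ↦ c_b⁻¹ 2⁻² φ_b(z / 2)`, of integral one. -/
def normVarphi (m : ℕ) (b : ℕ × ℕ) : ℝ × ℝ → ℝ :=
  normTensor (liftOp m b.1 (bspline m)) (liftOp m b.2 (bspline m))

/-- The rescaled function `z ↦ c_{ab}⁻¹ 4⁻² φ_{ab}(z / 4)`, of integral one. -/
def normVarphiPair (m : ℕ) (a b : ℕ × ℕ) : ℝ × ℝ → ℝ :=
  normTensor (liftOp m a.1 (liftOp m b.1 (bspline m))) (liftOp m a.2 (liftOp m b.2 (bspline m)))

theorem IsKernel.dilate {L R : ℝ} {f : ℝ → ℝ} (h : IsKernel L R f) {N : ℝ} (hN : 0 < N) :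
    IsKernel (L / N) (R / N) (fun t => f (N * t)) where
  meas := h.meas.comp (measurable_const_mul N)
  bdd := h.bdd.imp fun _ hM _ => hM _
  supp _ ht := h.supp _ fun ht' =>
    ht ⟨(div_le_iff₀' hN).2 ht'.1, (le_div_iff₀' hN).2 ht'.2⟩

theorem exists_isAvgKernel_normTensor {L R L' R' : ℝ} {f g : ℝ → ℝ} (hf : IsKernel L R f)
    (hg : IsKernel L' R' g) (hf0 : ∫ t, f t ≠ 0) (hg0 : ∫ t, g t ≠ 0) :
    ∃ M ρ, IsAvgKernel (normTensor f g) M ρ := by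
  obtain ⟨M, hM⟩ := hf.bdd
  obtain ⟨M', hM'⟩ := hg.bdd
  refine ⟨|((∫ t, f t) * ∫ t, g t)⁻¹| * (M * M'), max (max |L| |R|) (max |L'| |R'|),
    ((hf.meas.comp measurable_fst).mul (hg.meas.comp measurable_snd)).const_mul _, fun z => ?_,
    fun z hz => ?_, ?_⟩
  · rw [normTensor, tensor, abs_mul, abs_mul]
    have := (abs_nonneg _).trans (hM 0)
    gcongr
    exacts [hM _, hM' _]
  · have hz' : f z.1 * g z.2 ≠ 0 := right_ne_zero_of_mul hz
    have h₁ : z.1 ∈ Set.Icc L R := by_contra fun h => left_ne_zero_of_mul hz' (hf.supp _ h)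
    have h₂ : z.2 ∈ Set.Icc L' R' := by_contra fun h => right_ne_zero_of_mul hz' (hg.supp _ h)
    exact ⟨(abs_le_max_abs_abs h₁.1 h₁.2).trans (le_max_left _ _),
      (abs_le_max_abs_abs h₂.1 h₂.2).trans (le_max_right _ _)⟩
  · simp only [normTensor]
    rw [integral_const_mul, integral_tensor, inv_mul_cancel₀ (mul_ne_zero hf0 hg0)]

theorem avg_normTensor (f f' : ℝ → ℝ) (n : ℕ) (g : ℝ × ℝ → ℝ) (k : ℤ × ℤ) :
    avg (normTensor f f') n g k = ((∫ t, f t) * ∫ t, f' t)⁻¹ * avg (tensor f f') n g k := by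
  rw [avg, avg, ← integral_const_mul]
  refine integral_congr_ae (ae_of_all _ fun y => ?_)
  simp only [scaled, normTensor]
  ring

theorem avg_tensor (f f' : ℝ → ℝ) (n : ℕ) (g : ℝ × ℝ → ℝ) (k : ℤ × ℤ) :
    avg (tensor f f') n g k = 2 ^ n * 2 ^ n * ∫ y in Omega, g y *
      tensor (fun t => f (2 ^ n * t - k.1)) (fun t => f' (2 ^ n * t - k.2)) y := by
  rw [avg, ← integral_const_mul]
  refine integral_congr_ae (ae_of_all _ fun y => ?_)
  simp only [scaled, tensor]
  ring

theorem two_zpow_sub_one (n : ℕ) : (2 : ℝ) ^ ((n : ℤ) - 1) = 2 ^ n * 2⁻¹ := by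
  rw [zpow_sub₀ two_ne_zero, zpow_natCast, zpow_one, div_eq_mul_inv]

theorem two_zpow_sub_two (n : ℕ) : (2 : ℝ) ^ ((n : ℤ) - 2) = 2 ^ n * 4⁻¹ := by
  rw [zpow_sub₀ two_ne_zero, zpow_natCast, div_eq_mul_inv]
  norm_num

section Sampling

variable {m n c : ℕ}

theorem sampleT_eq_avg (hm : 1 ≤ m) (n : ℕ) (g : ℝ × ℝ → ℝ) :
    sampleT m n g = avg (normTensor (bspline m) (bspline m)) n g := by
  funext k
  rw [avg_normTensor, integral_bspline hm, mul_one, inv_one, one_mul, sampleT, avg,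
    ← integral_const_mul]
  refine integral_congr_ae (ae_of_all _ fun y => ?_)
  simp only [scaled, phiScaled, phi₂]
  ring

theorem sampleS_eq_avg {J : ℕ} (hm : 1 ≤ m) {β : Fin J → ℕ × ℕ} {j : Fin J}
    (hβ : (β j).1 ≤ m ∧ (β j).2 ≤ m) (n : ℕ) (v : Fin J → ℝ × ℝ → ℝ) :
    sampleS m β n v j = avg (normVarphi m (β j)) n (v j) := by
  funext k
  rw [normVarphi, avg_normTensor, sampleS, avg, ← integral_const_mul, ← integral_const_mul]
  refine integral_congr_ae (ae_of_all _ fun y => ?_)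
  have hdilate (a : ℝ) (b : ℤ) : 2 * (2 ^ n * 2⁻¹ * a - (b : ℝ) / 2) = 2 ^ n * a - b := by ring
  simp only [scaled, varphiScaled, varphi₂, tensor, varphi_eq hm hβ.1, varphi_eq hm hβ.2,
    two_zpow_sub_one, two_zpow_sub_two, hdilate, cst_eq hm hβ, order, pow_add, mul_inv, inv_pow,
    inv_inv]
  field_simp
  ring

theorem conv_const_mul (b : ℕ × ℕ) (x : ℝ) (a : ℤ × ℤ → ℝ) (k : ℤ × ℤ) :
    conv m b (fun l => x * a l) k = x * conv m b a k := by
  simp only [conv, mul_left_comm _ x, tsum_mul_left]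

theorem conv_eq_sum {b : ℕ × ℕ} (hb : b.1 ≤ m ∧ b.2 ≤ m) (a : ℤ × ℤ → ℝ) (k : ℤ × ℤ) :
    conv m b a k = ∑ r ∈ maskRange m ×ˢ maskRange m, mask₂ m b r * a (r + k) := by
  rw [conv, ← (Equiv.addRight k).tsum_eq]
  simp only [Equiv.coe_addRight, add_sub_cancel_right]
  refine tsum_eq_sum fun r hr => ?_
  rw [Finset.mem_product, not_and_or] at hr
  rcases hr with hr | hr
  · rw [mask₂, mask_eq_zero hb.1 hr, zero_mul, zero_mul]
  · rw [mask₂, mask_eq_zero hb.2 hr, mul_zero, zero_mul]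

theorem tensor_maskOp (b : ℕ × ℕ) (f g : ℝ → ℝ) (z : ℝ × ℝ) :
    tensor (maskOp m b.1 f) (maskOp m b.2 g) z =
      ∑ r ∈ maskRange m ×ˢ maskRange m, mask₂ m b r * tensor f g (z.1 - r.1, z.2 - r.2) := by
  rw [tensor, maskOp, maskOp, Finset.sum_mul_sum, ← Finset.sum_product']
  refine Finset.sum_congr rfl fun r _ => ?_
  simp only [mask₂, tensor]
  ring

theorem conv_avg {b : ℕ × ℕ} (hb : b.1 ≤ m ∧ b.2 ≤ m) {L R L' R' : ℝ} {f g : ℝ → ℝ}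
    (hf : IsKernel L R f) (hg : IsKernel L' R' g) (n : ℕ) {u : ℝ × ℝ → ℝ}
    (hu : Integrable u volOmega) (k : ℤ × ℤ) :
    conv m b (avg (tensor f g) n u) k = avg (tensor (maskOp m b.1 f) (maskOp m b.2 g)) n u k := by
  have hint (r : ℤ × ℤ) :
      Integrable (fun y => u y * scaled (tensor f g) n (r + k) y) volOmega := by
    have hN : (0 : ℝ) < 2 ^ n := by positivity
    refine ((((hf.translate (-(r + k).1)).dilate hN).integrable_mul_tensor
      ((hg.translate (-(r + k).2)).dilate hN) hu).const_mul (2 ^ n * 2 ^ n)).congr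
      (ae_of_all _ fun y => ?_)
    simp only [scaled, tensor, sub_eq_add_neg]
    ring
  simp only [conv_eq_sum hb, avg, ← integral_const_mul]
  rw [← integral_finsetSum _ fun r _ => (hint r).const_mul _]
  refine integral_congr_ae (ae_of_all _ fun y => ?_)
  simp only [scaled, tensor_maskOp, Finset.mul_sum, Prod.fst_add, Prod.snd_add, Int.cast_add,
    sub_add_eq_sub_sub_swap]
  refine Finset.sum_congr rfl fun r _ => ?_
  ring

theorem IsSplineKernel.testApprox_liftOp {f : ℝ → ℝ} (h : IsSplineKernel m c f) {l : ℕ}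
    (hl : l ≤ m) {a : ℤ} (ha : a ∈ splineRange m (c + 1) n) :
    TestApprox l (fun t => ((2 ^ n) ^ l)⁻¹ * WaveletFrame.liftOp m l f (2 ^ n * t - a))
      (fun t => maskOp m l f (2 ^ n * t - a)) := by
  obtain ⟨ha₀, ha₁⟩ := ha
  push_cast [add_mul] at ha₀ ha₁
  have hN : (0 : ℝ) < 2 ^ n := by positivity
  have key := (h.aeval_shift (natDegree_one_add_X_pow_le (m - l))).testApprox_winInt_iterate l
    (((2 ^ n) ^ l)⁻¹ * maskConst m l) (N := 2 ^ n) (d := (m / 2 : ℕ) - a) hN (by linarith)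
    (by rw [Nat.cast_sub hl]; linarith)
  have hshift (t : ℝ) : 2 ^ n * t - a + (m / 2 : ℕ) = 2 ^ n * t + ((m / 2 : ℕ) - a) := by ring
  have hcancel : ((2 ^ n) ^ l)⁻¹ * maskConst m l * (2 ^ n) ^ l = maskConst m l := by field_simp
  simp only [hcancel] at key
  simpa only [WaveletFrame.liftOp, maskOp_eq_aeval_shift hl, hshift, ← mul_assoc, map_mul,
    Module.End.mul_apply] using key

theorem IsWeakDeriv.conv_avg {α : ℕ × ℕ} {u g : ℝ × ℝ → ℝ} (h : IsWeakDeriv α u g)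
    (hu : Integrable u volOmega) (hg : Integrable g volOmega) (hα : α.1 ≤ m ∧ α.2 ≤ m)
    {f f' : ℝ → ℝ} (hf : IsSplineKernel m c f) (hf' : IsSplineKernel m c f') {k : ℤ × ℤ}
    (hk : k ∈ splineRange m (c + 1) n ×ˢ splineRange m (c + 1) n) :
    (-1) ^ order α * (2 ^ n) ^ order α * conv m α (avg (tensor f f') n u) k =
      avg (tensor (liftOp m α.1 f) (liftOp m α.2 f')) n g k := by
  rw [WaveletFrame.conv_avg hα hf.toIsKernel hf'.toIsKernel n hu, avg_tensor, avg_tensor,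
    h.integral_tensor hu hg (hf.testApprox_liftOp hα.1 hk.1) (hf'.testApprox_liftOp hα.2 hk.2)]
  have hsign : (-1 : ℝ) ^ order α * (-1) ^ order α = 1 := by
    rw [← mul_pow, neg_one_mul, neg_neg, one_pow]
  have hscale (y : ℝ × ℝ) :
      g y * tensor (fun t => ((2 ^ n) ^ α.1)⁻¹ * liftOp m α.1 f (2 ^ n * t - k.1))
        (fun t => ((2 ^ n) ^ α.2)⁻¹ * liftOp m α.2 f' (2 ^ n * t - k.2)) y =
      ((2 ^ n) ^ order α)⁻¹ * (g y * tensor (fun t => liftOp m α.1 f (2 ^ n * t - k.1))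
        (fun t => liftOp m α.2 f' (2 ^ n * t - k.2)) y) := by
    simp only [tensor, order, pow_add, mul_inv]
    ring
  simp only [hscale, integral_const_mul]
  field_simp
  linear_combination (∫ y in Omega, g y * tensor (fun t => liftOp m α.1 f (2 ^ n * t - k.1))
    (fun t => liftOp m α.2 f' (2 ^ n * t - k.2)) y) * hsign

variable {J : ℕ} {β : Fin J → ℕ × ℕ}

theorem transform₁_sampleT (hm : 1 ≤ m) {j : Fin J} (hβ : (β j).1 ≤ m ∧ (β j).2 ≤ m)
    {u g : ℝ × ℝ → ℝ} (h : IsWeakDeriv (β j) u g) (hu : Integrable u volOmega)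
    (hg : Integrable g volOmega) {k : ℤ × ℤ} (hk : k ∈ splineRange m 2 n ×ˢ splineRange m 2 n) :
    transform₁ m β n (sampleT m n u) j k = avg (normVarphi m (β j)) n g k := by
  have hB := isSplineKernel_bspline hm
  have hT : sampleT m n u = avg (tensor (bspline m) (bspline m)) n u := by
    funext l
    simp [sampleT_eq_avg hm, avg_normTensor, integral_bspline hm]
  rw [normVarphi, avg_normTensor, ← h.conv_avg hu hg hβ hB hB hk, transform₁, hT, cst_eq hm hβ,
    two_zpow_sub_one, mul_pow]
  field_simp

theorem transform₂_sampleS (hm : 1 ≤ m) (hβ : ∀ j, (β j).1 ≤ m ∧ (β j).2 ≤ m) {ij : Fin J × Fin J}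
    {v : Fin J → ℝ × ℝ → ℝ} {g : ℝ × ℝ → ℝ} (h : IsWeakDeriv (β ij.1) (v ij.2) g)
    (hv : Integrable (v ij.2) volOmega) (hg : Integrable g volOmega) {k : ℤ × ℤ}
    (hk : k ∈ splineRange m 3 n ×ˢ splineRange m 3 n) :
    transform₂ m β n (sampleS m β n v) ij k = avg (normVarphiPair m (β ij.1) (β ij.2)) n g k := by
  have hf := (isSplineKernel_bspline hm).liftOp (hβ ij.2).1
  have hf' := (isSplineKernel_bspline hm).liftOp (hβ ij.2).2
  have hne := mul_ne_zero hf.integral_ne_zero hf'.integral_ne_zero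
  have hS : sampleS m β n v ij.2 = fun l => ((∫ t, liftOp m (β ij.2).1 (bspline m) t) *
      ∫ t, liftOp m (β ij.2).2 (bspline m) t)⁻¹ * avg (tensor (liftOp m (β ij.2).1 (bspline m))
        (liftOp m (β ij.2).2 (bspline m))) n (v ij.2) l := by
    funext l
    rw [sampleS_eq_avg hm (hβ ij.2), normVarphi, avg_normTensor]
  rw [normVarphiPair, avg_normTensor, ← h.conv_avg hv hg (hβ ij.1) hf hf' hk, transform₂, hS,
    conv_const_mul, cstPair_eq hm (hβ ij.1) (hβ ij.2), two_zpow_sub_two, mul_pow]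
  generalize (∫ t, liftOp m (β ij.2).1 (bspline m) t) *
    ∫ t, liftOp m (β ij.2).2 (bspline m) t = x at hne ⊢
  field_simp

end Sampling

/-! ### Sobolev functions -/

instance isProbabilityMeasure_volOmega : IsProbabilityMeasure volOmega :=
  ⟨by simp [Omega, Measure.volume_eq_prod, Measure.prod_prod]⟩

section Sobolev

variable {k : ℕ} {p r : ℝ≥0∞} [hp : Fact (1 ≤ p)]

theorem memLp_sobolevDeriv (u : Sobolev k p) (α : ℕ × ℕ) (h : α.1 + α.2 ≤ k) :
    MemLp (sobolevDeriv u α h) p volOmega := Lp.memLp _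

theorem integrable_sobolevDeriv (u : Sobolev k p) (α : ℕ × ℕ) (h : α.1 + α.2 ≤ k) :
    Integrable (sobolevDeriv u α h) volOmega := (memLp_sobolevDeriv u α h).integrable hp.out

theorem integrable_sobolevFun (u : Sobolev k p) : Integrable (sobolevFun u) volOmega :=
  integrable_sobolevDeriv _ _ _

theorem isWeakDeriv_sobolevDeriv (u : Sobolev k p) (α : ℕ × ℕ) (h : α.1 + α.2 ≤ k) :
    IsWeakDeriv α (sobolevFun u) (sobolevDeriv u α h) := u.2 ⟨α, mem_multiIndices.2 h⟩

theorem sobolevDeriv_sub (u v : Sobolev k p) (α : ℕ × ℕ) (h : α.1 + α.2 ≤ k) :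
    sobolevDeriv (u - v) α h =ᵐ[volOmega] sobolevDeriv u α h - sobolevDeriv v α h :=
  Lp.coeFn_sub _ _

theorem tendsto_eLpNorm_sobolevDeriv {ι : Type*} {l : Filter ι} {w : ι → Sobolev k p}
    {w' : Sobolev k p} (hw : Tendsto w l (𝓝 w')) (α : ℕ × ℕ) (h : α.1 + α.2 ≤ k) :
    Tendsto (fun n => eLpNorm (sobolevDeriv (w n) α h - sobolevDeriv w' α h) p volOmega) l
      (𝓝 0) := by
  have hcont : Continuous fun u : Sobolev k p =>
      (u : PiLp p fun _ : multiIndices k => Lp ℝ p volOmega) ⟨α, mem_multiIndices.2 h⟩ :=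
    (PiLp.continuous_apply p _ _).comp continuous_subtype_val
  exact (Lp.tendsto_Lp_iff_tendsto_eLpNorm' _ _).1 ((hcont.tendsto w').comp hw)

theorem eLpNorm_sobolevFun_le (hk : 1 ≤ k) (hr : r ≤ max 2 p) (u : Sobolev k p) :
    eLpNorm (sobolevFun u) r volOmega ≤ eLpNorm (sobolevFun u) p volOmega +
      eLpNorm (sobolevDeriv u (1, 0) hk) p volOmega +
      eLpNorm (sobolevDeriv u (0, 1) hk) p volOmega := by
  have hu := integrable_sobolevFun u
  have hone α (h : α.1 + α.2 ≤ k) :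
      eLpNorm (sobolevDeriv u α h) 1 volOmega ≤ eLpNorm (sobolevDeriv u α h) p volOmega :=
    eLpNorm_le_eLpNorm_of_exponent_le hp.out (memLp_sobolevDeriv u α h).1
  rcases le_max_iff.1 hr with hr2 | hrp
  · calc eLpNorm (sobolevFun u) r volOmega
        ≤ eLpNorm (sobolevFun u) 2 volOmega := eLpNorm_le_eLpNorm_of_exponent_le hr2 hu.1
      _ ≤ sobolevNormOne (sobolevFun u) (sobolevDeriv u (1, 0) hk) (sobolevDeriv u (0, 1) hk) :=
        eLpNorm_two_le_sobolevNormOne hu (integrable_sobolevDeriv u _ _)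
          (integrable_sobolevDeriv u _ _) (isWeakDeriv_sobolevDeriv u _ _)
          (isWeakDeriv_sobolevDeriv u _ _)
      _ ≤ _ := add_le_add (add_le_add (hone _ _) (hone _ _)) (hone _ _)
  · rw [add_assoc]
    exact (eLpNorm_le_eLpNorm_of_exponent_le hrp hu.1).trans le_self_add

theorem memLp_sobolevFun (hk : 1 ≤ k) (hr : r ≤ max 2 p) (u : Sobolev k p) :
    MemLp (sobolevFun u) r volOmega :=
  ⟨(integrable_sobolevFun u).1, (eLpNorm_sobolevFun_le hk hr u).trans_lt
    (ENNReal.add_lt_top.2 ⟨ENNReal.add_lt_top.2 ⟨(memLp_sobolevDeriv u _ _).2,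
      (memLp_sobolevDeriv u _ _).2⟩, (memLp_sobolevDeriv u _ _).2⟩)⟩

theorem tendsto_eLpNorm_sobolevFun (hk : 1 ≤ k) (hr : r ≤ max 2 p) {ι : Type*} {l : Filter ι}
    {w : ι → Sobolev k p} {w' : Sobolev k p} (hw : Tendsto w l (𝓝 w')) :
    Tendsto (fun n => eLpNorm (sobolevFun (w n) - sobolevFun w') r volOmega) l (𝓝 0) := by
  have hbound := ((tendsto_eLpNorm_sobolevDeriv hw 0 (by simp)).add
    (tendsto_eLpNorm_sobolevDeriv hw (1, 0) hk)).add (tendsto_eLpNorm_sobolevDeriv hw (0, 1) hk)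
  rw [add_zero, add_zero] at hbound
  refine tendsto_of_tendsto_of_tendsto_of_le_of_le tendsto_const_nhds hbound (fun _ => zero_le)
    fun n => ?_
  have hle := eLpNorm_sobolevFun_le hk hr (w n - w')
  simp only [sobolevFun] at hle ⊢
  simpa only [eLpNorm_congr_ae (sobolevDeriv_sub _ _ _ _)] using hle

end Sobolev

/-! ### Arrays as elements of `L_2(Ω)` -/

section Extension

variable {n : ℕ} {K : Set (ℤ × ℤ)}

open Classical in
/-- The extension by zero of an array on `K`. -/
def extendZero (K : Set (ℤ × ℤ)) (a : K → ℝ) (k : ℤ × ℤ) : ℝ :=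
  if h : k ∈ K then a ⟨k, h⟩ else 0

theorem extendZero_coe (a : K → ℝ) (k : K) : extendZero K a k = a k := by
  simp [extendZero]

theorem stepFun_congr {a b : ℤ × ℤ → ℝ} (h : ∀ k ∈ K, a k = b k) :
    stepFun n K a = stepFun n K b :=
  Set.indicator_congr fun _ hx => h _ hx

variable [Finite K]

variable (n) in
theorem memLp_stepFun_extendZero (a : K → ℝ) :
    MemLp (stepFun n K (extendZero K a)) 2 volOmega := by
  obtain ⟨M, hM⟩ := (Set.finite_range fun k => |a k|).bddAbove
  refine MemLp.of_bound (measurable_stepFun _ _ _).aestronglyMeasurable (max M 0)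
    (ae_of_all _ fun x => (norm_stepFun_le n K _ x).trans ?_)
  by_cases hx : cell n x ∈ K
  · rw [extendZero, dif_pos hx]
    exact (hM ⟨_, rfl⟩).trans (le_max_left _ _)
  · rw [extendZero, dif_neg hx, norm_zero]
    exact le_max_right _ _

variable (n K) in
/-- The step function of an array on the finite set `K`, as an element of `L_2(Ω)`. -/
def stepLp : (K → ℝ) →ₗ[ℝ] Lp ℝ 2 volOmega where
  toFun a := (memLp_stepFun_extendZero n a).toLp
  map_add' a b := by
    rw [← MemLp.toLp_add]
    congr 1
    funext x
    by_cases hx : cell n x ∈ K <;> simp [stepFun, extendZero, hx]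
  map_smul' c a := by
    rw [RingHom.id_apply, ← MemLp.toLp_const_smul]
    congr 1
    funext x
    by_cases hx : cell n x ∈ K <;> simp [stepFun, extendZero, hx]

theorem discreteNorm₂_eq_enorm (hK : K ⊆ boxIndex n) (a : K → ℝ) :
    discreteNorm₂ n K a = ‖stepLp n K a‖ₑ := by
  have hstep := discreteNorm_eq_eLpNorm (ι := Unit) hK two_ne_zero ENNReal.ofNat_ne_top
    fun _ => extendZero K a
  simp only [extendZero_coe, ENNReal.toReal_ofNat] at hstep
  rw [discreteNorm₂, hstep]
  change _ = ‖(memLp_stepFun_extendZero n a).toLp‖ₑ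
  rw [Lp.enorm_toLp]
  refine eLpNorm_congr_norm_ae (ae_of_all _ fun x => ?_)
  simp [EuclideanSpace.norm_eq, Real.sqrt_sq_eq_abs]

end Extension

theorem avg_congr_ae (κ : ℝ × ℝ → ℝ) (n : ℕ) {f g : ℝ × ℝ → ℝ} (h : f =ᵐ[volOmega] g) :
    avg κ n f = avg κ n g :=
  funext fun _ => integral_congr_ae (h.mono fun _ hy => congrArg (· * _) hy)

section AvgCLM

variable {κ : ℝ × ℝ → ℝ} {M R : ℝ}

theorem IsAvgKernel.memLp_scaled (h : IsAvgKernel κ M R) (n : ℕ) (k : ℤ × ℤ) :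
    MemLp (scaled κ n k) 2 volOmega :=
  MemLp.of_bound (h.measurable_scaled n k).aestronglyMeasurable _
    (ae_of_all _ (h.abs_scaled_le n k))

/-- The local averages with indices in `K`, as a continuous linear map on `L_2(Ω)`. -/
def avgCLM (h : IsAvgKernel κ M R) (n : ℕ) (K : Set (ℤ × ℤ)) : Lp ℝ 2 volOmega →L[ℝ] (K → ℝ) :=
  ContinuousLinearMap.pi fun k => innerSL ℝ (h.memLp_scaled n k).toLp

theorem avgCLM_apply (h : IsAvgKernel κ M R) (n : ℕ) (K : Set (ℤ × ℤ)) (u : Lp ℝ 2 volOmega)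
    (k : K) : avgCLM h n K u k = avg κ n u k := by
  simp only [avgCLM, ContinuousLinearMap.coe_pi', innerSL_apply_apply]
  rw [L2.inner_def, avg]
  refine integral_congr_ae ?_
  filter_upwards [(h.memLp_scaled n k).coeFn_toLp] with y hy
  rw [hy, RCLike.inner_apply, conj_trivial]

variable {K : ℕ → Set (ℤ × ℤ)} [∀ n, Finite (K n)]

theorem tendsto_stepLp_avgCLM (h : IsAvgKernel κ M R)
    (hK : ∀ x ∈ Omega, ∀ᶠ n in atTop, cell n x ∈ K n) (u : Lp ℝ 2 volOmega) :
    Tendsto (fun n => stepLp n (K n) (avgCLM h n (K n) u)) atTop (𝓝 u) := by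
  rw [Lp.tendsto_Lp_iff_tendsto_eLpNorm']
  refine (h.tendsto_eLpNorm_stepFun_avg_sub hK (Lp.memLp u) one_le_two
    ENNReal.ofNat_ne_top).congr fun n => eLpNorm_congr_ae ?_
  have hstep : stepFun n (K n) (avg κ n u) =
      stepFun n (K n) (extendZero (K n) (avgCLM h n (K n) u)) :=
    stepFun_congr fun k hk => by rw [extendZero, dif_pos hk, avgCLM_apply]
  rw [hstep]
  exact (memLp_stepFun_extendZero n (avgCLM h n (K n) u)).coeFn_toLp.symm.sub .rfl

end AvgCLM

theorem tendsto_apply_of_tendsto_pointwise {𝕜 E F : Type*} [NontriviallyNormedField 𝕜]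
    [NormedAddCommGroup E] [NormedSpace 𝕜 E] [CompleteSpace E] [NormedAddCommGroup F]
    [NormedSpace 𝕜 F] {B : ℕ → E →L[𝕜] F} {A : E → F}
    (hB : ∀ v, Tendsto (fun n => B n v) atTop (𝓝 (A v))) {l : Filter ℕ} (hl : l ≤ atTop)
    {U : ℕ → E} {u : E} (hU : Tendsto U l (𝓝 u)) :
    Tendsto (fun n => B n (U n)) l (𝓝 (A u)) := by
  obtain ⟨c, hc⟩ := banach_steinhaus (g := B) fun v => by
    obtain ⟨c, hc⟩ := (hB v).norm.bddAbove_range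
    exact ⟨c, fun n => hc ⟨n, rfl⟩⟩
  have hzero : Tendsto (fun n => c * ‖U n - u‖) l (𝓝 0) := by
    simpa using (tendsto_iff_norm_sub_tendsto_zero.1 hU).const_mul c
  have hsub : Tendsto (fun n => B n (U n - u)) l (𝓝 0) :=
    squeeze_zero_norm (fun n => (B n).le_of_opNorm_le (hc n) _) hzero
  simpa using hsub.add ((hB u).mono_left hl)

-- The operators `stepLp ∘ A_n ∘ avgCLM` on `L_2(Ω)` converge pointwise to `A`, so they are
-- uniformly bounded although no bound on the `A_n` is assumed.
theorem tendsto_stepLp_of_consistent {κ : ℝ × ℝ → ℝ} {M R : ℝ} (h : IsAvgKernel κ M R)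
    {K : ℕ → Set (ℤ × ℤ)} [∀ n, Finite (K n)] (hK : ∀ x ∈ Omega, ∀ᶠ n in atTop, cell n x ∈ K n)
    {A : Lp ℝ 2 volOmega → Lp ℝ 2 volOmega} {An : (n : ℕ) → (K n → ℝ) →ₗ[ℝ] (K n → ℝ)}
    (hA : ∀ u, Tendsto (fun n => stepLp n (K n)
      (avgCLM h n (K n) (A u) - An n (avgCLM h n (K n) u))) atTop (𝓝 0))
    {l : Filter ℕ} (hl : l ≤ atTop) {U : ℕ → Lp ℝ 2 volOmega} {u : Lp ℝ 2 volOmega}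
    (hU : Tendsto U l (𝓝 u)) :
    Tendsto (fun n => stepLp n (K n) (An n (avgCLM h n (K n) (U n)))) l (𝓝 (A u)) := by
  let B (n : ℕ) : Lp ℝ 2 volOmega →L[ℝ] Lp ℝ 2 volOmega :=
    (LinearMap.toContinuousLinearMap (stepLp n (K n) ∘ₗ An n)).comp (avgCLM h n (K n))
  refine tendsto_apply_of_tendsto_pointwise (B := B) (fun v => ?_) hl hU
  simpa [B] using (tendsto_stepLp_avgCLM h hK (A v)).sub (hA v)

/-! ### Convergence of the discrete energies -/

section Energy

variable {m J C : ℕ} {β : Fin J → ℕ × ℕ} {p q r : ℝ≥0∞}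

theorem one_le_maxOrder (hs : ∃ j, β j ≠ 0) : 1 ≤ maxOrder β := by
  obtain ⟨j, hj⟩ := hs
  refine le_trans ?_ (order_le_maxOrder β j)
  rw [Ne, Prod.ext_iff, not_and_or, Prod.fst_zero, Prod.snd_zero] at hj
  omega

theorem order_le_two_mul_maxOrder (β : Fin J → ℕ × ℕ) (j : Fin J) :
    (β j).1 + (β j).2 ≤ 2 * maxOrder β :=
  (order_le_maxOrder β j).trans (by omega)

theorem indexK_subset_boxIndex (hm : 1 ≤ m) (hβ : ∀ j, (β j).1 ≤ m ∧ (β j).2 ≤ m) (C n : ℕ) :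
    indexK m β C n ⊆ boxIndex n := by
  rw [indexK_eq hm hβ]
  exact splineRange_prod_subset_boxIndex hm C.succ_ne_zero

theorem indexK_subset_splineRange (hm : 1 ≤ m) (hβ : ∀ j, (β j).1 ≤ m ∧ (β j).2 ≤ m) {c n : ℕ}
    (hc : c ≤ C + 1) : indexK m β C n ⊆ splineRange m c n ×ˢ splineRange m c n := by
  rw [indexK_eq hm hβ]
  exact Set.prod_mono (splineRange_anti hc) (splineRange_anti hc)

theorem eventually_cell_mem_indexK (hm : 1 ≤ m) (hβ : ∀ j, (β j).1 ≤ m ∧ (β j).2 ≤ m) (C : ℕ)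
    {x : ℝ × ℝ} (hx : x ∈ Omega) : ∀ᶠ n in atTop, cell n x ∈ indexK m β C n := by
  simpa only [indexK_eq hm hβ] using eventually_cell_mem_splineRange m (C + 1) hx

theorem tendsto_discreteNorm_of_eq_avg {ι : Type} [Fintype ι] {K : ℕ → Set (ℤ × ℤ)}
    (hK : ∀ n, K n ⊆ boxIndex n) (hK' : ∀ x ∈ Omega, ∀ᶠ n in atTop, cell n x ∈ K n)
    {κ : ι → ℝ × ℝ → ℝ} (hκ : ∀ i, ∃ M R, IsAvgKernel (κ i) M R) (hr : 1 ≤ r) (hr' : r ≠ ⊤)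
    {l : Filter ℕ} (hl : l ≤ atTop) {a : ℕ → ι → ℤ × ℤ → ℝ} {G : ℕ → ι → ℝ × ℝ → ℝ}
    {g : ι → ℝ × ℝ → ℝ} (ha : ∀ n i, ∀ k ∈ K n, a n i k = avg (κ i) n (G n i) k)
    (hG : ∀ n i, MemLp (G n i) r volOmega) (hg : ∀ i, MemLp (g i) r volOmega)
    (hlim : ∀ i, Tendsto (fun n => eLpNorm (G n i - g i) r volOmega) l (𝓝 0)) :
    Tendsto (fun n => discreteNorm n (K n) r.toReal fun i k => a n i k) l
      (𝓝 (continuumNorm r.toReal g)) := by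
  refine tendsto_discreteNorm hK hr hr' hg fun i => ?_
  obtain ⟨M, R, h⟩ := hκ i
  simpa only [stepFun_congr (ha _ i)] using
    h.tendsto_eLpNorm_stepFun_avg hK' hr hr' hl (fun n => hG n i) (hg i) (hlim i)

theorem tendsto_eLpNorm_sub_sub {α ι : Type*} [MeasurableSpace α] {μ : Measure α} (hr : 1 ≤ r)
    {l : Filter ι} {F G : ι → α → ℝ} {f g : α → ℝ} (hF : ∀ n, AEStronglyMeasurable (F n) μ)
    (hG : ∀ n, AEStronglyMeasurable (G n) μ) (hf : AEStronglyMeasurable f μ)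
    (hg : AEStronglyMeasurable g μ) (hFf : Tendsto (fun n => eLpNorm (F n - f) r μ) l (𝓝 0))
    (hGg : Tendsto (fun n => eLpNorm (G n - g) r μ) l (𝓝 0)) :
    Tendsto (fun n => eLpNorm (F n - G n - (f - g)) r μ) l (𝓝 0) := by
  have hsum := hFf.add hGg
  rw [add_zero] at hsum
  refine tendsto_of_tendsto_of_tendsto_of_le_of_le tendsto_const_nhds hsum (fun _ => zero_le)
    fun n => ?_
  simpa only [sub_sub_sub_comm] using eLpNorm_sub_le ((hF n).sub hf) ((hG n).sub hg) hr

theorem exists_isAvgKernel_normVarphi (hm : 1 ≤ m) {b : ℕ × ℕ} (hb : b.1 ≤ m ∧ b.2 ≤ m) :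
    ∃ M R, IsAvgKernel (normVarphi m b) M R :=
  have h₁ := (isSplineKernel_bspline hm).liftOp hb.1
  have h₂ := (isSplineKernel_bspline hm).liftOp hb.2
  exists_isAvgKernel_normTensor h₁.toIsKernel h₂.toIsKernel h₁.integral_ne_zero h₂.integral_ne_zero

theorem exists_isAvgKernel_normVarphiPair (hm : 1 ≤ m) {a b : ℕ × ℕ} (ha : a.1 ≤ m ∧ a.2 ≤ m)
    (hb : b.1 ≤ m ∧ b.2 ≤ m) : ∃ M R, IsAvgKernel (normVarphiPair m a b) M R :=
  have h₁ := ((isSplineKernel_bspline hm).liftOp hb.1).liftOp ha.1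
  have h₂ := ((isSplineKernel_bspline hm).liftOp hb.2).liftOp ha.2
  exists_isAvgKernel_normTensor h₁.toIsKernel h₂.toIsKernel h₁.integral_ne_zero h₂.integral_ne_zero

section Sobolev

variable [hp : Fact (1 ≤ p)] [hq : Fact (1 ≤ q)] {l : Filter ℕ}

theorem tendsto_discreteNorm_transform₁_sub (hm : 1 ≤ m) (hC : 1 ≤ C)
    (hβ : ∀ j, (β j).1 ≤ m ∧ (β j).2 ≤ m) (hs : 1 ≤ maxOrder β) (hpq : p ≤ max 2 q) (hpt : p ≠ ⊤)
    (hl : l ≤ atTop) {w : ℕ → EnergySpace β p q} {w' : EnergySpace β p q}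
    (hw : Tendsto w l (𝓝 w')) :
    Tendsto (fun n => discreteNorm n (indexK m β C n) p.toReal
      (fun j k => transform₁ m β n (sampleT m n (sobolevFun (w n).1)) j k -
        sampleS m β n (fun i => sobolevFun ((w n).2 i)) j k)) l
      (𝓝 (continuumNorm p.toReal (fun j x =>
        sobolevDeriv w'.1 (β j) (order_le_two_mul_maxOrder β j) x - sobolevFun (w'.2 j) x))) := by
  let G (x : EnergySpace β p q) (j : Fin J) : ℝ × ℝ → ℝ :=
    sobolevDeriv x.1 (β j) (order_le_two_mul_maxOrder β j) - sobolevFun (x.2 j)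
  have hG x j : MemLp (G x j) p volOmega :=
    (memLp_sobolevDeriv _ _ _).sub (memLp_sobolevFun hs hpq _)
  have hw₁ : Tendsto (fun n => (w n).1) l (𝓝 w'.1) := hw.fst_nhds
  have hw₂ j : Tendsto (fun n => (w n).2 j) l (𝓝 (w'.2 j)) := tendsto_pi_nhds.1 hw.snd_nhds j
  refine tendsto_discreteNorm_of_eq_avg (G := fun n => G (w n)) (g := G w')
    (a := fun n j k => transform₁ m β n (sampleT m n (sobolevFun (w n).1)) j k -
      sampleS m β n (fun i => sobolevFun ((w n).2 i)) j k)
    (indexK_subset_boxIndex hm hβ C) (fun x => eventually_cell_mem_indexK hm hβ C)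
    (fun j => exists_isAvgKernel_normVarphi hm (hβ j)) hp.out hpt hl (fun n j k hk => ?_)
    (fun n => hG (w n)) (hG w') fun j => ?_
  · obtain ⟨M, R, h⟩ := exists_isAvgKernel_normVarphi hm (hβ j)
    rw [h.avg_sub n (integrable_sobolevDeriv _ _ _) (integrable_sobolevFun _), Pi.sub_apply,
      transform₁_sampleT hm (hβ j) (isWeakDeriv_sobolevDeriv _ _ _) (integrable_sobolevFun _)
        (integrable_sobolevDeriv _ _ (order_le_two_mul_maxOrder β j))
        (indexK_subset_splineRange hm hβ (by omega) hk), sampleS_eq_avg hm (hβ j)]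
  · exact tendsto_eLpNorm_sub_sub hp.out (fun n => (memLp_sobolevDeriv _ _ _).1)
      (fun n => (integrable_sobolevFun _).1) (memLp_sobolevDeriv _ _ _).1
      (integrable_sobolevFun _).1 (tendsto_eLpNorm_sobolevDeriv hw₁ _ _)
      (tendsto_eLpNorm_sobolevFun hs hpq (hw₂ j))

theorem tendsto_discreteNorm_transform₂ (hm : 1 ≤ m) (hC : 2 ≤ C)
    (hβ : ∀ j, (β j).1 ≤ m ∧ (β j).2 ≤ m) (hqt : q ≠ ⊤) (hl : l ≤ atTop)
    {v : ℕ → Fin J → Sobolev (maxOrder β) q} {v' : Fin J → Sobolev (maxOrder β) q}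
    (hv : Tendsto v l (𝓝 v')) :
    Tendsto (fun n => discreteNorm n (indexK m β C n) q.toReal
      (fun ij k => transform₂ m β n (sampleS m β n fun i => sobolevFun (v n i)) ij k)) l
      (𝓝 (continuumNorm q.toReal (fun (ij : Fin J × Fin J) x =>
        sobolevDeriv (v' ij.2) (β ij.1) (order_le_maxOrder β ij.1) x))) := by
  let G (v : Fin J → Sobolev (maxOrder β) q) (ij : Fin J × Fin J) : ℝ × ℝ → ℝ :=
    sobolevDeriv (v ij.2) (β ij.1) (order_le_maxOrder β ij.1)
  have hG v ij : MemLp (G v ij) q volOmega := memLp_sobolevDeriv _ _ _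
  refine tendsto_discreteNorm_of_eq_avg (G := fun n => G (v n)) (g := G v')
    (a := fun n ij k => transform₂ m β n (sampleS m β n fun i => sobolevFun (v n i)) ij k)
    (indexK_subset_boxIndex hm hβ C) (fun x => eventually_cell_mem_indexK hm hβ C)
    (fun ij => exists_isAvgKernel_normVarphiPair hm (hβ ij.1) (hβ ij.2)) hq.out hqt hl
    (fun n ij k hk => ?_) (fun n => hG (v n)) (hG v') fun ij => ?_
  · exact transform₂_sampleS hm hβ (isWeakDeriv_sobolevDeriv _ _ _) (integrable_sobolevFun _)
      (integrable_sobolevDeriv _ _ _) (indexK_subset_splineRange hm hβ (by omega) hk)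
  · exact tendsto_eLpNorm_sobolevDeriv (tendsto_pi_nhds.1 hv ij.2) _ _

end Sobolev

theorem sampleTK_eq_avgCLM {M R : ℝ} (hm : 1 ≤ m)
    (h : IsAvgKernel (normTensor (bspline m) (bspline m)) M R) (n : ℕ) {g : ℝ × ℝ → ℝ}
    (hg : MemLp g 2 volOmega) :
    sampleTK m β C n g = avgCLM h n (indexK m β C n) hg.toLp := by
  funext k
  rw [avgCLM_apply, sampleTK, sampleT_eq_avg hm, avg_congr_ae _ _ hg.coeFn_toLp]

/-- The discretizations `A_n` of `A` are consistent with the sampling operators `T_n`: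
`‖T_n A u - A_n T_n u‖ → 0` in `ℓ_2(K_n)` for every `u ∈ L_2(Ω)`. -/
def IsConsistent (A : Lp ℝ 2 volOmega →ₗ[ℝ] Lp ℝ 2 volOmega)
    (An : (n : ℕ) → (indexK m β C n → ℝ) →ₗ[ℝ] (indexK m β C n → ℝ)) : Prop :=
  ∀ u : Lp ℝ 2 volOmega, Tendsto (fun n => discreteNorm₂ n (indexK m β C n)
    (sampleTK m β C n (A u) - An n (sampleTK m β C n u))) atTop (𝓝 0)

variable {f : Lp ℝ 2 volOmega} {A : Lp ℝ 2 volOmega →ₗ[ℝ] Lp ℝ 2 volOmega}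
  {An : (n : ℕ) → (indexK m β C n → ℝ) →ₗ[ℝ] (indexK m β C n → ℝ)} {l : Filter ℕ}

theorem IsConsistent.tendsto_discreteNorm₂ (hA : IsConsistent A An) (hm : 1 ≤ m)
    (hβ : ∀ j, (β j).1 ≤ m ∧ (β j).2 ≤ m) (hl : l ≤ atTop) {u : ℕ → ℝ × ℝ → ℝ}
    {u' : ℝ × ℝ → ℝ} (hu : ∀ n, MemLp (u n) 2 volOmega) (hu' : MemLp u' 2 volOmega)
    (hlim : Tendsto (fun n => eLpNorm (u n - u') 2 volOmega) l (𝓝 0)) :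
    Tendsto (fun n => discreteNorm₂ n (indexK m β C n)
      (An n (sampleTK m β C n (u n)) - sampleTK m β C n f)) l (𝓝 (fidelity A f u')) := by
  have hB := isSplineKernel_bspline hm
  obtain ⟨M, R, h⟩ := exists_isAvgKernel_normTensor hB.toIsKernel hB.toIsKernel
    hB.integral_ne_zero hB.integral_ne_zero
  have hbox := indexK_subset_boxIndex hm hβ C
  have hfin n : Finite (indexK m β C n) := ((finite_boxIndex n).subset (hbox n)).to_subtype
  have hK x (hx : x ∈ Omega) := eventually_cell_mem_indexK hm hβ C hx
  have hT n (g : Lp ℝ 2 volOmega) :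
      sampleTK m β C n g = avgCLM h n (indexK m β C n) g := by
    rw [sampleTK_eq_avgCLM hm h n (Lp.memLp g), Lp.toLp_coeFn]
  have hconsistent v : Tendsto (fun n => stepLp n (indexK m β C n)
      (avgCLM h n (indexK m β C n) (A v) - An n (avgCLM h n (indexK m β C n) v))) atTop
      (𝓝 0) := by
    rw [tendsto_zero_iff_enorm_tendsto_zero]
    simpa only [hT, discreteNorm₂_eq_enorm (hbox _)] using hA v
  have hsub := (tendsto_stepLp_of_consistent h hK hconsistent hl
    ((Lp.tendsto_Lp_iff_tendsto_eLpNorm'' u hu u' hu').2 hlim)).sub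
    ((tendsto_stepLp_avgCLM h hK f).mono_left hl)
  rw [fidelity, dif_pos hu']
  simpa only [← map_sub, hT, ← sampleTK_eq_avgCLM hm h _ (hu _), discreteNorm₂_eq_enorm (hbox _)]
    using hsub.enorm

theorem IsConsistent.tendsto_discreteEnergy [Fact (1 ≤ p)] [Fact (1 ≤ q)]
    (hA : IsConsistent A An) (hm : 1 ≤ m) (hC : 2 ≤ C) (hβ : ∀ j, (β j).1 ≤ m ∧ (β j).2 ≤ m)
    (hs : ∃ j, β j ≠ 0) (hp : p ≤ max 2 q) (hq : q ≠ ⊤) (ν₁ ν₂ : ℝ≥0) (hl : l ≤ atTop)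
    {w : ℕ → EnergySpace β p q} {w' : EnergySpace β p q} (hw : Tendsto w l (𝓝 w')) :
    Tendsto (fun n => discreteEnergy m β C p q ν₁ ν₂ f n (An n) (w n)) l
      (𝓝 (energy β p q ν₁ ν₂ A f w')) := by
  have hs' := one_le_maxOrder hs
  have hs₂ : 1 ≤ 2 * maxOrder β := by omega
  have hpt : p ≠ ⊤ := (hp.trans_lt (max_lt ENNReal.ofNat_lt_top hq.lt_top)).ne
  have hfidelity := hA.tendsto_discreteNorm₂ (f := f) hm hβ hl
    (fun n => memLp_sobolevFun hs₂ (le_max_left 2 p) (w n).1)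
    (memLp_sobolevFun hs₂ (le_max_left 2 p) w'.1)
    (tendsto_eLpNorm_sobolevFun hs₂ (le_max_left 2 p) hw.fst_nhds)
  have hsparsity := tendsto_discreteNorm_transform₁_sub hm (by omega : 1 ≤ C) hβ hs' hp hpt hl hw
  have hsmoothness := tendsto_discreteNorm_transform₂ hm hC hβ hq hl hw.snd_nhds
  exact ((ENNReal.Tendsto.const_mul (hsparsity.ennrpow_const _) (Or.inr ENNReal.coe_ne_top)).add
    (ENNReal.Tendsto.const_mul (hsmoothness.ennrpow_const _) (Or.inr ENNReal.coe_ne_top))).add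
    (ENNReal.Tendsto.const_mul (ENNReal.Tendsto.pow hfidelity) (Or.inr (by simp)))

end Energy

theorem isEpsOptimal_of_mapClusterPt {ι : Type*} {L : Filter ι} {X : Type} [TopologicalSpace X]
    {F : ι → X → ℝ≥0∞} {G : X → ℝ≥0∞}
    (hF : ∀ l ≤ L, ∀ (w : ι → X) (w' : X), Tendsto w l (𝓝 w') →
      Tendsto (fun n => F n (w n)) l (𝓝 (G w')))
    {ε : ℝ≥0} {w : ι → X} {w' : X} (hw : ∀ n, IsEpsOptimal (F n) ε (w n))
    (hw' : MapClusterPt w' L w) : IsEpsOptimal G ε w' := by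
  obtain ⟨U, hU, hlim⟩ := mapClusterPt_iff_ultrafilter.1 hw'
  rw [IsEpsOptimal, ENNReal.iInf_add]
  refine le_iInf fun y => ?_
  have hrecovery := (hF U hU (fun _ => y) y tendsto_const_nhds).add_const (ε : ℝ≥0∞)
  refine le_of_tendsto_of_tendsto' (hF U hU w w' hlim) hrecovery fun n => ?_
  exact (hw n).trans (add_le_add_left (iInf_le _ y) _)

end

end WaveletFrame

theorem corollary3p2_general
    {m J C : ℕ} (hm : 1 ≤ m) (hC : 2 ≤ C) {β : Fin J → ℕ × ℕ} (hs : ∃ j, β j ≠ 0)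
    (hβ : ∀ j, (β j).1 ≤ m ∧ (β j).2 ≤ m) {p q : ℝ≥0∞} [Fact (1 ≤ p)] [Fact (1 ≤ q)]
    (hp : p ≤ max 2 q) (hq : q ≠ ⊤) {ν₁ ν₂ : ℝ≥0} {f : Lp ℝ 2 volOmega}
    {A : Lp ℝ 2 volOmega →ₗ[ℝ] Lp ℝ 2 volOmega}
    {An : (n : ℕ) → (indexK m β C n → ℝ) →ₗ[ℝ] (indexK m β C n → ℝ)}
    (hA : ∀ u : Lp ℝ 2 volOmega, Tendsto
      (fun n => discreteNorm₂ n (indexK m β C n)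
        (sampleTK m β C n (A u) - An n (sampleTK m β C n u))) atTop (𝓝 0))
    {ε : ℝ≥0} {w : ℕ → EnergySpace β p q} {w' : EnergySpace β p q}
    (hw : ∀ n, IsEpsOptimal (discreteEnergy m β C p q ν₁ ν₂ f n (An n)) ε (w n))
    (hw' : MapClusterPt w' atTop w) : IsEpsOptimal (energy β p q ν₁ ν₂ A f) ε w' :=
  isEpsOptimal_of_mapClusterPt
    (fun _ hl _ _ => IsConsistent.tendsto_discreteEnergy hA hm hC hβ hs hp hq ν₁ ν₂ hl) hw hw'

theorem corollary3p2
    (m J C : ℕ) (hm : 1 ≤ m) (hJ : 1 ≤ J) (hC : 2 ≤ C)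
    (β : Fin J → ℕ × ℕ) (hβ : ∀ j, β j ≠ 0 ∧ (β j).1 ≤ m ∧ (β j).2 ≤ m)
    (p q : ℝ≥0∞) [Fact (1 ≤ p)] [Fact (1 ≤ q)] (hp : p ≤ 2) (hq : q ≤ 2)
    (ν₁ ν₂ : ℝ≥0) (f : Lp ℝ 2 volOmega)
    (A : Lp ℝ 2 volOmega →ₗ[ℝ] Lp ℝ 2 volOmega)
    (An : (n : ℕ) → (indexK m β C n → ℝ) →ₗ[ℝ] (indexK m β C n → ℝ))
    (hA : ∀ u : Lp ℝ 2 volOmega, Tendsto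
      (fun n => discreteNorm₂ n (indexK m β C n)
        (sampleTK m β C n (A u) - An n (sampleTK m β C n u))) atTop (𝓝 0)) :
    (∀ ε : ℝ≥0, 0 < ε → ∀ (w : ℕ → EnergySpace β p q) (w' : EnergySpace β p q),
      (∀ n, IsEpsOptimal (discreteEnergy m β C p q ν₁ ν₂ f n (An n)) ε (w n)) →
      MapClusterPt w' atTop w →
      IsEpsOptimal (energy β p q ν₁ ν₂ A f) ε w') ∧
    (∀ (w : ℕ → EnergySpace β p q) (w' : EnergySpace β p q),
      (∀ n, IsMinimizer (discreteEnergy m β C p q ν₁ ν₂ f n (An n)) (w n)) →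
      MapClusterPt w' atTop w →
      IsMinimizer (energy β p q ν₁ ν₂ A f) w') := by
  have hgeneral (ε : ℝ≥0) w w' :=
    corollary3p2_general (ν₁ := ν₁) (ν₂ := ν₂) (f := f) (ε := ε) (w := w) (w' := w') hm hC
      ⟨⟨0, hJ⟩, (hβ _).1⟩ (fun j => (hβ j).2) (hp.trans (le_max_left 2 q))
      (hq.trans_lt ENNReal.ofNat_lt_top).ne hA
  exact ⟨fun ε _ => hgeneral ε, hgeneral 0⟩
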